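/- Let $K,T\ge 1$, $M\ge 2$, $N\ge K+T$, put $r=K+T-1$, and let $F$ be a finite field. $M$ messages $W^1,\dots,W^M\in F^L$ (independent, uniform) are stored on $N$ servers: each message is arranged as an $(L/K)\times K$ matrix, whose rows are encoded with an $(N,K)$-MDS code $C\subseteq F^N$. A query to server $i$ is a vector $q\in F^{ML/K}$ (one block of length $L/K$ for every message), and the answer is its inner product with the data $D_i\in F^{ML/K}$ stored there. An $(N,K,T,M)$-PIR scheme gives, for every $m$, a random family of queries such that the desired message $W^m$ has conditional entropy $0$ given the answers (and the queries, which the user knows) and the queries sent to any $T$ servers have mutual information $0$ with the (uniform) index $m$; its rate is $L$ divided by the number of queries. The star-product one-shot scheme of Freij-Hollanti et al. uses an $(N,T)$-MDS retrieval code $D\subseteq F^N$ such that the star product $C\star D$ (the span of the coordinatewise products of codewords) is an $(N,K+T-1)$-MDS code. Its noise $(q_1,\dots,q_N)$ consists of independent uniform codewords of $D$, one for each of the $ML/K$ coordinates; server $i$ receives $q_i$ if $i\le r$, and $q_i+a_i$ with a vector $a_i$ that queries the desired message only if $i>r$. Such pairs include all generalized Reed–Solomon codes $C=\mathrm{GRS}_K(x,y)$,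 $D=\mathrm{GRS}_T(x,z)$ with the same distinct evaluation points $x_1,\dots,x_N\in F$ and nonzero multipliers $y_i,z_i$. The symbolic matrices (with $N$ columns, one per server) are $S_2=(1,\dots,1,2,\dots,2)$, with $r$ ones and $N-r$ twos, and $S_{j+1}$, which consists of $S_j,\sigma(S_j),\dots,\sigma^{r-1}(S_j)$ ($\sigma$ is the cyclic shift of the columns to the left), followed by one new row for every entry of $S_j$ equal to $j$; if this entry is in column $c$, the new row is $0$ in the columns $c,c-1,\dots,c-r+1$ (cyclically) and $j+1$ in the other $N-r$ columns. The row of $S_2$ is a group of level $1$; the groups of $S_{j+1}$ are those of the shifted copies of $S_j$ and, for every entry $j$ of $S_j$, the group of level $j$ formed by its $r$ shifted copies and the $N-r$ new entries $j+1$ of its new row. A scheme is obtained by refining and lifting the one-shot scheme if its queries are given by some number of repetitions of $S_M$, an entry $k\ge 1$ standing for one query for every set of $k$ messages, which is a sum of $k$ queries, one to each of these messages, such that, when $W^m$ is desired, the answers to the parts that query $W^m$ are linearly independent and, for every repetition, every group of level $k$ and every set $s\not\ni m$ of $k$ messages, the queries for $s$ at the entries $k$ of the group and the queries for $s\cup\{m\}$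 at its entries $k+1$, without their part querying $W^m$, form a realization of the noise of the one-shot scheme. **Theorem 2.** For every such pair $C,D$ there is a message length $L$, divisible by $K$, for which the noise of the star-product scheme, with suitable $a_i$, gives a one-shot scheme of codimension $r=K+T-1$ (for each desired message: any $T$ queries are independent and uniform, the answers $\langle D_i,a_i\rangle$, $i>r$, are linearly independent, and each $\langle D_i,q_i\rangle$ with $i>r$ is a fixed linear combination of $\langle D_1,q_1\rangle,\dots,\langle D_r,q_r\rangle$), and refining and lifting this scheme gives an $(N,K,T,M)$-PIR scheme $\mathcal Q$ with rate $$R_{\mathcal Q}=\frac{(N-K-T+1)N^{M-1}}{N^M-(K+T-1)^M}=\frac{1-\frac{K+T-1}{N}}{1-\left(\frac{K+T-1}{N}\right)^M}.$$ -/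

import Mathlib

noncomputable section

namespace OneShotPIR

/-! ## Codes -/

/-- The linear code generated by the rows of `G`. -/
def rowSpace {F : Type*} [Field F] {K N : ℕ} (G : Matrix (Fin K) (Fin N) F) :
    Submodule F (Fin N → F) :=
  Submodule.span F (Set.range fun k : Fin K => G k)

/-- `C` is an `(N, k)`-MDS code: it has dimension `k` and every nonzero codeword has
Hamming weight at least `N - k + 1`. -/
def IsMDS {F : Type*} [Field F] [DecidableEq F] {N : ℕ} (k : ℕ)
    (C : Submodule F (Fin N → F)) : Prop :=
  Module.finrank F C = k ∧ ∀ c ∈ C, c ≠ 0 → N + 1 ≤ hammingNorm c + k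

/-- The generator matrix of the generalized Reed-Solomon code of dimension `k` with evaluation
points `x` and column multipliers `y`. -/
def grsMatrix {F : Type*} [Field F] {N : ℕ} (k : ℕ) (x y : Fin N → F) :
    Matrix (Fin k) (Fin N) F :=
  Matrix.of fun a i => y i * x i ^ (a : ℕ)

/-- A storage code `C` of dimension `K` and a retrieval code `D` of dimension `T`, both MDS, whose
star product is an MDS code of the smallest possible dimension `K + T - 1`.
(The product of submodules of the algebra `Fin N → F` is the span of all coordinatewise products
of codewords, that is, the star product of the codes.) -/
def IsStarPair {F : Type*} [Field F] [DecidableEq F] {N : ℕ} (K T : ℕ)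
    (C D : Submodule F (Fin N → F)) : Prop :=
  IsMDS K C ∧ IsMDS T D ∧ IsMDS (K + T - 1) (C * D)

/-! ## Coded storage, queries and responses -/

/-- `M` messages; each is an element of `F ^ L` with `L = ℓ * K`, arranged as an `ℓ × K` matrix,
every row of which is encoded separately. -/
abbrev Messages (F : Type*) (M K ℓ : ℕ) := Fin M → Fin ℓ → Fin K → F

/-- A linear query: a vector of length `M * ℓ = M * L / K`, the `j`-th block of which queries the
`j`-th message. -/
abbrev Query (F : Type*) (M ℓ : ℕ) := Fin M → Fin ℓ → F

/-- The data stored on server `i`. -/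
def stored {F : Type*} [Field F] {N K M ℓ : ℕ} (G : Matrix (Fin K) (Fin N) F)
    (W : Messages F M K ℓ) (i : Fin N) : Query F M ℓ :=
  fun j l => ∑ k, W j l k * G k i

/-- The response of server `i` to the query `q`: the inner product with the stored data. -/
def response {F : Type*} [Field F] {N K M ℓ : ℕ} (G : Matrix (Fin K) (Fin N) F)
    (W : Messages F M K ℓ) (i : Fin N) (q : Query F M ℓ) : F :=
  ∑ j, ∑ l, stored G W i j l * q j l

/-! ## Shannon entropy of finite random variables -/

/-- Shannon entropy (in nats) of the random variable `X`. -/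
def entropy {Ω α : Type*} [Fintype α] (p : PMF Ω) (X : Ω → α) : ℝ :=
  ∑ a, Real.negMulLog ((p.map X) a).toReal

/-- Conditional entropy `H(X | Y)`. -/
def condEntropy {Ω α β : Type*} [Fintype α] [Fintype β] (p : PMF Ω) (X : Ω → α) (Y : Ω → β) : ℝ :=
  entropy p (fun ω => (X ω, Y ω)) - entropy p Y

/-- Mutual information `I(X ; Y)`. -/
def mutualInfo {Ω α β : Type*} [Fintype α] [Fintype β] (p : PMF Ω) (X : Ω → α) (Y : Ω → β) : ℝ :=
  entropy p X + entropy p Y - entropy p (fun ω => (X ω, Y ω))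

/-! ## PIR schemes -/

/-- The queries of a scheme are labelled by a finite type `ι`. For every desired message `m`, a
scheme gives the joint law of all the queries that the user sends. The server which receives the
query with a given label is recorded by a map `server : ι → Fin N`. -/
abbrev Scheme (F : Type*) (M ℓ : ℕ) (ι : Type*) := Fin M → PMF (ι → Query F M ℓ)

/-- The joint law of the messages, which are independent and uniform, and of the queries sent for
the desired message `m`, which are independent of the messages. -/
def dataLaw {F : Type*} [Field F] [Fintype F] [DecidableEq F] {M K ℓ : ℕ} {ι : Type*}
    (Q : Scheme F M ℓ ι) (m : Fin M) : PMF (Messages F M K ℓ × (ι → Query F M ℓ)) :=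
  (PMF.uniformOfFintype (Messages F M K ℓ)).bind fun W => (Q m).map fun q => (W, q)

/-- The joint law of the desired index, which is uniform, and of the queries. -/
def indexLaw {F : Type*} {M ℓ : ℕ} [NeZero M] {ι : Type*} (Q : Scheme F M ℓ ι) :
    PMF (Fin M × (ι → Query F M ℓ)) :=
  (PMF.uniformOfFintype (Fin M)).bind fun m => (Q m).map fun q => (m, q)

/-- Correctness: the desired message has zero entropy given the answers
(and the queries, which the user knows). -/
def IsCorrect {F : Type*} [Field F] [Fintype F] [DecidableEq F] {N K M ℓ : ℕ}
    {ι : Type*} [Fintype ι] [DecidableEq ι]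
    (G : Matrix (Fin K) (Fin N) F) (server : ι → Fin N) (Q : Scheme F M ℓ ι) : Prop :=
  ∀ m : Fin M, condEntropy (dataLaw (K := K) Q m) (fun ω => ω.1 m)
    (fun ω => (ω.2, fun s : ι => response G ω.1 (server s) (ω.2 s))) = 0

/-- `T`-privacy: the queries received by any `T` servers carry no information about the index of
the desired message. -/
def IsPrivate {F : Type*} [Fintype F] {N M ℓ : ℕ} [NeZero M]
    {ι : Type*} [Fintype ι] [DecidableEq ι] (T : ℕ) (server : ι → Fin N)
    (Q : Scheme F M ℓ ι) : Prop :=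
  ∀ J : Finset (Fin N), J.card = T →
    mutualInfo (indexLaw Q) (fun ω => fun s : {s : ι // server s ∈ J} => ω.2 s.1)
      (fun ω => ω.1) = 0

/-- An `(N, K, T, M)`-PIR scheme for data stored with the MDS code generated by `G`. -/
def IsPIRScheme {F : Type*} [Field F] [Fintype F] [DecidableEq F] {N K M ℓ : ℕ} [NeZero M]
    {ι : Type*} [Fintype ι] [DecidableEq ι] (G : Matrix (Fin K) (Fin N) F) (T : ℕ)
    (server : ι → Fin N) (Q : Scheme F M ℓ ι) : Prop :=
  IsMDS K (rowSpace G) ∧ IsCorrect G server Q ∧ IsPrivate T server Q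

/-- The PIR rate `L / |Q|` with `L = ℓ * K`; the number of queries is the number of labels. -/
def rate (K ℓ : ℕ) (ι : Type*) [Fintype ι] : ℝ :=
  ((ℓ : ℝ) * (K : ℝ)) / (Fintype.card ι : ℝ)

/-! ## One-shot schemes -/

/-- A one-shot scheme of codimension `r` for the desired message `m`: server `i` receives
`q i + a i`, where `q` has law `noise`, and the informative part `a i` vanishes on the first `r`
servers. -/
def IsOneShot {F : Type*} [Field F] [Fintype F] [DecidableEq F] {N K M ℓ : ℕ}
    (G : Matrix (Fin K) (Fin N) F) (T r : ℕ) (m : Fin M)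
    (noise : PMF (Fin N → Query F M ℓ)) (a : Fin N → Query F M ℓ) : Prop :=
  (∀ i : Fin N, (i : ℕ) < r → a i = 0) ∧
  (∀ i j, j ≠ m → a i j = 0) ∧
  (∀ J : Finset (Fin N), J.card = T →
    noise.map (fun q => fun i : J => q i.1 + a i.1) =
      PMF.uniformOfFintype (J → Query F M ℓ)) ∧
  LinearIndependent F (fun i : {i : Fin N // r ≤ (i : ℕ)} =>
    fun W : Messages F M K ℓ => response G W i.1 (a i.1)) ∧
  ∃ α : Fin N → Fin N → F, ∀ q ∈ noise.support, ∀ i : Fin N, r ≤ (i : ℕ) →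
    ∀ W : Messages F M K ℓ, response G W i (q i) =
      ∑ j ∈ Finset.univ.filter (fun j : Fin N => (j : ℕ) < r), α i j * response G W j (q j)

/-- The noise of the star product scheme whose retrieval code is generated by `H`: in every
coordinate, the `N` queries form a uniform codeword, and these codewords are independent. -/
def starNoise {F : Type*} [Field F] [Fintype F] [DecidableEq F] {N T : ℕ} (M ℓ : ℕ)
    (H : Matrix (Fin T) (Fin N) F) : PMF (Fin N → Query F M ℓ) :=
  (PMF.uniformOfFintype (Fin T → Query F M ℓ)).map fun u i => ∑ t, H t i • u t

/-! ## Symbolic matrices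

A matrix of natural numbers with `N` columns is given by the list of its rows. Rows and columns
are numbered from `0`. -/

/-- The matrix `σ ^ t (S)`: every row is shifted cyclically to the left `t` times. -/
def shift {N : ℕ} (t : ℕ) (S : List (Fin N → ℕ)) : List (Fin N → ℕ) :=
  S.map fun row j => row ((finRotate N ^ t) j)

/-- The positions of the entries of `S` with value `k`, in lexicographic order. -/
def positions {N : ℕ} (k : ℕ) (S : List (Fin N → ℕ)) : List (ℕ × Fin N) :=
  S.zipIdx.flatMap fun p =>
    ((List.finRange N).filter fun j => p.1 j = k).map fun j => (p.2, j)

/-- The number of cyclic steps to the left which lead from column `j` to column `c`. -/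
def stepsLeft {N : ℕ} (j c : Fin N) : ℕ := ((j : ℕ) + N - (c : ℕ)) % N

/-- The lifting of `S = S_M`: the matrices `S, σ(S), …, σ^(r-1)(S)`, followed by one row for
every entry `M` of `S`; if this entry is in column `j`, then the new row is `0` in the columns
`j, j - 1, …, j - r + 1` (cyclically) and `M + 1` in the others. -/
def lift {N : ℕ} (r M : ℕ) (S : List (Fin N → ℕ)) : List (Fin N → ℕ) :=
  (List.range r).flatMap (fun t => shift t S) ++
    (positions M S).map fun b => fun c => if stepsLeft b.2 c < r then 0 else M + 1

/-- The symbolic matrix `S_M` of a one-shot scheme of codimension `r` (for `2 ≤ M`). -/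
def symMatrix (N r : ℕ) : ℕ → List (Fin N → ℕ)
  | 0 => []
  | 1 => []
  | 2 => [fun j => if (j : ℕ) < r then 1 else 2]
  | M + 3 => lift r (M + 2) (symMatrix N r (M + 2))

/-- The groups of entries of `S_M` to which the decoding equations of the one-shot scheme are
applied. A pair `(k, g)` stands for the group of the `N` entries at the positions `(g j, j)`, one
in each column `j`: `r` of them are equal to `k` (they carry the noise alone) and `N - r` of them
are equal to `k + 1` (they carry the mixed queries).
The only row of `S_2` is a group. The groups of `S_(M+1)` are those of the `r` shifted
copies of `S_M` and, for every entry `M` of `S_M`, the group of the `r` shifted copies of this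
entry and of the nonzero entries in the row that was added for it. -/
def groups (N r : ℕ) : ℕ → List (ℕ × (Fin N → ℕ))
  | 0 => []
  | 1 => []
  | 2 => [(1, fun _ => 0)]
  | M + 3 =>
    let S := symMatrix N r (M + 2)
    (List.range r).flatMap (fun t => (groups N r (M + 2)).map fun p =>
        (p.1, fun j => t * S.length + p.2 ((finRotate N ^ t) j))) ++
      (positions (M + 2) S).zipIdx.map fun b =>
        (M + 2, fun c => if stepsLeft b.1.2 c < r then stepsLeft b.1.2 c * S.length + b.1.1
          else r * S.length + b.2)

/-- The query structure of `S_M`, repeated `ρ` times: an entry `k ≠ 0` stands for one query for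
every set `s` of `k` messages. A label is a repetition, a row, a column (the server)
and a set of messages. -/
abbrev LiftLabel (N r M ρ : ℕ) : Type :=
  {x : Fin ρ × Fin (symMatrix N r M).length × Fin N × Finset (Fin M) //
    x.2.2.2.Nonempty ∧ (symMatrix N r M).get x.2.1 x.2.2.1 = x.2.2.2.card}

/-- The server which receives a query. -/
def LiftLabel.server {N r M ρ : ℕ} (x : LiftLabel N r M ρ) : Fin N := x.1.2.2.1

/-- The set of messages that are queried. -/
def LiftLabel.msgs {N r M ρ : ℕ} (x : LiftLabel N r M ρ) : Finset (Fin M) := x.1.2.2.2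

/-- The part of a query that queries message `m`. -/
def part {F : Type*} [Field F] {M ℓ : ℕ} (m : Fin M) (q : Query F M ℓ) : Query F M ℓ :=
  fun j => if j = m then q j else 0

/-- `Q` is obtained by refining and lifting the one-shot scheme of codimension `r` with the given
noise. It has the query structure of the symbolic matrix, and, whenever message `m` is desired:
* the query labelled by a set of messages is a sum of queries to these messages;
* the responses to the parts that query message `m` are linearly independent;
* for every repetition, every group `(k, g)` and every set `s` of `k` messages without `m`, the
  queries labelled by `s`, and those labelled by `s ∪ {m}` without their part that queries `m`, at
  the `N` positions of the group, are a realization of the noise of the one-shot scheme. -/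
def IsRefinedLifting {F : Type*} [Field F] {N K M ℓ r ρ : ℕ} (G : Matrix (Fin K) (Fin N) F)
    (noise : PMF (Fin N → Query F M ℓ)) (Q : Scheme F M ℓ (LiftLabel N r M ρ)) : Prop :=
  ∀ m : Fin M, ∀ q ∈ (Q m).support,
    (∀ x : LiftLabel N r M ρ, ∀ j ∉ x.msgs, q x j = 0) ∧
    LinearIndependent F (fun x : {x : LiftLabel N r M ρ // m ∈ x.msgs} =>
      fun W : Messages F M K ℓ => response G W x.1.server (part m (q x.1))) ∧
    ∀ p ∈ groups N r M, ∀ c : Fin ρ, ∀ s : Finset (Fin M), s.card = p.1 → m ∉ s →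
      ∃ b ∈ noise.support, ∀ x : LiftLabel N r M ρ, x.1.1 = c →
        (x.1.2.1 : ℕ) = p.2 x.server →
          (x.msgs = s → q x = b x.server) ∧
          (x.msgs = insert m s → q x - part m (q x) = b x.server)

end OneShotPIR

end

/-!
Why the scheme exists. Write `r = K + T - 1`. On a group of `S_M` the interference is a realization
of the star product noise, so the responses to it form a codeword of the `(N, r)`-MDS code `C * D`
(`response_noise_mem`). It vanishes as soon as it vanishes at the `r` servers which receive noise
alone. Hence responses that all vanish leave only vanishing responses to the parts that query the
desired message; these are as many independent functionals as the message has symbols, so the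
message vanishes (`IsRefinedLifting.eq_zero`). By linearity the scheme is correct.

Privacy and independence pull in opposite directions. The vectors that query an undesired message
are codewords on every group, those that query the desired message must give linearly independent
responses with certainty, and yet any `T` servers must see the same law in both cases, jointly for
all groups. Note that the groups of the labels that query `j` depend on the desired message `m`.
There are `n = N ^ (M - 2)` of them, each with one label per server (`GroupsOf.label_bijective`), so
changing `m` permutes, at every server, the `n` labels there (`exists_group_perms`).

`exists_query_laws` provides the two laws, over an extension field `E` of `F` of large degree. The
vectors have a leading part and a noise part. The leading parts are codewords in both laws, drawn
uniformly from a set of information symbols which is closed under all invertible mixings over `F`;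
this makes the law of the undesired queries at `T` servers independent of the permutations, since
any permutation there is the effect of a mixing (`ColumnsSeparated.exists_mix`). In the undesired
law the noise parts are uniform codewords, thus uniform at any `T` servers. In the desired law they
follow, given the leading parts, a law all of whose marginals at `T` servers are uniform, but which
lives on the noise for which the queries are independent. Such a law exists if prescribing the noise
at any `T` servers leaves only few dependent choices for the others (`exists_pmf_uniform_marginals`):
the uniform law is repaired on the sparse set of bad points by a signed combination of laws with
fixed values at up to `T` servers, which does not change the marginals.
The bad points are sparse because independence is the nonvanishing of a determinant, a polynomial
of bounded degree along every line (`GenericOnLines`), and it holds somewhere: scaling the noise at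
the `T` servers reduces this to noise that is zero there, and an explicit circulant design handles
that case (`exists_codewords_tensorIndep`). The whole construction uses the codes only through the
fact that any `k` columns of a generator matrix of an `(N, k)`-MDS code are independent
(`ColumnsSeparated`).

The rate counts labels: in one copy of `S_M` there are `(N - r) ^ k * r ^ (M - 1 - k)` entries equal
to `k + 1` (`entrySum_symMatrix`), so the binomial theorem gives `N ^ (M - 1)` labels that query
a given message and `(N ^ M - r ^ M) / (N - r)` labels altogether.
-/

noncomputable section

namespace OneShotPIR

/-! ### MDS codes -/

theorem mem_rowSpace_iff {F : Type*} [Field F] {K N : ℕ} {G : Matrix (Fin K) (Fin N) F}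
    {c : Fin N → F} : c ∈ rowSpace G ↔ ∃ u : Fin K → F, ∀ i, c i = ∑ k, u k * G k i := by
  unfold rowSpace
  rw [Submodule.mem_span_range_iff_exists_fun]
  refine exists_congr fun u => ⟨fun h i => ?_, fun h => ?_⟩
  · rw [← h]; simp [Finset.sum_apply]
  · funext i; rw [h i]; simp [Finset.sum_apply]

theorem IsMDS.eq_zero_of_vanish {F : Type*} [Field F] [DecidableEq F] {N k : ℕ}
    {C : Submodule F (Fin N → F)} (hC : IsMDS k C) {c : Fin N → F} (hc : c ∈ C)
    (S : Finset (Fin N)) (hS : k ≤ S.card) (h0 : ∀ i ∈ S, c i = 0) : c = 0 := by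
  by_contra hne
  have h1 := hC.2 c hc hne
  have h2 : hammingNorm c + S.card ≤ N := by
    unfold hammingNorm
    have : Disjoint (Finset.univ.filter fun i => c i ≠ 0) S := by
      rw [Finset.disjoint_left]
      intro i hi hiS
      exact (Finset.mem_filter.1 hi).2 (h0 i hiS)
    rw [← Finset.card_union_of_disjoint this]
    simpa using Finset.card_le_univ ((Finset.univ.filter fun i => c i ≠ 0) ∪ S)
  omega

/-- An MDS code takes arbitrary values on any `k` positions: here, the values `1` at `i₀` and `0`
elsewhere on a set of at most `k` positions. -/
theorem IsMDS.exists_dual {F : Type*} [Field F] [DecidableEq F] {N k : ℕ}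
    {G : Matrix (Fin k) (Fin N) F} (hG : IsMDS k (rowSpace G)) (hk : k ≤ N)
    (S : Finset (Fin N)) (hS : S.card ≤ k) (i₀ : Fin N) :
    ∃ u : Fin k → F, ∀ i ∈ S, ∑ a, u a * G a i = if i = i₀ then 1 else 0 := by
  obtain ⟨S', hSS', hS'⟩ := Finset.exists_superset_card_eq hS (by simpa using hk)
  let φ : rowSpace G →ₗ[F] (S' → F) :=
    (LinearMap.funLeft F F (fun i : S' => (i : Fin N))).comp (rowSpace G).subtype
  have hinj : Function.Injective φ := by
    rw [injective_iff_map_eq_zero]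
    intro c hc
    apply Subtype.ext
    refine hG.eq_zero_of_vanish c.2 S' hS'.ge fun i hi => ?_
    exact congrFun hc ⟨i, hi⟩
  have hsurj : Function.Surjective φ := by
    refine (LinearMap.injective_iff_surjective_of_finrank_eq_finrank ?_).1 hinj
    rw [hG.1]
    simp [hS']
  obtain ⟨c, hc⟩ := hsurj fun i => if (i : Fin N) = i₀ then 1 else 0
  obtain ⟨u, hu⟩ := mem_rowSpace_iff.1 c.2
  refine ⟨u, fun i hi => ?_⟩
  rw [← hu]
  exact congrFun hc ⟨i, hSS' hi⟩

/-! ### Generalized Reed-Solomon codes -/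

theorem grs_isMDS {F : Type*} [Field F] [DecidableEq F] {N k : ℕ} (hk : k ≤ N)
    (x y : Fin N → F) (hx : Function.Injective x) (hy : ∀ i, y i ≠ 0) :
    IsMDS k (rowSpace (grsMatrix k x y)) := by
  -- A codeword is the evaluation of a polynomial of degree less than `k`.
  have key : ∀ u : Fin k → F, ∀ S : Finset (Fin N), k ≤ S.card →
      (∀ i ∈ S, ∑ a, u a * grsMatrix k x y a i = 0) → u = 0 := by
    intro u S hS h0
    let p : Polynomial F := ∑ a : Fin k, Polynomial.C (u a) * Polynomial.X ^ (a : ℕ)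
    have hcoeff : ∀ a : Fin k, p.coeff a = u a := by
      intro a
      simp [p, Polynomial.finsetSum_coeff, Polynomial.coeff_X_pow, Fin.val_inj]
    have hdeg : p.degree < k := by
      refine Polynomial.mem_degreeLT.1 (Submodule.sum_mem _ fun a _ => Polynomial.mem_degreeLT.2 ?_)
      exact (Polynomial.degree_C_mul_X_pow_le _ _).trans_lt (by exact_mod_cast a.2)
    have hp : p = 0 := by
      refine Polynomial.eq_zero_of_degree_lt_of_eval_finset_eq_zero (S.image x) ?_ ?_
      · rw [Finset.card_image_of_injective _ hx]
        exact hdeg.trans_le (by exact_mod_cast hS)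
      · intro v hv
        obtain ⟨i, hi, rfl⟩ := Finset.mem_image.1 hv
        have h := h0 i hi
        have h' : y i * p.eval (x i) = 0 := by
          rw [← h]
          simp only [p, Polynomial.eval_finsetSum, Finset.mul_sum, grsMatrix, Matrix.of_apply]
          refine Finset.sum_congr rfl fun a _ => ?_
          simp; ring
        exact (mul_eq_zero.1 h').resolve_left (hy i)
    funext a
    rw [← hcoeff a, hp]; simp
  have hli : LinearIndependent F (fun a : Fin k => grsMatrix k x y a) := by
    rw [Fintype.linearIndependent_iff]
    intro u hu
    have := key u Finset.univ (by simpa using hk) fun i _ => by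
      have := congrFun hu i
      simpa [Finset.sum_apply] using this
    exact congrFun this
  refine ⟨(finrank_span_eq_card hli).trans (Fintype.card_fin k), fun c hc hne => ?_⟩
  obtain ⟨u, hu⟩ := mem_rowSpace_iff.1 hc
  by_contra hlt
  refine hne ?_
  have hu0 : u = 0 := by
    refine key u (Finset.univ.filter fun i => c i = 0) ?_ ?_
    · have := Finset.card_filter_add_card_filter_not (s := (Finset.univ : Finset (Fin N)))
        (fun i => c i = 0)
      simp only [Finset.card_univ, Fintype.card_fin] at this
      unfold hammingNorm at hlt
      simp only [ne_eq] at hlt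
      omega
    · intro i hi
      rw [← hu i]; exact (Finset.mem_filter.1 hi).2
  funext i
  rw [hu i, hu0]; simp

/-- The products of the rows `s` and `t` of the two generator matrices depend only on `s + t`, and are
the rows of the third one. -/
theorem grs_mul {F : Type*} [Field F] {N K T : ℕ} (hK : 1 ≤ K) (hT : 1 ≤ T)
    (x y z : Fin N → F) :
    rowSpace (grsMatrix K x y) * rowSpace (grsMatrix T x z) =
      rowSpace (grsMatrix (K + T - 1) x (y * z)) := by
  unfold rowSpace
  rw [Submodule.span_mul_span]
  congr 1
  ext c
  simp only [Set.mem_mul, Set.mem_range]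
  constructor
  · rintro ⟨_, ⟨a, rfl⟩, _, ⟨b, rfl⟩, rfl⟩
    refine ⟨⟨a + b, by omega⟩, ?_⟩
    funext i
    simp only [grsMatrix, Matrix.of_apply, Pi.mul_apply, pow_add]
    ring
  · rintro ⟨s, rfl⟩
    by_cases h : (s : ℕ) < K
    · refine ⟨_, ⟨⟨s, h⟩, rfl⟩, _, ⟨⟨0, hT⟩, rfl⟩, ?_⟩
      funext i
      simp only [grsMatrix, Matrix.of_apply, Pi.mul_apply]
      ring
    · refine ⟨_, ⟨⟨K - 1, by omega⟩, rfl⟩, _, ⟨⟨s - (K - 1), by omega⟩, rfl⟩, ?_⟩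
      funext i
      have hs : (s : ℕ) = (K - 1) + (s - (K - 1)) := by omega
      simp only [grsMatrix, Matrix.of_apply, Pi.mul_apply]
      rw [hs, pow_add]
      simp only [add_tsub_cancel_left]
      ring

theorem grs_isStarPair {F : Type*} [Field F] [DecidableEq F] {N K T : ℕ} (hK : 1 ≤ K)
    (hT : 1 ≤ T) (hN : K + T ≤ N) (x y z : Fin N → F) (hx : Function.Injective x)
    (hy : ∀ i, y i ≠ 0) (hz : ∀ i, z i ≠ 0) :
    IsStarPair K T (rowSpace (grsMatrix K x y)) (rowSpace (grsMatrix T x z)) := by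
  refine ⟨grs_isMDS (by omega) x y hx hy, grs_isMDS (by omega) x z hx hz, ?_⟩
  rw [grs_mul hK hT]
  exact grs_isMDS (by omega) x (y * z) hx fun i => mul_ne_zero (hy i) (hz i)

/-! ### Laws with uniform marginals that avoid a sparse set -/

/-- The weights `c_s` for which `∑_S c_{#S} f (b on S, y off S) = f b` whenever `f` depends on only
`T` of the `T + n` coordinates; they vanish for `s > T`. -/
def interpCoeff (n T s : ℕ) : ℝ := if s ≤ T then ((Ring.choose (-(n : ℤ)) (T - s) : ℤ) : ℝ) else 0

theorem sum_choose_mul_interpCoeff (n T a : ℕ) (ha : a ≤ T) :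
    ∑ j ∈ Finset.range (n + 1), (n.choose j : ℝ) * interpCoeff n T (a + j) =
      if a = T then 1 else 0 := by
  have h := Ring.add_choose_eq (r := (n : ℤ)) (s := -(n : ℤ)) (T - a) (Commute.all _ _)
  have h0 : (Ring.choose (0 : ℤ) (T - a)) = if a = T then 1 else 0 := by
    rw [Ring.choose_zero_ite]
    congr 1
    simp only [eq_iff_iff]; omega
  rw [add_neg_cancel, h0, Finset.Nat.sum_antidiagonal_eq_sum_range_succ_mk] at h
  have h' : ((if a = T then 1 else 0 : ℤ) : ℝ) = ∑ j ∈ Finset.range (T - a + 1),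
      (n.choose j : ℝ) * interpCoeff n T (a + j) := by
    rw [h]
    push_cast
    refine Finset.sum_congr rfl fun j hj => ?_
    have hj' : a + j ≤ T := by have := Finset.mem_range.1 hj; omega
    rw [Ring.choose_natCast, interpCoeff, if_pos hj', Nat.sub_sub]
    simp
  have h'' : (if a = T then 1 else 0 : ℝ) = ((if a = T then 1 else 0 : ℤ) : ℝ) := by
    split_ifs <;> simp
  rw [h'', h']
  -- Both sums extend to the range of length `n + T + 1` by zeros.
  have e1 : ∑ j ∈ Finset.range (n + 1), (n.choose j : ℝ) * interpCoeff n T (a + j) =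
      ∑ j ∈ Finset.range (n + T + 1), (n.choose j : ℝ) * interpCoeff n T (a + j) := by
    refine Finset.sum_subset (Finset.range_mono (by omega)) fun j _ hj => ?_
    rw [Finset.mem_range, not_lt] at hj
    rw [Nat.choose_eq_zero_of_lt (by omega)]; simp
  have e2 : ∑ j ∈ Finset.range (T - a + 1), (n.choose j : ℝ) * interpCoeff n T (a + j) =
      ∑ j ∈ Finset.range (n + T + 1), (n.choose j : ℝ) * interpCoeff n T (a + j) := by
    refine Finset.sum_subset (Finset.range_mono (by omega)) fun j _ hj => ?_
    rw [Finset.mem_range, not_lt] at hj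
    rw [interpCoeff, if_neg (by omega)]; simp
  rw [e1, e2]

section

variable {ι Y : Type*} [Fintype ι] [DecidableEq ι]

theorem sum_interpCoeff_fiber (T : ℕ) (J A : Finset ι) (hJ : J.card = T) (hA : A ⊆ J) :
    ∑ S ∈ Finset.univ.filter (fun S : Finset ι => S ∩ J = A),
      interpCoeff (Fintype.card ι - T) T S.card = if A = J then 1 else 0 := by
  have e : ∑ S ∈ Finset.univ.filter (fun S : Finset ι => S ∩ J = A),
      interpCoeff (Fintype.card ι - T) T S.card =
      ∑ B ∈ Jᶜ.powerset, interpCoeff (Fintype.card ι - T) T (A.card + B.card) := by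
    refine Finset.sum_bij' (fun S _ => S \ J) (fun B _ => A ∪ B) ?_ ?_ ?_ ?_ ?_
    · intro S _
      rw [Finset.mem_powerset]
      intro i hi
      simp only [Finset.mem_sdiff] at hi
      simpa using hi.2
    · intro B hB
      rw [Finset.mem_powerset] at hB
      simp only [Finset.mem_filter, Finset.mem_univ, true_and]
      ext i
      have h1 : i ∈ A → i ∈ J := fun h => hA h
      have h2 : i ∈ B → i ∉ J := fun h => by simpa using hB h
      simp only [Finset.mem_inter, Finset.mem_union]
      tauto
    · intro S hS
      rw [Finset.mem_filter] at hS
      rw [← hS.2]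
      ext i; simp only [Finset.mem_union, Finset.mem_inter, Finset.mem_sdiff]; tauto
    · intro B hB
      rw [Finset.mem_powerset] at hB
      ext i
      have h1 : i ∈ A → i ∈ J := fun h => hA h
      have h2 : i ∈ B → i ∉ J := fun h => by simpa using hB h
      simp only [Finset.mem_union, Finset.mem_sdiff]; tauto
    · intro S hS
      rw [Finset.mem_filter] at hS
      congr 1
      rw [← hS.2, Finset.card_inter_add_card_sdiff]
  rw [e, Finset.sum_powerset_apply_card (fun j => interpCoeff (Fintype.card ι - T) T (A.card + j))]
  have hc : Jᶜ.card = Fintype.card ι - T := by rw [Finset.card_compl, hJ]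
  rw [hc]
  simp only [nsmul_eq_mul]
  rw [sum_choose_mul_interpCoeff _ _ _ (hJ ▸ Finset.card_le_card hA)]
  congr 1
  rw [eq_iff_iff]
  constructor
  · intro h; exact Finset.eq_of_subset_of_card_le hA (by omega)
  · rintro rfl; exact hJ

/-- A function `φ` of `T` coordinates takes at `b` the value which the signed combination of the
mixtures of `b` and `y` gives to it, whatever `y` is. -/
theorem sum_interpCoeff_piecewise (T : ℕ) (J : Finset ι) (hJ : J.card = T)
    (φ : (J → Y) → ℝ) (b y : ι → Y) :
    ∑ S : Finset ι, interpCoeff (Fintype.card ι - T) T S.card *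
      φ (fun i => S.piecewise b y i.1) = φ fun i => b i.1 := by
  rw [← Finset.sum_fiberwise_of_maps_to (t := J.powerset) (g := fun S => S ∩ J)
    (fun S _ => by simp)]
  have : ∀ A ∈ J.powerset, ∑ S ∈ Finset.univ.filter (fun S : Finset ι => S ∩ J = A),
      interpCoeff (Fintype.card ι - T) T S.card * φ (fun i => S.piecewise b y i.1) =
      if A = J then φ (fun i => b i.1) else 0 := by
    intro A hA
    rw [Finset.mem_powerset] at hA
    have h1 : ∀ S ∈ Finset.univ.filter (fun S : Finset ι => S ∩ J = A),
        interpCoeff (Fintype.card ι - T) T S.card * φ (fun i => S.piecewise b y i.1) =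
        interpCoeff (Fintype.card ι - T) T S.card * φ (fun i => A.piecewise b y i.1) := by
      intro S hS
      rw [Finset.mem_filter] at hS
      congr 2
      funext i
      have : i.1 ∈ S ↔ i.1 ∈ A := by rw [← hS.2]; simp
      simp [Finset.piecewise, this]
    rw [Finset.sum_congr rfl h1, ← Finset.sum_mul, sum_interpCoeff_fiber T J A hJ hA]
    split_ifs with h
    · subst h
      rw [one_mul]
      congr 1
      funext i
      simp [Finset.piecewise]
    · simp
  rw [Finset.sum_congr rfl this, Finset.sum_ite_eq' ]
  simp

/-- How sparse the bad points have to be in `exists_pmf_uniform_marginals`. -/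
def sparsity (N T : ℕ) : ℝ :=
  2 * 2 ^ N + 2 * ∑ S : Finset (Fin N), |interpCoeff (N - T) T S.card|

section

variable {N T : ℕ} [Fintype Y] (good : (Fin N → Y) → Prop)

open scoped Classical in
/-- The points `y` all of whose mixtures with at most `T` coordinates of `b` are good. -/
def freshPoints (T : ℕ) (b : Fin N → Y) : Finset (Fin N → Y) :=
  Finset.univ.filter fun y => ∀ S : Finset (Fin N), S.card ≤ T → good (S.piecewise b y)

open scoped Classical in
/-- The unnormalized density: the mass of every bad point `b` is replaced by the signed combination
of mixtures of `b` with a uniform fresh point that has the same marginals on `T` coordinates. -/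
def avoidDensity (T : ℕ) (z : Fin N → Y) : ℝ :=
  (if good z then 1 else 0) + ∑ b ∈ Finset.univ.filter (fun b => ¬ good b),
    ((freshPoints good T b).card : ℝ)⁻¹ * ∑ y ∈ freshPoints good T b, ∑ S : Finset (Fin N),
      interpCoeff (N - T) T S.card * if S.piecewise b y = z then 1 else 0

open scoped Classical in
/-- Exchanging the coordinates in `S` of a bad point `b` and of `y` injects the pairs with mixture
`z` into the points whose mixture with `z` is bad. -/
theorem card_mixtures_le (S : Finset (Fin N)) (z : Fin N → Y) :
    (Finset.univ.filter fun p : (Fin N → Y) × (Fin N → Y) =>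
      ¬ good p.1 ∧ S.piecewise p.1 p.2 = z).card ≤
    (Finset.univ.filter fun y : Fin N → Y => ¬ good (S.piecewise z y)).card := by
  have key : ∀ b y : Fin N → Y, S.piecewise b y = z → S.piecewise z (S.piecewise y b) = b := by
    rintro b y rfl
    funext i
    by_cases h : i ∈ S <;> simp [h]
  have key' : ∀ b y : Fin N → Y, S.piecewise b y = z → S.piecewise (S.piecewise y b) z = y := by
    rintro b y rfl
    funext i
    by_cases h : i ∈ S <;> simp [h]
  refine Finset.card_le_card_of_injOn (fun p => S.piecewise p.2 p.1) ?_ ?_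
  · rintro ⟨b, y⟩ h
    simp only [Finset.coe_filter, Finset.mem_univ, true_and, Set.mem_ofPred_eq] at h ⊢
    rw [key b y h.2]; exact h.1
  · rintro ⟨b, y⟩ h ⟨b', y'⟩ h' e
    simp only [Finset.coe_filter, Finset.mem_univ, true_and, Set.mem_ofPred_eq] at h h'
    simp only at e
    have e₁ : b = b' := (key b y h.2).symm.trans
      ((congrArg (fun v => S.piecewise z v) e).trans (key b' y' h'.2))
    have e₂ : y = y' := (key' b y h.2).symm.trans
      ((congrArg (fun v => S.piecewise v z) e).trans (key' b' y' h'.2))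
    rw [e₁, e₂]

variable {good}

open scoped Classical in
theorem avoidDensity_of_not_good {z : Fin N → Y} (hz : ¬ good z) :
    avoidDensity good T z = 0 := by
  unfold avoidDensity
  rw [if_neg hz, zero_add]
  refine Finset.sum_eq_zero fun b _ => ?_
  rw [Finset.sum_eq_zero, mul_zero]
  intro y hy
  refine Finset.sum_eq_zero fun S _ => ?_
  by_cases hS : S.card ≤ T
  · rw [if_neg, mul_zero]
    rintro rfl
    exact hz ((Finset.mem_filter.1 hy).2 S hS)
  · rw [interpCoeff, if_neg hS, zero_mul]

open scoped Classical in
/-- At least half of the points are fresh. -/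
theorem card_freshPoints {B : ℝ} (hB : sparsity N T ≤ B)
    (hgood : ∀ S : Finset (Fin N), S.card ≤ T → ∀ b : Fin N → Y,
      ((Finset.univ.filter fun y : Fin N → Y => ¬ good (S.piecewise b y)).card : ℝ) * B ≤
        (Fintype.card (Fin N → Y) : ℝ)) (b : Fin N → Y) :
    (Fintype.card (Fin N → Y) : ℝ) ≤ 2 * (freshPoints good T b).card := by
  have hB1 : 2 * 2 ^ N ≤ B := by
    refine le_trans ?_ hB
    unfold sparsity
    have : 0 ≤ ∑ S : Finset (Fin N), |interpCoeff (N - T) T S.card| :=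
      Finset.sum_nonneg fun _ _ => abs_nonneg _
    linarith
  have hpos : (0 : ℝ) < 2 ^ N := by positivity
  have hsub : (Finset.univ : Finset (Fin N → Y)) ⊆ freshPoints good T b ∪
      (Finset.univ.filter fun S : Finset (Fin N) => S.card ≤ T).biUnion fun S =>
        Finset.univ.filter fun y : Fin N → Y => ¬ good (S.piecewise b y) := by
    intro y _
    by_cases h : y ∈ freshPoints good T b
    · exact Finset.mem_union_left _ h
    · refine Finset.mem_union_right _ ?_
      simp only [freshPoints, Finset.mem_filter, Finset.mem_univ, true_and, not_forall] at h
      obtain ⟨S, hS, h⟩ := h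
      simp only [Finset.mem_biUnion, Finset.mem_filter, Finset.mem_univ, true_and]
      exact ⟨S, hS, h⟩
  have h1 := (Finset.card_le_card hsub).trans ((Finset.card_union_le _ _).trans
    (Nat.add_le_add_left Finset.card_biUnion_le _))
  have h2 : (Fintype.card (Fin N → Y) : ℝ) ≤ (freshPoints good T b).card +
      ∑ S ∈ Finset.univ.filter (fun S : Finset (Fin N) => S.card ≤ T),
        ((Finset.univ.filter fun y : Fin N → Y => ¬ good (S.piecewise b y)).card : ℝ) := by
    rw [Finset.card_univ] at h1
    exact_mod_cast h1
  set V : ℝ := (Fintype.card (Fin N → Y) : ℝ) with hV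
  have h3 : ∑ S ∈ Finset.univ.filter (fun S : Finset (Fin N) => S.card ≤ T),
      ((Finset.univ.filter fun y : Fin N → Y => ¬ good (S.piecewise b y)).card : ℝ) ≤
      ∑ S : Finset (Fin N), V / (2 * 2 ^ N) := by
    refine (Finset.sum_le_sum (g := fun _ => V / (2 * 2 ^ N)) fun S hS => ?_).trans
      (Finset.sum_le_sum_of_subset_of_nonneg (Finset.filter_subset _ _) fun _ _ _ => by positivity)
    rw [le_div_iff₀ (by positivity)]
    refine le_trans ?_ (hgood S (Finset.mem_filter.1 hS).2 b)
    gcongr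
  rw [Finset.sum_const, Finset.card_univ, Fintype.card_finset, Fintype.card_fin, nsmul_eq_mul] at h3
  have h4 : ((2 ^ N : ℕ) : ℝ) * (V / (2 * 2 ^ N)) = V / 2 := by
    push_cast; field_simp
  rw [h4] at h3
  linarith

open scoped Classical in
/-- At a good point, the signed terms are outweighed by the mass `1`, since few pairs of a bad point
and a fresh point have a given mixture. -/
theorem avoidDensity_nonneg [Nonempty Y] {B : ℝ} (hB : sparsity N T ≤ B)
    (hgood : ∀ S : Finset (Fin N), S.card ≤ T → ∀ b : Fin N → Y,
      ((Finset.univ.filter fun y : Fin N → Y => ¬ good (S.piecewise b y)).card : ℝ) * B ≤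
        (Fintype.card (Fin N → Y) : ℝ)) (z : Fin N → Y) :
    0 ≤ avoidDensity good T z := by
  by_cases hz : good z
  swap
  · rw [avoidDensity_of_not_good hz]
  set V : ℝ := (Fintype.card (Fin N → Y) : ℝ) with hV
  have hVpos : 0 < V := by
    rw [hV]; exact_mod_cast Fintype.card_pos
  have hBpos : 0 < B := by
    refine lt_of_lt_of_le ?_ hB
    unfold sparsity
    have : 0 ≤ ∑ S : Finset (Fin N), |interpCoeff (N - T) T S.card| :=
      Finset.sum_nonneg fun _ _ => abs_nonneg _
    positivity
  have hbound : |∑ b ∈ Finset.univ.filter (fun b => ¬ good b),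
    ((freshPoints good T b).card : ℝ)⁻¹ * ∑ y ∈ freshPoints good T b, ∑ S : Finset (Fin N),
      interpCoeff (N - T) T S.card * if S.piecewise b y = z then 1 else 0| ≤ 1 := by
    calc _ ≤ ∑ b ∈ Finset.univ.filter (fun b => ¬ good b), (2 / V) *
          ∑ y : Fin N → Y, ∑ S : Finset (Fin N),
            |interpCoeff (N - T) T S.card| * if S.piecewise b y = z then 1 else 0 := by
          refine (Finset.abs_sum_le_sum_abs _ _).trans (Finset.sum_le_sum fun b _ => ?_)
          rw [abs_mul]
          refine mul_le_mul ?_ ?_ (abs_nonneg _) (by positivity)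
          · have hc := card_freshPoints hB hgood b
            rw [← hV] at hc
            rw [abs_of_nonneg (by positivity), inv_eq_one_div,
              div_le_div_iff₀ (by linarith) hVpos]
            linarith
          · refine (Finset.abs_sum_le_sum_abs _ _).trans ?_
            refine le_trans (Finset.sum_le_sum fun y _ => ?_) (Finset.sum_le_sum_of_subset_of_nonneg
              (Finset.subset_univ _) fun y _ _ => Finset.sum_nonneg fun S _ =>
                mul_nonneg (abs_nonneg _) (by split_ifs <;> simp))
            refine (Finset.abs_sum_le_sum_abs _ _).trans (Finset.sum_le_sum fun S _ => ?_)
            rw [abs_mul]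
            refine mul_le_mul_of_nonneg_left ?_ (abs_nonneg _)
            split_ifs <;> simp
      _ = (2 / V) * ∑ S : Finset (Fin N), |interpCoeff (N - T) T S.card| *
            ((Finset.univ.filter fun p : (Fin N → Y) × (Fin N → Y) =>
              ¬ good p.1 ∧ S.piecewise p.1 p.2 = z).card : ℝ) := by
          rw [← Finset.mul_sum]
          congr 1
          rw [Finset.sum_congr rfl fun b _ => Finset.sum_comm, Finset.sum_comm]
          refine Finset.sum_congr rfl fun S _ => ?_
          simp_rw [← Finset.mul_sum]
          congr 1
          rw [Finset.card_filter, Nat.cast_sum, Fintype.sum_prod_type, Finset.sum_filter]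
          refine Finset.sum_congr rfl fun b _ => ?_
          by_cases hb : good b <;> simp [hb]
      _ ≤ (2 / V) * ∑ S : Finset (Fin N), |interpCoeff (N - T) T S.card| * (V / B) := by
          refine mul_le_mul_of_nonneg_left (Finset.sum_le_sum fun S _ => ?_) (by positivity)
          by_cases hS : S.card ≤ T
          · refine mul_le_mul_of_nonneg_left ?_ (abs_nonneg _)
            rw [le_div_iff₀ hBpos]
            refine le_trans ?_ (hgood S hS z)
            gcongr
            exact card_mixtures_le good S z
          · simp [interpCoeff, hS]
      _ = (2 * ∑ S : Finset (Fin N), |interpCoeff (N - T) T S.card|) / B := by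
          rw [← Finset.sum_mul]; field_simp
      _ ≤ 1 := by
          rw [div_le_one hBpos]
          refine le_trans ?_ hB
          unfold sparsity
          have : (0 : ℝ) ≤ 2 * 2 ^ N := by positivity
          linarith
  unfold avoidDensity
  rw [if_pos hz]
  linarith [(abs_le.1 hbound).1]

open scoped Classical in
/-- The density has the marginals of the counting measure on any `T` coordinates. -/
theorem sum_avoidDensity_mul (hfresh : ∀ b, (freshPoints good T b).card ≠ 0)
    (J : Finset (Fin N)) (hJ : J.card = T) (φ : (J → Y) → ℝ) :
    ∑ z, avoidDensity good T z * φ (fun i => z i.1) = ∑ z : Fin N → Y, φ fun i => z i.1 := by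
  have hS : ∀ b y : Fin N → Y, ∑ z : Fin N → Y, (∑ S : Finset (Fin N),
      interpCoeff (N - T) T S.card * if S.piecewise b y = z then 1 else 0) * φ (fun i => z i.1) =
        φ fun i => b i.1 := by
    intro b y
    have h := sum_interpCoeff_piecewise T J hJ φ b y
    rw [Fintype.card_fin] at h
    rw [← h]
    simp_rw [Finset.sum_mul]
    rw [Finset.sum_comm]
    refine Finset.sum_congr rfl fun S _ => ?_
    simp
  have hb : ∀ b : Fin N → Y, ∑ z : Fin N → Y, (((freshPoints good T b).card : ℝ)⁻¹ *
      ∑ y ∈ freshPoints good T b, ∑ S : Finset (Fin N),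
        interpCoeff (N - T) T S.card * if S.piecewise b y = z then 1 else 0) *
          φ (fun i => z i.1) = φ fun i => b i.1 := by
    intro b
    simp_rw [mul_assoc, ← Finset.mul_sum, Finset.sum_mul]
    rw [Finset.sum_comm]
    simp_rw [← Finset.sum_mul]
    rw [Finset.sum_congr rfl fun y _ => hS b y, Finset.sum_const, nsmul_eq_mul, ← mul_assoc,
      inv_mul_cancel₀ (by exact_mod_cast hfresh b), one_mul]
  unfold avoidDensity
  simp_rw [add_mul, Finset.sum_add_distrib]
  have h2 : ∑ z : Fin N → Y, (∑ b ∈ Finset.univ.filter (fun b => ¬ good b),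
      ((freshPoints good T b).card : ℝ)⁻¹ * ∑ y ∈ freshPoints good T b, ∑ S : Finset (Fin N),
        interpCoeff (N - T) T S.card * if S.piecewise b y = z then 1 else 0) *
          φ (fun i => z i.1) =
      ∑ b ∈ Finset.univ.filter (fun b => ¬ good b), φ fun i => b i.1 := by
    simp_rw [Finset.sum_mul]
    rw [Finset.sum_comm]
    exact Finset.sum_congr rfl fun b _ => by rw [← hb b]
  have h1 : ∑ z : Fin N → Y, (if good z then (1 : ℝ) else 0) * φ (fun i => z i.1) =
      ∑ z ∈ Finset.univ.filter good, φ fun i => z i.1 := by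
    rw [Finset.sum_filter]
    refine Finset.sum_congr rfl fun z _ => ?_
    split_ifs <;> simp
  rw [h1, h2, Finset.sum_filter_add_sum_filter_not]

end

open scoped Classical in
/-- If the bad points are sparse even after `T` coordinates have been prescribed, then there is a
law that avoids them and has the same marginals on any `T` coordinates as the uniform law. -/
theorem exists_pmf_uniform_marginals {N T : ℕ} [Fintype Y] [Nonempty Y] (hT : T ≤ N)
    (good : (Fin N → Y) → Prop) {B : ℝ} (hB : sparsity N T ≤ B)
    (hgood : ∀ S : Finset (Fin N), S.card ≤ T → ∀ b : Fin N → Y,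
      ((Finset.univ.filter fun y : Fin N → Y => ¬ good (S.piecewise b y)).card : ℝ) * B ≤
        (Fintype.card (Fin N → Y) : ℝ)) :
    ∃ p : PMF (Fin N → Y), (∀ z ∈ p.support, good z) ∧
      ∀ J : Finset (Fin N), J.card = T →
        p.map (fun z (i : J) => z i.1) =
          (PMF.uniformOfFintype (Fin N → Y)).map fun z (i : J) => z i.1 := by
  have hVpos : (0 : ℝ) < (Fintype.card (Fin N → Y) : ℝ) := by exact_mod_cast Fintype.card_pos
  have hfresh : ∀ b, (freshPoints good T b).card ≠ 0 := by
    intro b h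
    have := card_freshPoints hB hgood b
    rw [h, Nat.cast_zero, mul_zero] at this
    linarith
  have hnn := avoidDensity_nonneg hB hgood
  set V : ℝ := (Fintype.card (Fin N → Y) : ℝ) with hV
  have hmarg := sum_avoidDensity_mul (T := T) hfresh
  obtain ⟨J₀, hJ₀⟩ : ∃ J : Finset (Fin N), J.card = T := by
    obtain ⟨J, -, hJ⟩ := Finset.exists_subset_card_eq (s := (Finset.univ : Finset (Fin N)))
      (n := T) (by simpa using hT)
    exact ⟨J, hJ⟩
  have htot : ∑ z, V⁻¹ * avoidDensity good T z = 1 := by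
    have := hmarg J₀ hJ₀ fun _ => 1
    simp only [mul_one, Finset.sum_const, nsmul_eq_mul, Finset.card_univ] at this
    rw [← Finset.mul_sum, this, ← hV, inv_mul_cancel₀ hVpos.ne']
  refine ⟨PMF.ofFintype (fun z => ENNReal.ofReal (V⁻¹ * avoidDensity good T z)) ?_, ?_, ?_⟩
  · rw [← ENNReal.ofReal_sum_of_nonneg fun z _ => mul_nonneg (by positivity) (hnn z), htot]
    simp
  · intro z hz
    by_contra h
    rw [PMF.mem_support_ofFintype_iff, avoidDensity_of_not_good h] at hz
    simp at hz
  · intro J hJ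
    ext x
    rw [PMF.map_apply, PMF.map_apply, tsum_fintype, tsum_fintype]
    simp only [PMF.ofFintype_apply, PMF.uniformOfFintype_apply]
    have hmx := hmarg J hJ fun v => if x = v then 1 else 0
    have e1 : ∀ z : Fin N → Y, (if x = fun i : J => z i.1 then
        ENNReal.ofReal (V⁻¹ * avoidDensity good T z) else 0) =
        ENNReal.ofReal (V⁻¹ * (avoidDensity good T z *
          if x = fun i : J => z i.1 then 1 else 0)) := by
      intro z; split_ifs <;> simp
    have e2 : ∀ z : Fin N → Y, (if x = fun i : J => z i.1 then
        (Fintype.card (Fin N → Y) : ENNReal)⁻¹ else 0) =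
        ENNReal.ofReal (V⁻¹ * if x = fun i : J => z i.1 then 1 else 0) := by
      intro z; split_ifs
      · rw [mul_one, ENNReal.ofReal_inv_of_pos hVpos, hV, ENNReal.ofReal_natCast]
      · simp
    have e3 : ∑ z : Fin N → Y, ENNReal.ofReal (V⁻¹ * (avoidDensity good T z *
        if x = fun i : J => z i.1 then 1 else 0)) =
        ∑ z : Fin N → Y, ENNReal.ofReal (V⁻¹ * if x = fun i : J => z i.1 then 1 else 0) := by
      rw [← ENNReal.ofReal_sum_of_nonneg, ← ENNReal.ofReal_sum_of_nonneg, ← Finset.mul_sum,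
        ← Finset.mul_sum, hmx]
      · intro z _; split_ifs <;> positivity
      · intro z _
        have := hnn z
        split_ifs <;> positivity
    refine Eq.trans (Finset.sum_congr rfl fun z _ => ?_)
      (e3.trans (Finset.sum_congr rfl fun z _ => ?_))
    · convert e1 z
    · convert (e2 z).symm

end

/-! ### Predicates that hold generically along lines -/

/-- A predicate on a vector space over a finite field which fails at no more than `d` points of
every line on which it holds somewhere, such as the nonvanishing of a polynomial of degree `d`. -/
def GenericOnLines (E : Type*) {W : Type*} [Field E] [AddCommGroup W] [Module E W] (d : ℕ)
    (P : W → Prop) : Prop :=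
  ∀ x v : W, P x → {t : E | ¬ P (x + t • v)}.ncard ≤ d

open scoped Classical in
/-- The Schwartz-Zippel bound: average over the lines through a point at which `P` holds. -/
theorem GenericOnLines.card_mul_le {E W : Type*} [Field E] [Fintype E] [AddCommGroup W]
    [Module E W] [Fintype W] {d : ℕ} {P : W → Prop} (hP : GenericOnLines E d P) {x₀ : W}
    (hx₀ : P x₀) :
    (Finset.univ.filter fun x => ¬ P x).card * (Fintype.card E - 1) ≤ d * Fintype.card W := by
  have h1 : ∀ t ∈ Finset.univ.erase (0 : E),
      (Finset.univ.filter fun x => ¬ P (x₀ + t • x)).card =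
        (Finset.univ.filter fun x => ¬ P x).card := by
    intro t ht
    have ht0 : t ≠ 0 := Finset.ne_of_mem_erase ht
    refine Finset.card_bij (fun x _ => x₀ + t • x) ?_ ?_ ?_
    · intro x hx
      simpa using hx
    · intro x _ y _ h
      exact smul_right_injective W ht0 (add_left_cancel h)
    · intro x hx
      refine ⟨t⁻¹ • (x - x₀), ?_, ?_⟩
      · simpa [smul_smul, ht0] using hx
      · simp [smul_smul, ht0]
  have h2 : ∑ t ∈ Finset.univ.erase (0 : E),
      (Finset.univ.filter fun x => ¬ P (x₀ + t • x)).card =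
        (Finset.univ.filter fun x => ¬ P x).card * (Fintype.card E - 1) := by
    rw [Finset.sum_congr rfl h1, Finset.sum_const, Finset.card_erase_of_mem (Finset.mem_univ _),
      Finset.card_univ, smul_eq_mul, mul_comm]
  rw [← h2]
  simp_rw [Finset.card_filter]
  rw [Finset.sum_comm]
  calc _ ≤ ∑ _x : W, d := by
        refine Finset.sum_le_sum fun x _ => ?_
        refine le_trans ?_ (hP x₀ x hx₀)
        rw [← Finset.card_filter, Set.ncard_eq_toFinset_card']
        refine Finset.card_le_card fun t ht => ?_
        simpa using (Finset.mem_filter.1 ht).2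
    _ = d * Fintype.card W := by simp [mul_comm]

/-- Precomposition with an affine map. -/
theorem GenericOnLines.comp {E W W' : Type*} [Field E] [AddCommGroup W] [Module E W]
    [AddCommGroup W'] [Module E W'] {d : ℕ} {P : W → Prop} (hP : GenericOnLines E d P)
    (f : W' → W) (g : W' → W) (hf : ∀ x v, ∀ t : E, f (x + t • v) = f x + t • g v) :
    GenericOnLines E d fun x => P (f x) := by
  intro x v hx
  simp_rw [hf]
  exact hP _ _ hx

theorem ncard_det_add_smul_eq_zero_le {E R : Type*} [Field E] [Fintype R]
    [DecidableEq R] (A B : Matrix R R E) (hA : A.det ≠ 0) :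
    {t : E | (A + t • B).det = 0}.ncard ≤ Fintype.card R := by
  classical
  let p : Polynomial E := Matrix.det ((Polynomial.X : Polynomial E) • B.map Polynomial.C +
    A.map Polynomial.C)
  have heval : ∀ t, p.eval t = (A + t • B).det := by
    intro t
    have := RingHom.map_det (Polynomial.evalRingHom t) ((Polynomial.X : Polynomial E) •
      B.map Polynomial.C + A.map Polynomial.C)
    rw [Polynomial.coe_evalRingHom] at this
    rw [this]
    congr 1
    ext i j
    simp [add_comm]
    ring
  have hp : p ≠ 0 := by
    intro h
    apply hA
    have := heval 0
    rw [h] at this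
    simpa using this.symm
  have hsub : {t : E | (A + t • B).det = 0} ⊆ (p.roots.toFinset : Set E) := by
    intro t ht
    simp only [Finset.mem_coe, Multiset.mem_toFinset, Polynomial.mem_roots hp,
      Polynomial.IsRoot.def, heval]
    exact ht
  calc _ ≤ (p.roots.toFinset : Set E).ncard := Set.ncard_le_ncard hsub (Finset.finite_toSet _)
    _ = p.roots.toFinset.card := Set.ncard_coe_finset _
    _ ≤ Multiset.card p.roots := Multiset.toFinset_card_le _
    _ ≤ p.natDegree := p.card_roots'
    _ ≤ Fintype.card R := Polynomial.natDegree_det_X_add_C_le B A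

/-! ### Independent query tensors -/

/-- Every server `i` receives a vector `w i g a` for every `g : Fin n` and `a : Fin K`. These are
independent after tensoring with the column of `G` at `i`: the responses to the corresponding
queries are independent functionals of the message. -/
def TensorIndep {F E C : Type*} [Field F] [Field E] [Algebra F E] {N n K : ℕ}
    (G : Matrix (Fin K) (Fin N) F) (w : Fin N → Fin n → Fin K → C → E) : Prop :=
  ∀ y : Fin N → Fin n → Fin K → E,
    (∀ c k, ∑ i, ∑ g, ∑ a, y i g a * w i g a c * algebraMap F E (G k i) = 0) → y = 0

theorem TensorIndep.generic {F E C : Type*} [Field F] [Field E] [Algebra F E] [Fintype E]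
    [Fintype C] {N n K : ℕ} (hC : Fintype.card C = n * N) (G : Matrix (Fin K) (Fin N) F) :
    GenericOnLines E (N * n * K) (TensorIndep (E := E) (C := C) (n := n) G) := by
  classical
  have hcard : Fintype.card (C × Fin K) = Fintype.card (Fin N × Fin n × Fin K) := by
    simp only [Fintype.card_prod, hC, Fintype.card_fin]; ring
  let σ : C × Fin K ≃ Fin N × Fin n × Fin K := Fintype.equivOfCardEq hcard
  let A : (Fin N → Fin n → Fin K → C → E) → Matrix (C × Fin K) (C × Fin K) E :=
    fun w => Matrix.of fun r s =>
      w (σ s).1 (σ s).2.1 (σ s).2.2 r.1 * algebraMap F E (G r.2 (σ s).1)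
  have hA : ∀ w, TensorIndep G w ↔ (A w).det ≠ 0 := by
    intro w
    have hmul : ∀ y : Fin N → Fin n → Fin K → E, ∀ r : C × Fin K,
        (A w).mulVec (fun s => y (σ s).1 (σ s).2.1 (σ s).2.2) r =
          ∑ i, ∑ g, ∑ a, y i g a * w i g a r.1 * algebraMap F E (G r.2 i) := by
      intro y r
      rw [Matrix.mulVec, dotProduct]
      refine (Equiv.sum_comp σ (fun s : Fin N × Fin n × Fin K =>
        w s.1 s.2.1 s.2.2 r.1 * algebraMap F E (G r.2 s.1) * y s.1 s.2.1 s.2.2)).trans ?_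
      rw [Fintype.sum_prod_type]
      refine Finset.sum_congr rfl fun i _ => ?_
      rw [Fintype.sum_prod_type]
      refine Finset.sum_congr rfl fun g _ => Finset.sum_congr rfl fun a _ => ?_
      ring
    rw [ne_eq, ← Matrix.exists_mulVec_eq_zero_iff, not_exists]
    constructor
    · rintro h v ⟨hv0, hv⟩
      apply hv0
      have h0 := h (fun i g a => v (σ.symm (i, g, a))) fun c k => by
        rw [← hmul _ (c, k)]
        simp only [Prod.mk.eta, Equiv.symm_apply_apply]
        exact congrFun hv (c, k)
      funext s
      have := congrFun (congrFun (congrFun h0 (σ s).1) (σ s).2.1) (σ s).2.2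
      simpa using this
    · intro h y hy
      by_contra hne
      refine h (fun s => y (σ s).1 (σ s).2.1 (σ s).2.2) ⟨fun h0 => hne ?_, ?_⟩
      · funext i g a
        have := congrFun h0 (σ.symm (i, g, a))
        simpa using this
      · funext r
        rw [hmul, hy]; rfl
  intro w v hw
  have hlin : ∀ t : E, A (w + t • v) = A w + t • A v := by
    intro t
    ext r s
    simp [A]; ring
  simp only [hA, hlin, not_not]
  refine (ncard_det_add_smul_eq_zero_le _ _ ((hA w).1 hw)).trans (le_of_eq ?_)
  rw [hcard]; simp [mul_assoc]

/-- Vectors with a leading part in `Λ → E` and a noise part in `M → E`. -/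
def joinParts {E Λ M : Type*} {N n K : ℕ} (z : Fin N → Fin n → Fin K → Λ → E)
    (m : Fin N → Fin n → Fin K → M → E) : Fin N → Fin n → Fin K → Λ ⊕ M → E :=
  fun i g a => Sum.elim (z i g a) (m i g a)

theorem TensorIndep.smul_noise {F E Λ M : Type*} [Field F] [Field E] [Algebra F E] {N n K : ℕ}
    {G : Matrix (Fin K) (Fin N) F} {z : Fin N → Fin n → Fin K → Λ → E}
    {m : Fin N → Fin n → Fin K → M → E} (h : TensorIndep G (joinParts z m)) {s : E} (hs : s ≠ 0) :
    TensorIndep G (joinParts z (s • m)) := by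
  intro y hy
  refine h y fun c k => ?_
  rcases c with c | c
  · simpa [joinParts] using hy (Sum.inl c) k
  · have := hy (Sum.inr c) k
    simp only [joinParts, Sum.elim_inr, Pi.smul_apply, smul_eq_mul] at this ⊢
    have e : ∑ i, ∑ g, ∑ a, y i g a * (s * m i g a c) * algebraMap F E (G k i) =
        s * ∑ i, ∑ g, ∑ a, y i g a * m i g a c * algebraMap F E (G k i) := by
      simp_rw [Finset.mul_sum]
      refine Finset.sum_congr rfl fun i _ => Finset.sum_congr rfl fun g _ =>
        Finset.sum_congr rfl fun a _ => ?_
      ring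
    rw [e] at this
    exact (mul_eq_zero.1 this).resolve_left hs

/-- For every `g`, the codeword with information symbols `z t g`, `t : Fin T`. -/
def codewords {F X : Type*} [Field F] [AddCommGroup X] [Module F X] {N T n : ℕ}
    (H : Matrix (Fin T) (Fin N) F) (z : Fin T → Fin n → X) : Fin N → Fin n → X :=
  fun i g => ∑ t, H t i • z t g

/-- The action of matrices over `F` on families of information symbols. -/
def mix {F X : Type*} [Field F] [AddCommGroup X] [Module F X] {T n : ℕ}
    (A : Matrix (Fin T × Fin n) (Fin T × Fin n) F) (z : Fin T → Fin n → X) : Fin T → Fin n → X :=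
  fun t g => ∑ s : Fin T × Fin n, A (t, g) s • z s.1 s.2

theorem mix_mul {F X : Type*} [Field F] [AddCommGroup X] [Module F X] {T n : ℕ}
    (A B : Matrix (Fin T × Fin n) (Fin T × Fin n) F) (z : Fin T → Fin n → X) :
    mix (A * B) z = mix A (mix B z) := by
  funext t g
  simp only [mix, Matrix.mul_apply, Finset.sum_smul, Finset.smul_sum, smul_smul]
  exact Finset.sum_comm

theorem mix_one {F X : Type*} [Field F] [AddCommGroup X] [Module F X] {T n : ℕ}
    (z : Fin T → Fin n → X) : mix (1 : Matrix (Fin T × Fin n) (Fin T × Fin n) F) z = z := by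
  funext t g
  simp [mix, Matrix.one_apply, ite_smul]

theorem mix_add_smul {F E X : Type*} [Field F] [Field E] [AddCommGroup X] [Module F X] [Module E X]
    [SMulCommClass E F X] {T n : ℕ} (A : Matrix (Fin T × Fin n) (Fin T × Fin n) F)
    (z v : Fin T → Fin n → X) (s : E) : mix A (z + s • v) = mix A z + s • mix A v := by
  funext t g
  simp only [mix, Pi.add_apply, Pi.smul_apply, smul_add, Finset.sum_add_distrib, Finset.smul_sum]
  congr 1
  exact Finset.sum_congr rfl fun _ _ => (smul_comm _ _ _).symm

theorem codewords_add_smul {F E X : Type*} [Field F] [Field E] [AddCommGroup X] [Module F X]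
    [Module E X] [SMulCommClass E F X] {N T n : ℕ} (H : Matrix (Fin T) (Fin N) F)
    (z v : Fin T → Fin n → X) (s : E) :
    codewords H (z + s • v) = codewords H z + s • codewords H v := by
  funext i g
  simp only [codewords, Pi.add_apply, Pi.smul_apply, smul_add, Finset.sum_add_distrib,
    Finset.smul_sum]
  congr 1
  exact Finset.sum_congr rfl fun _ _ => (smul_comm _ _ _).symm

/-- The leading parts that are admissible: after any recombination over `F`, the codewords can, for
every set `J` of `T` servers, be completed to an independent family by a noise part that
vanishes on `J`. -/
def AdmissibleLead {F E Λ : Type*} (M : Type*) [Field F] [Field E] [Algebra F E] {N n K T : ℕ}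
    (G : Matrix (Fin K) (Fin N) F) (H : Matrix (Fin T) (Fin N) F)
    (z : Fin T → Fin n → Fin K → Λ → E) : Prop :=
  ∀ A : Matrix (Fin T × Fin n) (Fin T × Fin n) F, IsUnit A → ∀ J : Finset (Fin N), J.card = T →
    ∃ m : Fin N → Fin n → Fin K → M → E, (∀ i ∈ J, m i = 0) ∧
      TensorIndep G (joinParts (codewords H (mix A z)) m)

theorem AdmissibleLead.mix {F E Λ M : Type*} [Field F] [Field E] [Algebra F E] {N n K T : ℕ}
    {G : Matrix (Fin K) (Fin N) F} {H : Matrix (Fin T) (Fin N) F}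
    {z : Fin T → Fin n → Fin K → Λ → E} (hz : AdmissibleLead M G H z)
    {A : Matrix (Fin T × Fin n) (Fin T × Fin n) F} (hA : IsUnit A) :
    AdmissibleLead M G H (mix A z) := by
  intro B hB J hJ
  rw [← mix_mul]
  exact hz _ (hB.mul hA) J hJ

section

variable {F E Λ M : Type*} [Field F] [Field E] [Algebra F E] {N n K T : ℕ}
  {G : Matrix (Fin K) (Fin N) F} {H : Matrix (Fin T) (Fin N) F}

open scoped Classical in
theorem exists_admissibleLead [Fintype F] [Fintype E] [Fintype Λ] [Fintype M]
    (hC : Fintype.card (Λ ⊕ M) = n * N)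
    (hQ : Fintype.card (Matrix (Fin T × Fin n) (Fin T × Fin n) F × Finset (Fin N)) *
      (N * n * K) < Fintype.card E - 1)
    (hex : ∀ J : Finset (Fin N), J.card = T → ∃ (z : Fin T → Fin n → Fin K → Λ → E)
      (m : Fin N → Fin n → Fin K → M → E), (∀ i ∈ J, m i = 0) ∧
        TensorIndep G (joinParts (codewords H z) m)) :
    ∃ z : Fin T → Fin n → Fin K → Λ → E, AdmissibleLead M G H z := by
  choose! zJ mJ hm hind using hex
  let P : Matrix (Fin T × Fin n) (Fin T × Fin n) F × Finset (Fin N) →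
      (Fin T → Fin n → Fin K → Λ → E) → Prop :=
    fun p z => TensorIndep G (joinParts (codewords H (OneShotPIR.mix p.1 z)) (mJ p.2))
  have hgen : ∀ p, GenericOnLines E (N * n * K) (P p) := by
    intro p
    refine (TensorIndep.generic hC G).comp
      (fun z => joinParts (codewords H (OneShotPIR.mix p.1 z)) (mJ p.2))
      (fun z => joinParts (codewords H (OneShotPIR.mix p.1 z)) 0) ?_
    intro x v t
    rw [mix_add_smul, codewords_add_smul]
    funext i g a c
    rcases c with c | c <;> simp [joinParts]
  have hbad : ∀ p ∈ Finset.univ.filter (fun p : Matrix (Fin T × Fin n) (Fin T × Fin n) F ×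
      Finset (Fin N) => IsUnit p.1 ∧ p.2.card = T),
      (Finset.univ.filter fun z => ¬ P p z).card * (Fintype.card E - 1) ≤
        N * n * K * Fintype.card (Fin T → Fin n → Fin K → Λ → E) := by
    intro p hp
    obtain ⟨hu, hJ⟩ := (Finset.mem_filter.1 hp).2
    obtain ⟨B, hB⟩ := hu.exists_right_inv
    refine (hgen p).card_mul_le (x₀ := OneShotPIR.mix B (zJ p.2)) ?_
    simp only [P]
    rw [← mix_mul, hB, mix_one]
    exact hind p.2 hJ
  by_contra hno
  push Not at hno
  have hcover : (Finset.univ : Finset (Fin T → Fin n → Fin K → Λ → E)) ⊆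
      (Finset.univ.filter (fun p : Matrix (Fin T × Fin n) (Fin T × Fin n) F ×
        Finset (Fin N) => IsUnit p.1 ∧ p.2.card = T)).biUnion fun p =>
          Finset.univ.filter fun z => ¬ P p z := by
    intro z _
    have := hno z
    unfold AdmissibleLead at this
    push Not at this
    obtain ⟨A, hA, J, hJ, h⟩ := this
    simp only [Finset.mem_biUnion, Finset.mem_filter, Finset.mem_univ, true_and]
    exact ⟨(A, J), ⟨hA, hJ⟩, h (mJ J) (hm J hJ)⟩
  have h1 := (Finset.card_le_card hcover).trans Finset.card_biUnion_le
  have h2 := Nat.mul_le_mul_right (Fintype.card E - 1) h1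
  rw [Finset.sum_mul] at h2
  have h3 := h2.trans (Finset.sum_le_sum hbad)
  rw [Finset.sum_const, smul_eq_mul, Finset.card_univ] at h3
  have h4 : (Finset.univ.filter (fun p : Matrix (Fin T × Fin n) (Fin T × Fin n) F ×
        Finset (Fin N) => IsUnit p.1 ∧ p.2.card = T)).card ≤
      Fintype.card (Matrix (Fin T × Fin n) (Fin T × Fin n) F × Finset (Fin N)) :=
    Finset.card_le_univ _
  have hW : 0 < Fintype.card (Fin T → Fin n → Fin K → Λ → E) := Fintype.card_pos
  have h5 := h3.trans (Nat.mul_le_mul_right _ h4)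
  rw [← mul_assoc, mul_comm] at h5
  exact absurd (Nat.le_of_mul_le_mul_right h5 hW) (not_le.2 hQ)

open scoped Classical in
theorem card_not_tensorIndep_mul_le [Fintype E] [Fintype Λ] [Fintype M] [DecidableEq M]
    (hC : Fintype.card (Λ ⊕ M) = n * N) (hTN : T ≤ N)
    (hQ : N * n * K < Fintype.card E - 1) {z : Fin T → Fin n → Fin K → Λ → E}
    (hz : AdmissibleLead M G H z) (S : Finset (Fin N)) (hS : S.card ≤ T)
    (b : Fin N → Fin n → Fin K → M → E) :
    (Finset.univ.filter fun y : Fin N → Fin n → Fin K → M → E =>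
      ¬ TensorIndep G (joinParts (codewords H z) (S.piecewise b y))).card *
        (Fintype.card E - 1) ≤ N * n * K * Fintype.card (Fin N → Fin n → Fin K → M → E) := by
  have hgen : GenericOnLines E (N * n * K) fun y : Fin N → Fin n → Fin K → M → E =>
      TensorIndep G (joinParts (codewords H z) (S.piecewise b y)) := by
    refine (TensorIndep.generic hC G).comp
      (fun y => joinParts (codewords H z) (S.piecewise b y))
      (fun y => joinParts 0 (S.piecewise 0 y)) ?_
    intro x v t
    funext i g a c
    rcases c with c | c <;> by_cases hi : i ∈ S <;> simp [joinParts, hi]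
  obtain ⟨J, hSJ, hJ⟩ := Finset.exists_superset_card_eq hS (by simpa using hTN)
  obtain ⟨m₀, hm₀, hind⟩ := hz 1 isUnit_one J hJ
  rw [mix_one] at hind
  -- Scale the prescribed values towards zero, where completion is possible, and scale back.
  have hline := TensorIndep.generic hC G (joinParts (codewords H z) m₀)
    (joinParts 0 (S.piecewise b 0)) hind
  obtain ⟨t, ht0, ht⟩ : ∃ t : E, t ≠ 0 ∧ TensorIndep G (joinParts (codewords H z) m₀ +
      t • joinParts 0 (S.piecewise b 0)) := by
    by_contra hno
    push Not at hno
    have hsub : ((Finset.univ.erase (0 : E) : Finset E) : Set E) ⊆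
        {t : E | ¬ TensorIndep G (joinParts (codewords H z) m₀ +
          t • joinParts 0 (S.piecewise b 0))} := by
      intro t ht
      exact hno t (Finset.ne_of_mem_erase ht)
    have := Set.ncard_le_ncard hsub (Set.toFinite _)
    rw [Set.ncard_coe_finset, Finset.card_erase_of_mem (Finset.mem_univ _), Finset.card_univ]
      at this
    omega
  have hjoin : joinParts (codewords H z) m₀ + t • joinParts 0 (S.piecewise b 0) =
      joinParts (codewords H z) (m₀ + t • S.piecewise b 0) := by
    funext i g a c
    rcases c with c | c <;> simp [joinParts]
  rw [hjoin] at ht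
  have hscaled := ht.smul_noise (inv_ne_zero ht0)
  refine hgen.card_mul_le (x₀ := t⁻¹ • m₀) ?_
  convert hscaled using 2
  funext i
  by_cases hi : i ∈ S
  · simp [hi, hm₀ i (hSJ hi), smul_smul, ht0]
  · simp [hi]

end

/-! ### Circulant designs -/

/-- Any `k` columns of `G` can be separated by the functionals of the row space. -/
def ColumnsSeparated {F : Type*} [Field F] {N k : ℕ} (G : Matrix (Fin k) (Fin N) F) : Prop :=
  ∀ S : Finset (Fin N), S.card ≤ k → ∀ i₀ : Fin N,
    ∃ u : Fin k → F, ∀ i ∈ S, ∑ a, u a * G a i = if i = i₀ then 1 else 0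

section

variable {F E : Type*} [Field F] [Field E] [Algebra F E] {N K T : ℕ}
  {G : Matrix (Fin K) (Fin N) F}

theorem ColumnsSeparated.eq_zero (hG : ColumnsSeparated G) {y : Fin N → E} (S : Finset (Fin N))
    (hS : S.card ≤ K) (hyS : ∀ i ∉ S, y i = 0)
    (hy : ∀ k, ∑ i, y i * algebraMap F E (G k i) = 0) (i : Fin N) : y i = 0 := by
  by_cases hi : i ∈ S
  swap
  · exact hyS i hi
  obtain ⟨u, hu⟩ := hG S hS i
  have h : ∑ k, algebraMap F E (u k) * ∑ j, y j * algebraMap F E (G k j) = 0 :=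
    Finset.sum_eq_zero fun k _ => by rw [hy, mul_zero]
  simp_rw [Finset.mul_sum] at h
  rw [Finset.sum_comm] at h
  have h2 : ∀ j, ∑ k, algebraMap F E (u k) * (y j * algebraMap F E (G k j)) =
      if j = i then y j else 0 := by
    intro j
    by_cases hj : j ∈ S
    · have := congrArg (fun v => y j * algebraMap F E v) (hu j hj)
      simp only [map_sum, map_mul, Finset.mul_sum] at this
      rw [Finset.sum_congr rfl fun k _ => mul_left_comm _ _ _, this]
      split_ifs <;> simp
    · rw [hyS j hj]; simp
  rw [Finset.sum_congr rfl fun j _ => h2 j] at h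
  simpa using h

theorem card_filter_exists_le {N : ℕ} (S : Finset (Fin N)) (f : Fin N → ℕ)
    (hf : Set.InjOn f S) (B : Finset ℕ) (h : ℕ → ℕ) :
    (S.filter fun i => ∃ b ∈ B, f i = h b).card ≤ B.card := by
  refine (Finset.card_le_card_of_injOn (t := B.image h) f ?_ ?_).trans Finset.card_image_le
  · intro i hi
    obtain ⟨b, hb, e⟩ := (Finset.mem_filter.1 hi).2
    exact Finset.mem_image.2 ⟨b, hb, e.symm⟩
  · exact hf.mono fun i hi => (Finset.mem_filter.1 hi).1

/-- The cell `(b, a)` of an array with `q ≤ p` rows and `K ≤ p` columns contains the server of `S`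
with number `b + a` modulo `p`. As the servers in a row are distinct, the queries which use the
coordinate `b` for the `a`-th vector of that server are independent. -/
theorem ColumnsSeparated.circulant (hG : ColumnsSeparated G) (S : Finset (Fin N)) (f : Fin N → ℕ)
    (hf : Set.InjOn f S) {p q : ℕ} (hKp : K ≤ p) (y : Fin N → Fin K → E)
    (hy : ∀ b : Fin q, ∀ k, ∑ i, ∑ a : Fin K,
      y i a * (if i ∈ S ∧ f i = ((b : ℕ) + a) % p then 1 else 0) * algebraMap F E (G k i) = 0)
    {i : Fin N} (hi : i ∈ S) (a : Fin K) (b : Fin q) (hb : f i = ((b : ℕ) + a) % p) :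
    y i a = 0 := by
  have huniq : ∀ a' : Fin K, f i = ((b : ℕ) + a') % p → a' = a := by
    intro a' h
    have h1 : (b : ℕ) + a' ≡ b + a [MOD p] := h.symm.trans hb
    have h2 := Nat.ModEq.add_left_cancel' _ h1
    exact Fin.ext (h2.eq_of_lt_of_lt (a'.2.trans_le hKp) (a.2.trans_le hKp))
  have h0 := hG.eq_zero (y := fun i => ∑ a : Fin K, y i a *
      if i ∈ S ∧ f i = ((b : ℕ) + a) % p then 1 else 0)
    (S.filter fun i => ∃ a ∈ Finset.range K, f i = ((b : ℕ) + a) % p)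
    ((card_filter_exists_le S f hf (Finset.range K) fun a => ((b : ℕ) + a) % p).trans (by simp))
    (fun j hj => Finset.sum_eq_zero fun a' _ => by
      rw [if_neg, mul_zero]
      rintro ⟨h1, h2⟩
      exact hj (Finset.mem_filter.2 ⟨h1, a', Finset.mem_range.2 a'.2, h2⟩))
    (fun k => by
      refine Eq.trans ?_ (hy b k)
      exact Finset.sum_congr rfl fun j _ => by rw [Finset.sum_mul]) i
  rw [Finset.sum_eq_single a] at h0
  · rw [if_pos ⟨hi, hb⟩, mul_one] at h0
    exact h0
  · intro a' _ hne
    rw [if_neg, mul_zero]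
    rintro ⟨-, h⟩
    exact hne (huniq a' h)
  · intro h; exact absurd (Finset.mem_univ _) h

theorem exists_add_mod_eq {p v a : ℕ} (hv : v < p) (ha : a < p) :
    ∃ b < p, v = (b + a) % p := by
  refine ⟨(v + (p - a)) % p, Nat.mod_lt _ (by omega), ?_⟩
  rw [Nat.mod_add_mod, add_assoc, Nat.sub_add_cancel ha.le, Nat.add_mod_right,
    Nat.mod_eq_of_lt hv]

theorem exists_numbering (S : Finset (Fin N)) {p : ℕ} (hp : S.card = p) :
    ∃ f : Fin N → ℕ, Set.InjOn f S ∧ ∀ i ∈ S, f i < p := by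
  classical
  let e := S.equivFinOfCardEq hp
  refine ⟨fun i => if h : i ∈ S then e ⟨i, h⟩ else 0, ?_, ?_⟩
  · intro i hi j hj h
    simp only [Finset.mem_coe] at hi hj
    simp only [hi, hj, dif_pos] at h
    have := e.injective (Fin.ext h)
    exact congrArg Subtype.val this
  · intro i hi
    simp only [hi, dif_pos]
    exact (e ⟨i, hi⟩).2

/-- For every set `J` of `T` servers there are codewords and a noise part vanishing on `J` which
together give an independent family. The noise is a circulant design on the servers outside `J`.
If `T ≤ K`, then the leading part is a codeword without zeros on the coordinate `a`, and outside
of the design it remains to treat `K` servers for every `a`. If `K ≤ T`, then the design covers all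
servers outside `J`, and the leading part is a circulant design on `J`. -/
theorem exists_codewords_tensorIndep {H : Matrix (Fin T) (Fin N) F} (hG : ColumnsSeparated G)
    (hH : ColumnsSeparated H) (hT : 1 ≤ T) (hN : K + T ≤ N) (n : ℕ) {ξ : Fin T → E}
    (hξ : LinearIndependent F ξ) (J : Finset (Fin N)) (hJ : J.card = T) :
    ∃ (z : Fin T → Fin n → Fin K → Fin n × Fin (max T K) → E)
      (m : Fin N → Fin n → Fin K → Fin n × Fin (N - max T K) → E), (∀ i ∈ J, m i = 0) ∧
        TensorIndep G (joinParts (codewords H z) m) := by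
  have hJc : Jᶜ.card = N - T := by rw [Finset.card_compl, hJ, Fintype.card_fin]
  obtain ⟨f, hf, hfp⟩ := exists_numbering Jᶜ hJc
  let m : Fin N → Fin n → Fin K → Fin n × Fin (N - max T K) → E := fun i g a c =>
    if c.1 = g ∧ i ∈ Jᶜ ∧ f i = ((c.2 : ℕ) + a) % (N - T) then 1 else 0
  have hmJ : ∀ i ∈ J, m i = 0 := by
    intro i hi
    funext g a c
    simp [m, hi]
  -- The noise part alone shows that the coefficients in the cells of the design vanish.
  have hkill : ∀ z : Fin N → Fin n → Fin K → Fin n × Fin (max T K) → E,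
      ∀ y : Fin N → Fin n → Fin K → E,
      (∀ c k, ∑ i, ∑ g, ∑ a, y i g a * joinParts z m i g a c * algebraMap F E (G k i) = 0) →
      ∀ i ∉ J, ∀ g, ∀ a : Fin K, ∀ b < N - max T K, f i = (b + a) % (N - T) → y i g a = 0 := by
    intro z y hy i hi g a b hb hfb
    refine hG.circulant Jᶜ f hf (p := N - T) (q := N - max T K) (by omega)
      (fun i a => y i g a) (fun b k => ?_) (by simpa using hi) a ⟨b, hb⟩ hfb
    refine Eq.trans ?_ (hy (Sum.inr (g, b)) k)
    refine Finset.sum_congr rfl fun i _ => ?_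
    rw [Finset.sum_eq_single g]
    · simp [joinParts, m]
    · intro g' _ hne
      refine Finset.sum_eq_zero fun a _ => ?_
      simp [joinParts, m, hne.symm]
    · intro h; exact absurd (Finset.mem_univ _) h
  rcases le_total T K with hTK | hKT
  · have hmax : max T K = K := max_eq_right hTK
    let z : Fin T → Fin n → Fin K → Fin n × Fin (max T K) → E := fun t g a c =>
      if c.1 = g ∧ (c.2 : ℕ) = a then ξ t else 0
    let d : Fin N → E := fun i => ∑ t, H t i • ξ t
    have hz : ∀ i g a c, codewords H z i g a c =
        if c.1 = g ∧ (c.2 : ℕ) = (a : ℕ) then d i else 0 := by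
      intro i g a c
      simp only [codewords, Finset.sum_apply, Pi.smul_apply, z, d]
      split_ifs <;> simp
    have hd : ∀ i, d i ≠ 0 := by
      intro i h
      have h0 := Fintype.linearIndependent_iff.1 hξ (fun t => H t i) h
      obtain ⟨u, hu⟩ := hH {i} (by simpa using hT) i
      have := hu i (by simp)
      simp [h0] at this
    refine ⟨z, m, hmJ, fun y hy => ?_⟩
    have hk := hkill _ y hy
    funext i g a
    have hcard : (J ∪ Jᶜ.filter fun i => ∃ b ∈ Finset.Ico (N - K) (N - T),
        f i = (b + a) % (N - T)).card ≤ K := by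
      refine (Finset.card_union_le _ _).trans ?_
      have := card_filter_exists_le Jᶜ f hf (Finset.Ico (N - K) (N - T)) fun b => (b + a) % (N - T)
      rw [Nat.card_Ico] at this
      omega
    have h0 := hG.eq_zero (y := fun i => y i g a * d i) _ hcard ?_ ?_ i
    · exact (mul_eq_zero.1 h0).resolve_right (hd i)
    · intro j hj
      simp only [Finset.mem_union, Finset.mem_filter, not_or, not_and, Finset.mem_compl] at hj
      obtain ⟨b, hb, hfb⟩ := exists_add_mod_eq (a := a) (hfp j (by simpa using hj.1))
        (a.2.trans_le (by omega))
      have hbK : b < N - K := by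
        by_contra hlt
        exact hj.2 hj.1 ⟨b, Finset.mem_Ico.2 ⟨by omega, hb⟩, hfb⟩
      rw [hk j hj.1 g a b (by rw [hmax]; exact hbK) hfb, zero_mul]
    · intro k
      refine Eq.trans ?_ (hy (Sum.inl (g, ⟨a, by rw [hmax]; exact a.2⟩)) k)
      refine Finset.sum_congr rfl fun j _ => ?_
      rw [Finset.sum_eq_single g, Finset.sum_eq_single a]
      · simp [joinParts, hz]
      · intro a' _ hne
        have : (a : ℕ) ≠ a' := fun h => hne (Fin.ext h.symm)
        simp [joinParts, hz, this]
      · intro h; exact absurd (Finset.mem_univ _) h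
      · intro g' _ hne
        refine Finset.sum_eq_zero fun a _ => ?_
        simp [joinParts, hz, hne.symm]
      · intro h; exact absurd (Finset.mem_univ _) h
  · have hmax : max T K = T := max_eq_left hKT
    obtain ⟨e, he, hep⟩ := exists_numbering J hJ
    choose u hu using hH J hJ.le
    let x : Fin N → Fin n → Fin K → Fin n × Fin (max T K) → E := fun i g a c =>
      if c.1 = g ∧ i ∈ J ∧ e i = ((c.2 : ℕ) + a) % T then 1 else 0
    let z : Fin T → Fin n → Fin K → Fin n × Fin (max T K) → E := fun t g =>
      ∑ j ∈ J, u j t • x j g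
    have hz : ∀ i ∈ J, ∀ g, codewords H z i g = x i g := by
      intro i hi g
      simp only [codewords, z, Finset.smul_sum, smul_smul]
      rw [Finset.sum_comm]
      simp_rw [← Finset.sum_smul]
      have : ∀ j, ∑ t, H t i * u j t = if i = j then 1 else 0 := by
        intro j
        rw [← hu j i hi]
        exact Finset.sum_congr rfl fun t _ => mul_comm _ _
      simp_rw [this, ite_smul, one_smul, zero_smul]
      simp [hi]
    refine ⟨z, m, hmJ, fun y hy => ?_⟩
    have hout : ∀ i ∉ J, ∀ g a, y i g a = 0 := by
      intro i hi g a
      obtain ⟨b, hb, hfb⟩ := exists_add_mod_eq (a := a) (hfp i (by simpa using hi))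
        (a.2.trans_le (by omega))
      exact hkill _ y hy i hi g a b (by rw [hmax]; exact hb) hfb
    funext i g a
    by_cases hi : i ∈ J
    swap
    · exact hout i hi g a
    obtain ⟨b, hb, hfb⟩ := exists_add_mod_eq (a := a) (hep i hi) (a.2.trans_le hKT)
    refine hG.circulant J e he (p := T) (q := T) hKT (fun i a => y i g a) (fun b k => ?_) hi a
      ⟨b, hb⟩ hfb
    refine Eq.trans ?_ (hy (Sum.inl (g, ⟨b, by rw [hmax]; exact b.2⟩)) k)
    refine Finset.sum_congr rfl fun j _ => ?_
    by_cases hj : j ∈ J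
    · rw [Finset.sum_eq_single g]
      · simp [joinParts, hz j hj, x]
      · intro g' _ hne
        refine Finset.sum_eq_zero fun a _ => ?_
        simp [joinParts, hz j hj, x, hne.symm]
      · intro h; exact absurd (Finset.mem_univ _) h
    · simp [hout j hj]

end

/-! ### The laws of the queries to one message -/

theorem pmf_map_uniformOfFintype_of_surjective {A B : Type*} [AddGroup A] [AddGroup B] [Fintype A]
    [Fintype B] (f : A →+ B) (hf : Function.Surjective f) :
    (PMF.uniformOfFintype A).map f = PMF.uniformOfFintype B := by
  classical
  ext b
  obtain ⟨a₀, rfl⟩ := hf b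
  have hconst : ∀ b, (Finset.univ.filter fun a => b = f a).card =
      (Finset.univ.filter fun a => f a = 0).card := by
    intro b
    obtain ⟨a₁, rfl⟩ := hf b
    refine Finset.card_bij (fun a _ => a - a₁) ?_ ?_ ?_
    · intro a ha
      simp only [Finset.mem_filter, Finset.mem_univ, true_and] at ha ⊢
      rw [map_sub, ha, sub_self]
    · intro a _ a' _ h
      exact sub_left_injective h
    · intro a ha
      refine ⟨a + a₁, ?_, by simp⟩
      simp only [Finset.mem_filter, Finset.mem_univ, true_and] at ha ⊢
      rw [map_add, ha, zero_add]
  have hcard : Fintype.card A = Fintype.card B * (Finset.univ.filter fun a => f a = 0).card := by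
    have := Finset.card_eq_sum_card_fiberwise (f := f) (s := Finset.univ) (t := Finset.univ)
      (fun _ _ => Finset.mem_coe.2 (Finset.mem_univ _))
    rw [Finset.card_univ] at this
    rw [this, Finset.sum_congr rfl fun b _ => by
      rw [Finset.filter_congr fun a _ => eq_comm, hconst b], Finset.sum_const, Finset.card_univ,
      smul_eq_mul]
  rw [PMF.map_apply, tsum_fintype]
  simp only [PMF.uniformOfFintype_apply]
  rw [← Finset.sum_filter, Finset.sum_const, nsmul_eq_mul]
  have h1 : ((Finset.univ.filter fun a => f a₀ = f a).card : ENNReal) =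
      ((Finset.univ.filter fun a => f a = 0).card : ENNReal) := by rw [hconst]
  have hne : (Finset.univ.filter fun a => f a = 0).card ≠ 0 :=
    Finset.card_ne_zero_of_mem (a := 0) (by simp)
  have key : ((Finset.univ.filter fun a => f a = 0).card : ENNReal) * (Fintype.card A : ENNReal)⁻¹ =
      (Fintype.card B : ENNReal)⁻¹ := by
    rw [hcard, Nat.cast_mul, ENNReal.mul_inv (by simp) (by simp), mul_left_comm,
      ENNReal.mul_inv_cancel (by exact_mod_cast hne) (by simp), mul_one]
  rw [← key, ← h1]

theorem pmf_map_uniformOfFintype_restrict {ι Y : Type*} [Fintype ι] [DecidableEq ι] [AddGroup Y]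
    [Fintype Y] (J : Finset ι) :
    (PMF.uniformOfFintype (ι → Y)).map (fun m (i : J) => m i.1) =
      PMF.uniformOfFintype (J → Y) := by
  let f : (ι → Y) →+ (J → Y) :=
    { toFun := fun m i => m i.1
      map_zero' := rfl
      map_add' := fun _ _ => rfl }
  refine pmf_map_uniformOfFintype_of_surjective f fun x => ?_
  exact ⟨fun i => if h : i ∈ J then x ⟨i, h⟩ else 0, by funext i; simp [f]⟩

theorem pmf_map_uniformOfFinset_of_perm {A : Type*} (s : Finset A) (hs : s.Nonempty) (f : A → A)
    (hf : Function.Injective f) (hfs : ∀ a ∈ s, f a ∈ s) :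
    (PMF.uniformOfFinset s hs).map f = PMF.uniformOfFinset s hs := by
  classical
  have himg : s.image f = s := by
    refine Finset.eq_of_subset_of_card_le ?_ ?_
    · intro b hb
      obtain ⟨a, ha, rfl⟩ := Finset.mem_image.1 hb
      exact hfs a ha
    · rw [Finset.card_image_of_injective _ hf]
  ext b
  rw [PMF.map_apply]
  by_cases hb : b ∈ s
  · have hb' := hb
    rw [← himg] at hb'
    obtain ⟨a, ha, rfl⟩ := Finset.mem_image.1 hb'
    rw [tsum_eq_single a, if_pos rfl, PMF.uniformOfFinset_apply_of_mem _ ha,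
      PMF.uniformOfFinset_apply_of_mem _ hb]
    intro a' ha'
    rw [if_neg fun h => ha' (hf h).symm]
  · rw [PMF.uniformOfFinset_apply_of_notMem _ hb, ENNReal.tsum_eq_zero]
    intro a
    split_ifs with h
    · rw [PMF.uniformOfFinset_apply_of_notMem]
      intro ha
      exact hb (h ▸ hfs a ha)
    · rfl

/-- Relabelling the codewords separately on every server amounts, on `T` servers, to a
recombination of the information symbols. -/
theorem ColumnsSeparated.exists_mix {F : Type*} [Field F] {N T n : ℕ}
    {H : Matrix (Fin T) (Fin N) F} (hH : ColumnsSeparated H) (J : Finset (Fin N))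
    (hJ : J.card = T) (π : Fin N → Equiv.Perm (Fin n)) :
    ∃ A : Matrix (Fin T × Fin n) (Fin T × Fin n) F, IsUnit A ∧
      ∀ {X : Type*} [AddCommGroup X] [Module F X] (z : Fin T → Fin n → X), ∀ i ∈ J, ∀ g,
        codewords H z i (π i g) = codewords H (mix A z) i g := by
  choose u hu using hH J hJ.le
  have hHu : (Matrix.of fun (i : J) t => H t i.1) * (Matrix.of fun t (j : J) => u j.1 t) = 1 := by
    ext i j
    simp only [Matrix.mul_apply, Matrix.of_apply, Matrix.one_apply]
    rw [Finset.sum_congr rfl fun t _ => mul_comm _ _, hu j.1 i.1 i.2]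
    simp only [Subtype.coe_inj]
  have huH := (Matrix.mul_eq_one_comm_of_card_eq _ _ _ (by simp [hJ])).1 hHu
  let A : (Fin N → Equiv.Perm (Fin n)) → Matrix (Fin T × Fin n) (Fin T × Fin n) F := fun σ =>
    Matrix.of fun p q => ∑ i : J, u i.1 p.1 * (if σ i.1 p.2 = q.2 then 1 else 0) * H q.1 i.1
  -- The row of `A σ` at the codeword symbol of server `i` and label `g`.
  have hrow : ∀ σ : Fin N → Equiv.Perm (Fin n), ∀ i : J, ∀ g q,
      ∑ t, H t i.1 * A σ (t, g) q = if σ i.1 g = q.2 then H q.1 i.1 else 0 := by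
    intro σ i g q
    simp only [A, Matrix.of_apply, Finset.mul_sum]
    rw [Finset.sum_comm]
    have : ∀ j : J, ∑ t, H t i.1 * (u j.1 t * (if σ j.1 g = q.2 then 1 else 0) * H q.1 j.1) =
        if i = j then (if σ i.1 g = q.2 then H q.1 i.1 else 0) else 0 := by
      intro j
      have h := congrFun (congrFun hHu i) j
      simp only [Matrix.mul_apply, Matrix.of_apply, Matrix.one_apply] at h
      rw [Finset.sum_congr rfl fun t _ => show H t i.1 * (u j.1 t *
        (if σ j.1 g = q.2 then 1 else 0) * H q.1 j.1) = (H t i.1 * u j.1 t) *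
          ((if σ j.1 g = q.2 then 1 else 0) * H q.1 j.1) by ring, ← Finset.sum_mul, h]
      by_cases hij : i = j
      · subst hij; simp
      · simp [hij]
    rw [Finset.sum_congr rfl fun j _ => this j]
    simp
  have hmul : ∀ σ : Fin N → Equiv.Perm (Fin n), A σ * A (fun i => (σ i).symm) = 1 := by
    intro σ
    ext p q
    rw [Matrix.mul_apply, Fintype.sum_prod_type]
    have h1 : ∀ t g, A σ p (t, g) * A (fun i => (σ i).symm) (t, g) q = ∑ i : J,
        u i.1 p.1 * (if σ i.1 p.2 = g then 1 else 0) *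
          (H t i.1 * A (fun i => (σ i).symm) (t, g) q) := by
      intro t g
      simp only [A, Matrix.of_apply]
      rw [Finset.sum_mul]
      exact Finset.sum_congr rfl fun i _ => by ring
    simp_rw [h1]
    rw [Finset.sum_comm]
    rw [Finset.sum_congr rfl fun g _ => Finset.sum_comm, Finset.sum_comm]
    simp_rw [← Finset.mul_sum]
    rw [Finset.sum_congr rfl fun i _ => Finset.sum_congr rfl fun g _ => by
      rw [hrow (fun i => (σ i).symm) i g q]]
    have h2 : ∀ i : J, ∑ g, u i.1 p.1 * (if σ i.1 p.2 = g then 1 else 0) *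
        (if (σ i.1).symm g = q.2 then H q.1 i.1 else 0) =
          (u i.1 p.1 * H q.1 i.1) * if p.2 = q.2 then 1 else 0 := by
      intro i
      rw [Finset.sum_eq_single (σ i.1 p.2)]
      · simp
      · intro g _ hg
        rw [if_neg (Ne.symm hg)]; simp
      · intro h; exact absurd (Finset.mem_univ _) h
    rw [Finset.sum_congr rfl fun i _ => h2 i, ← Finset.sum_mul]
    have h3 := congrFun (congrFun huH p.1) q.1
    simp only [Matrix.mul_apply, Matrix.of_apply, Matrix.one_apply] at h3
    rw [h3, Matrix.one_apply]
    simp only [Prod.ext_iff]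
    by_cases h4 : p.1 = q.1 <;> by_cases h5 : p.2 = q.2 <;> simp [h4, h5]
  refine ⟨A π, IsUnit.of_mul_eq_one _ (hmul π), ?_⟩
  intro X _ _ z i hi g
  simp only [codewords, mix, Finset.smul_sum, smul_smul]
  rw [Finset.sum_comm]
  simp_rw [← Finset.sum_smul]
  symm
  rw [Finset.sum_congr rfl fun q _ => by rw [hrow π ⟨i, hi⟩ g q], Fintype.sum_prod_type]
  refine Finset.sum_congr rfl fun t _ => ?_
  simp [ite_smul]

theorem ColumnsSeparated.map_codewords_uniform {F : Type*} [Field F] {N T n : ℕ}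
    {H : Matrix (Fin T) (Fin N) F} (hH : ColumnsSeparated H) (J : Finset (Fin N))
    (hJ : J.card ≤ T) (π : Fin N → Equiv.Perm (Fin n)) {X : Type*} [AddCommGroup X] [Module F X]
    [Fintype X] :
    (PMF.uniformOfFintype (Fin T → Fin n → X)).map
      (fun z (i : J) g => codewords H z i.1 (π i.1 g)) =
        PMF.uniformOfFintype (J → Fin n → X) := by
  let f : (Fin T → Fin n → X) →+ (J → Fin n → X) :=
    { toFun := fun z i g => codewords H z i.1 (π i.1 g)
      map_zero' := by funext i g; simp [codewords]
      map_add' := by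
        intro x y; funext i g
        simp [codewords, Finset.sum_add_distrib] }
  refine pmf_map_uniformOfFintype_of_surjective f fun x => ?_
  choose u hu using hH J hJ
  refine ⟨fun t g => ∑ j : J, u j.1 t • x j ((π j.1).symm g), ?_⟩
  funext i g
  simp only [f, AddMonoidHom.coe_mk, ZeroHom.coe_mk, codewords, Finset.smul_sum, smul_smul]
  rw [Finset.sum_comm]
  simp_rw [← Finset.sum_smul]
  have : ∀ j : J, ∑ t, H t i.1 * u j.1 t = if i = j then 1 else 0 := by
    intro j
    rw [Finset.sum_congr rfl fun t _ => mul_comm _ _, hu j.1 i.1 i.2]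
    simp only [Subtype.coe_inj]
  simp_rw [this, ite_smul, one_smul, zero_smul]
  simp

/-- The coordinates over the extension field of the queries to one message: those of the leading
part, followed by those of the noise part. -/
abbrev Coord (N K T n : ℕ) : Type := (Fin n × Fin (max T K)) ⊕ (Fin n × Fin (N - max T K))

/-- Given admissible leading parts, the noise can be chosen at random so that the queries are always
independent, while it is uniform at any `T` servers. -/
theorem exists_noise_law {F E Λ M : Type*} [Field F] [Field E] [Fintype E] [Algebra F E]
    [Fintype Λ] [Fintype M] [DecidableEq M] {N n K T : ℕ} {G : Matrix (Fin K) (Fin N) F}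
    {H : Matrix (Fin T) (Fin N) F} (hC : Fintype.card (Λ ⊕ M) = n * N) (hTN : T ≤ N)
    (hQ : N * n * K < Fintype.card E - 1) {B : ℕ} (hB : sparsity N T ≤ B)
    (hQB : B * (N * n * K + 1) ≤ Fintype.card E - 1)
    {z : Fin T → Fin n → Fin K → Λ → E} (hz : AdmissibleLead M G H z) :
    ∃ q : PMF (Fin N → Fin n → Fin K → M → E),
      (∀ m ∈ q.support, TensorIndep G (joinParts (codewords H z) m)) ∧
      ∀ J : Finset (Fin N), J.card = T →
        q.map (fun m (i : J) => m i.1) =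
          (PMF.uniformOfFintype (Fin N → Fin n → Fin K → M → E)).map fun m (i : J) => m i.1 := by
  classical
  have arith : ∀ c V d q : ℕ, c * q ≤ d * V → B * (d + 1) ≤ q → c * B ≤ V := by
    intro c V d q h1 h2
    refine Nat.le_of_mul_le_mul_right (c := d + 1) ?_ (Nat.succ_pos _)
    calc c * B * (d + 1) = c * (B * (d + 1)) := by ring
      _ ≤ c * q := Nat.mul_le_mul_left _ h2
      _ ≤ d * V := h1
      _ ≤ V * (d + 1) := by rw [mul_comm]; exact Nat.mul_le_mul_left _ (Nat.le_succ _)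
  refine exists_pmf_uniform_marginals hTN
    (fun m : Fin N → Fin n → Fin K → M → E => TensorIndep G (joinParts (codewords H z) m)) hB ?_
  intro S hS b
  have h := arith _ _ _ _ (card_not_tensorIndep_mul_le hC hTN hQ hz S hS b) hQB
  have h' := (Nat.cast_le (α := ℝ)).2 h
  rw [Nat.cast_mul] at h'
  convert h'

/-- Over a large field there are two laws of families of queries to one message: `pD` for a desired
message, which is supported on independent families, and `pU` for the information symbols of the
codewords that are sent for an undesired message. No `T` servers can distinguish them, even if the
codewords are labelled differently on every server.

In both laws the leading parts are codewords of a uniform admissible family. The noise parts are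
codewords of a uniform family in `pU`; in `pD` they have the same marginals on `T` servers, but
avoid the dependent families. -/
theorem exists_query_laws_of_card_lt {F E : Type*} [Field F] [Fintype F] [Field E] [Fintype E]
    [Algebra F E] {N K T : ℕ} {G : Matrix (Fin K) (Fin N) F} {H : Matrix (Fin T) (Fin N) F}
    (hG : ColumnsSeparated G) (hH : ColumnsSeparated H) (hT : 1 ≤ T) (hN : K + T ≤ N) (n : ℕ)
    {ξ : Fin T → E} (hξ : LinearIndependent F ξ) {B : ℕ} (hB : sparsity N T ≤ B)
    (hQ : Nat.card (Matrix (Fin T × Fin n) (Fin T × Fin n) F × Finset (Fin N)) * (N * n * K) +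
      B * (N * n * K + 1) + N * n * K + 1 < Fintype.card E) :
    ∃ (pD : PMF (Fin N → Fin n → Fin K → Coord N K T n → E))
      (pU : PMF (Fin T → Fin n → Fin K → Coord N K T n → E)),
      (∀ w ∈ pD.support, TensorIndep G w) ∧
      ∀ J : Finset (Fin N), J.card = T → ∀ π : Fin N → Equiv.Perm (Fin n),
        pD.map (fun w (i : J) => w i.1) =
          pU.map (fun z (i : J) g => codewords H z i.1 (π i.1 g)) := by
  classical
  rw [Nat.card_eq_fintype_card] at hQ
  have hmaxN : max T K ≤ N := by omega
  have hC : Fintype.card (Coord N K T n) = n * N := by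
    simp only [Fintype.card_sum, Fintype.card_prod, Fintype.card_fin]
    rw [← Nat.mul_add, Nat.add_sub_cancel' hmaxN]
  obtain ⟨z₀, hz₀⟩ := exists_admissibleLead (G := G) (H := H) (E := E)
    (Λ := Fin n × Fin (max T K)) (M := Fin n × Fin (N - max T K)) hC
    (by omega) (exists_codewords_tensorIndep hG hH hT hN n hξ)
  let lead : Finset (Fin T → Fin n → Fin K → Fin n × Fin (max T K) → E) :=
    Finset.univ.filter fun z => AdmissibleLead (Fin n × Fin (N - max T K)) G H z
  have hlead : lead.Nonempty := ⟨z₀, by simpa [lead] using hz₀⟩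
  have hnoise : ∀ z : Fin T → Fin n → Fin K → Fin n × Fin (max T K) → E,
      ∃ q : PMF (Fin N → Fin n → Fin K → Fin n × Fin (N - max T K) → E), z ∈ lead →
        (∀ m ∈ q.support, TensorIndep G (joinParts (codewords H z) m)) ∧
        ∀ J : Finset (Fin N), J.card = T →
          q.map (fun m (i : J) => m i.1) =
            (PMF.uniformOfFintype (Fin N → Fin n → Fin K → Fin n × Fin (N - max T K) → E)).map
              fun m (i : J) => m i.1 := by
    intro z
    by_cases hz : z ∈ lead
    swap
    · exact ⟨PMF.uniformOfFintype _, fun h => absurd h hz⟩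
    have hadm : AdmissibleLead (Fin n × Fin (N - max T K)) G H z := (Finset.mem_filter.1 hz).2
    obtain ⟨q, hq⟩ := exists_noise_law hC (by omega) (by omega) hB (by omega) hadm
    exact ⟨q, fun _ => hq⟩
  choose q hq using hnoise
  let leadLaw := PMF.uniformOfFinset lead hlead
  refine ⟨leadLaw.bind fun z => (q z).map (joinParts (codewords H z)),
    leadLaw.bind fun z => (PMF.uniformOfFintype
      (Fin T → Fin n → Fin K → Fin n × Fin (N - max T K) → E)).map (joinParts z), ?_, ?_⟩
  · intro w hw
    rw [PMF.mem_support_bind_iff] at hw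
    obtain ⟨z, hz, hw⟩ := hw
    rw [PMF.mem_support_map_iff] at hw
    obtain ⟨m, hm, rfl⟩ := hw
    exact (hq z ((PMF.mem_support_uniformOfFinset_iff hlead z).1 hz)).1 m hm
  · intro J hJ π
    -- The law of the queries to `J`, given the leading part `x`: the noise part is uniform.
    let Ψ : (J → Fin n → Fin K → Fin n × Fin (max T K) → E) →
        PMF (J → Fin n → Fin K → Coord N K T n → E) := fun x =>
      (PMF.uniformOfFintype (J → Fin n → Fin K → Fin n × Fin (N - max T K) → E)).map
        fun m i g a => Sum.elim (x i g a) (m i g a)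
    have hD : (leadLaw.bind fun z => (q z).map (joinParts (codewords H z))).map
        (fun w (i : J) => w i.1) =
          (leadLaw.map fun z (i : J) => codewords H z i.1).bind Ψ := by
      rw [PMF.map_bind, PMF.bind_map]
      ext v
      rw [PMF.bind_apply, PMF.bind_apply]
      refine tsum_congr fun z => ?_
      by_cases hz : z ∈ lead
      · congr 2
        have h := (hq z hz).2 J hJ
        rw [pmf_map_uniformOfFintype_restrict] at h
        simp only [Function.comp_apply, Ψ]
        rw [← h, PMF.map_comp, PMF.map_comp]
        rfl
      · rw [PMF.uniformOfFinset_apply_of_notMem hlead hz, zero_mul, zero_mul]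
    have hU : (leadLaw.bind fun z => (PMF.uniformOfFintype
        (Fin T → Fin n → Fin K → Fin n × Fin (N - max T K) → E)).map (joinParts z)).map
        (fun z (i : J) g => codewords H z i.1 (π i.1 g)) =
          (leadLaw.map fun z (i : J) g => codewords H z i.1 (π i.1 g)).bind Ψ := by
      rw [PMF.map_bind, PMF.bind_map]
      congr 1
      funext z
      simp only [Function.comp_apply, Ψ]
      rw [← hH.map_codewords_uniform J hJ.le π, PMF.map_comp, PMF.map_comp]
      congr 1
      funext u i g a c
      simp only [Function.comp_apply, codewords, Finset.sum_apply, Pi.smul_apply]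
      rcases c with c | c <;> simp [joinParts]
    rw [hD, hU]
    obtain ⟨A, hA, hAπ⟩ := hH.exists_mix J hJ π
    have hinv : leadLaw.map (mix A) = leadLaw := by
      refine pmf_map_uniformOfFinset_of_perm lead hlead _ ?_ ?_
      · obtain ⟨A', hA'⟩ := hA.exists_left_inv
        intro x y hxy
        have := congrArg (mix A') hxy
        rwa [← mix_mul, ← mix_mul, hA', mix_one, mix_one] at this
      · intro z hz
        exact Finset.mem_filter.2 ⟨Finset.mem_univ _, (Finset.mem_filter.1 hz).2.mix hA⟩
    congr 1
    conv_lhs => rw [← hinv]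
    rw [PMF.map_comp]
    congr 1
    funext z i g
    exact (hAπ z i.1 i.2 g).symm

/-- The two laws over an extension of `F` of sufficiently large degree. -/
theorem exists_query_laws {F : Type*} [Field F] [Fintype F] {N K T : ℕ}
    {G : Matrix (Fin K) (Fin N) F} {H : Matrix (Fin T) (Fin N) F} (hG : ColumnsSeparated G)
    (hH : ColumnsSeparated H) (hT : 1 ≤ T) (hN : K + T ≤ N) (n : ℕ) :
    ∃ (e : ℕ) (E : Type) (_ : Field E) (_ : Fintype E) (_ : Algebra F E)
      (_ : Module.Basis (Fin e) F E) (pD : PMF (Fin N → Fin n → Fin K → Coord N K T n → E))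
      (pU : PMF (Fin T → Fin n → Fin K → Coord N K T n → E)), 1 ≤ e ∧
      (∀ w ∈ pD.support, TensorIndep G w) ∧
      ∀ J : Finset (Fin N), J.card = T → ∀ π : Fin N → Equiv.Perm (Fin n),
        pD.map (fun w (i : J) => w i.1) =
          pU.map (fun z (i : J) g => codewords H z i.1 (π i.1 g)) := by
  obtain ⟨B, hB⟩ := exists_nat_ge (sparsity N T)
  obtain ⟨e, he⟩ : ∃ e : ℕ, Nat.card (Matrix (Fin T × Fin n) (Fin T × Fin n) F ×
      Finset (Fin N)) * (N * n * K) + B * (N * n * K + 1) + N * n * K + 1 + T = e := ⟨_, rfl⟩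
  obtain ⟨p, hp⟩ := CharP.exists F
  have : Fact p.Prime := ⟨CharP.char_is_prime F p⟩
  have : NeZero e := ⟨by omega⟩
  obtain ⟨E, fE, aE, hE, hfin, hcard⟩ : ∃ (E : Type) (_ : Field E) (_ : Algebra F E) (_ : Finite E),
      Module.finrank F E = e ∧ Nat.card E = Nat.card F ^ e :=
    ⟨FiniteField.Extension F p e, inferInstance, inferInstance, inferInstance,
      FiniteField.finrank_extension F p e, FiniteField.natCard_extension F p e⟩
  let _ : Fintype E := Fintype.ofFinite E
  let bas : Module.Basis (Fin e) F E := Module.finBasisOfFinrankEq F E hfin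
  have hQ : e < Fintype.card E := by
    rw [Fintype.card_eq_nat_card, hcard]
    exact Nat.lt_pow_self Finite.one_lt_card
  have hξ : LinearIndependent F fun t : Fin T => bas (Fin.castLE (by omega) t) :=
    bas.linearIndependent.comp _ (Fin.castLE_injective _)
  obtain ⟨pD, pU, h⟩ := exists_query_laws_of_card_lt hG hH hT hN n hξ hB (by omega)
  exact ⟨e, E, fE, inferInstance, aE, bas, pD, pU, by omega, h⟩

/-! ### Symbolic matrices and their groups -/

/-- The entry of `S` in row `a` and column `j`; it is `0` if there is no such row. -/
def entry {N : ℕ} (S : List (Fin N → ℕ)) (a : ℕ) (j : Fin N) : ℕ := S.getD a (fun _ => 0) j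

theorem lt_length_of_entry_ne_zero {N : ℕ} {S : List (Fin N → ℕ)} {a : ℕ} {j : Fin N}
    (h : entry S a j ≠ 0) : a < S.length := by
  by_contra hlt
  apply h
  rw [entry, List.getD_eq_default _ _ (not_lt.1 hlt)]

theorem entry_eq_get {N : ℕ} (S : List (Fin N → ℕ)) (a : Fin S.length) (j : Fin N) :
    entry S a j = S.get a j := by
  rw [entry, List.getD_eq_getElem _ _ a.2, List.get_eq_getElem]

theorem getD_flatMap_range_append {α : Type*} (f : ℕ → List α) (l : List α) (d : α) {L r t a : ℕ}
    (hf : ∀ t, (f t).length = L) (ht : t < r) (ha : a < L) :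
    ((List.range r).flatMap f ++ l).getD (t * L + a) d = (f t).getD a d := by
  induction r generalizing l with
  | zero => omega
  | succ r ih =>
    rw [List.range_succ, List.flatMap_append, List.append_assoc]
    rcases Nat.lt_succ_iff_lt_or_eq.1 ht with h | rfl
    · exact ih _ h
    · have hlen : ((List.range t).flatMap f).length = t * L := by
        rw [List.length_flatMap]; simp [hf]
      rw [List.getD_append_right _ _ _ _ (by rw [hlen]; omega), hlen, Nat.add_sub_cancel_left,
        List.flatMap_singleton, List.getD_append _ _ _ _ (by rw [hf]; exact ha)]

theorem length_flatMap_range {α : Type*} (f : ℕ → List α) {L : ℕ} (r : ℕ)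
    (hf : ∀ t, (f t).length = L) : ((List.range r).flatMap f).length = r * L := by
  rw [List.length_flatMap]; simp [hf]

theorem finRotate_pow_val {N : ℕ} (t : ℕ) (j : Fin N) :
    (((finRotate N ^ t) j : Fin N) : ℕ) = ((j : ℕ) + t) % N := by
  cases N with
  | zero => exact j.elim0
  | succ n =>
    induction t with
    | zero => simp [Nat.mod_eq_of_lt j.2]
    | succ t ih =>
      rw [pow_succ', Equiv.Perm.mul_apply, finRotate_apply, Fin.val_add, ih, Fin.val_one',
        ← Nat.add_mod, add_assoc]

theorem add_mod_eq_iff {N c s j : ℕ} (hc : c < N) (hs : s < N) (hj : j < N) :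
    (c + s) % N = j ↔ (j + N - c) % N = s := by
  have h1 : (c + s) % N = if c + s < N then c + s else c + s - N := by
    split_ifs with h
    · exact Nat.mod_eq_of_lt h
    · rw [Nat.mod_eq_sub_mod (by omega), Nat.mod_eq_of_lt (by omega)]
  have h2 : (j + N - c) % N = if j < c then j + N - c else j - c := by
    split_ifs with h
    · exact Nat.mod_eq_of_lt (by omega)
    · rw [Nat.mod_eq_sub_mod (by omega), Nat.mod_eq_of_lt (by omega)]; omega
  rw [h1, h2]
  split_ifs <;> omega

theorem stepsLeft_lt {N : ℕ} (j c : Fin N) : stepsLeft j c < N :=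
  Nat.mod_lt _ (Nat.zero_lt_of_lt j.2)

theorem finRotate_pow_eq_iff {N : ℕ} {s : ℕ} (hs : s < N) (j c : Fin N) :
    (finRotate N ^ s) c = j ↔ stepsLeft j c = s := by
  rw [Fin.ext_iff, finRotate_pow_val, add_mod_eq_iff c.2 hs j.2, stepsLeft]

theorem finRotate_pow_stepsLeft {N : ℕ} (j c : Fin N) : (finRotate N ^ stepsLeft j c) c = j :=
  (finRotate_pow_eq_iff (stepsLeft_lt j c) j c).2 rfl

theorem card_stepsLeft_lt {N r : ℕ} (hr : r ≤ N) (j : Fin N) :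
    (Finset.univ.filter fun c => stepsLeft j c < r).card = r := by
  conv_rhs => rw [← Finset.card_range r]
  refine Finset.card_bij (fun c _ => stepsLeft j c) ?_ ?_ ?_
  · intro c hc
    exact Finset.mem_range.2 (Finset.mem_filter.1 hc).2
  · intro c _ c' _ h
    have h1 := finRotate_pow_stepsLeft j c
    have h2 := finRotate_pow_stepsLeft j c'
    rw [← h] at h2
    exact (finRotate N ^ stepsLeft j c).injective (h1.trans h2.symm)
  · intro s hs
    have hs' := Finset.mem_range.1 hs
    have h : stepsLeft j ((finRotate N ^ s).symm j) = s := by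
      rw [← finRotate_pow_eq_iff (by omega), Equiv.apply_symm_apply]
    exact ⟨_, by simpa [h] using hs', h⟩

theorem mem_positions {N k : ℕ} {S : List (Fin N → ℕ)} {b : ℕ × Fin N} :
    b ∈ positions k S ↔ b.1 < S.length ∧ entry S b.1 b.2 = k := by
  obtain ⟨a, j⟩ := b
  simp only [positions, List.mem_flatMap, List.mem_map, List.mem_filter, List.mem_finRange,
    true_and, Prod.mk.injEq, decide_eq_true_eq, Prod.exists, List.mem_zipIdx_iff_getElem?]
  constructor
  · rintro ⟨row, i, hrow, j', hk, rfl, rfl⟩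
    obtain ⟨hi, rfl⟩ := List.getElem?_eq_some_iff.1 hrow
    refine ⟨hi, ?_⟩
    rw [entry, List.getD_eq_getElem _ _ hi]
    exact hk
  · rintro ⟨ha, hk⟩
    refine ⟨S[a], a, List.getElem?_eq_getElem ha, j, ?_, rfl, rfl⟩
    rw [entry, List.getD_eq_getElem _ _ ha] at hk
    exact hk

theorem nodup_positions {N k : ℕ} (S : List (Fin N → ℕ)) : (positions k S).Nodup := by
  rw [positions, List.nodup_flatMap]
  refine ⟨fun p _ => ?_, ?_⟩
  · exact ((List.nodup_finRange N).filter _).map fun _ _ h => (Prod.ext_iff.1 h).2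
  · refine (List.pairwise_map (f := Prod.snd)).1 ?_ |>.imp (R := fun p q => p.2 ≠ q.2) ?_
    · rw [List.zipIdx_map_snd]
      exact List.nodup_range'
    · intro p q hpq
      simp only [Function.onFun, List.disjoint_left, List.mem_map, not_exists, not_and]
      rintro _ ⟨j, _, rfl⟩ j' _ h
      exact hpq (Prod.ext_iff.1 h).1.symm

theorem length_lift {N r M : ℕ} (S : List (Fin N → ℕ)) :
    (lift r M S).length = r * S.length + (positions M S).length := by
  rw [lift, List.length_append, List.length_map, length_flatMap_range (L := S.length)]
  intro t; simp [shift]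

theorem entry_lift_shift {N r M t a : ℕ} {S : List (Fin N → ℕ)} (ht : t < r) (ha : a < S.length)
    (j : Fin N) : entry (lift r M S) (t * S.length + a) j = entry S a ((finRotate N ^ t) j) := by
  unfold entry lift
  rw [getD_flatMap_range_append (fun t => shift t S) _ _ (by intro t; simp [shift]) ht ha]
  rw [List.getD_eq_getElem _ _ (by simpa [shift] using ha), List.getD_eq_getElem _ _ ha]
  exact congrFun (List.getElem_map _) j

theorem entry_lift_new {N r M b : ℕ} {S : List (Fin N → ℕ)} (hb : b < (positions M S).length)
    (c : Fin N) : entry (lift r M S) (r * S.length + b) c =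
      if stepsLeft ((positions M S)[b]).2 c < r then 0 else M + 1 := by
  unfold entry lift
  have hlen : ((List.range r).flatMap fun t => shift t S).length = r * S.length :=
    length_flatMap_range _ r (by intro t; simp [shift])
  rw [List.getD_append_right _ _ _ _ (by rw [hlen]; omega), hlen, Nat.add_sub_cancel_left,
    List.getD_eq_getElem _ _ (by simpa using hb)]
  simp

theorem row_lift_cases {N r M A : ℕ} {S : List (Fin N → ℕ)} (hA : A < (lift r M S).length) :
    (∃ t < r, ∃ a < S.length, A = t * S.length + a) ∨
      ∃ b < (positions M S).length, A = r * S.length + b := by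
  rw [length_lift] at hA
  by_cases h : A < r * S.length
  · left
    have hpos : 0 < S.length := by
      by_contra h0
      rw [Nat.eq_zero_of_not_pos h0, mul_zero] at h
      omega
    refine ⟨A / S.length, (Nat.div_lt_iff_lt_mul hpos).2 h, A % S.length, Nat.mod_lt _ hpos, ?_⟩
    rw [mul_comm, Nat.div_add_mod]
  · exact Or.inr ⟨A - r * S.length, by omega, by omega⟩

/-- What the groups of `S_M` satisfy: the positions of a group of level `k` carry `r` entries `k`
and `N - r` entries `k + 1`; every entry `k < M` lies in a unique group of level `k`, and every
entry `k + 1 ≥ 2` in a unique group of level `k`. -/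
structure IsGrouping {N : ℕ} (r M : ℕ) (S : List (Fin N → ℕ)) (gr : List (ℕ × (Fin N → ℕ))) :
    Prop where
  level : ∀ p ∈ gr, 1 ≤ p.1 ∧ p.1 < M
  entry_eq : ∀ p ∈ gr, ∀ j, entry S (p.2 j) j = p.1 ∨ entry S (p.2 j) j = p.1 + 1
  card_lower : ∀ p ∈ gr, (Finset.univ.filter fun j => entry S (p.2 j) j = p.1).card = r
  exists_lower : ∀ a j k, 1 ≤ k → k < M → entry S a j = k → ∃ p ∈ gr, p.1 = k ∧ p.2 j = a
  exists_upper : ∀ a j k, 1 ≤ k → entry S a j = k + 1 → ∃ p ∈ gr, p.1 = k ∧ p.2 j = a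
  unique : ∀ p ∈ gr, ∀ p' ∈ gr, ∀ j, p.1 = p'.1 → p.2 j = p'.2 j → p = p'
  entry_le : ∀ a j, entry S a j ≤ M

/-- The groups of the lifting of a matrix `S` with groups `gr`. -/
def liftGroups {N : ℕ} (r M : ℕ) (S : List (Fin N → ℕ)) (gr : List (ℕ × (Fin N → ℕ))) :
    List (ℕ × (Fin N → ℕ)) :=
  (List.range r).flatMap (fun t => gr.map fun p =>
      (p.1, fun j => t * S.length + p.2 ((finRotate N ^ t) j))) ++
    (positions M S).zipIdx.map fun b =>
      (M, fun c => if stepsLeft b.1.2 c < r then stepsLeft b.1.2 c * S.length + b.1.1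
        else r * S.length + b.2)

theorem mem_liftGroups {N r M : ℕ} {S : List (Fin N → ℕ)} {gr : List (ℕ × (Fin N → ℕ))}
    {p : ℕ × (Fin N → ℕ)} : p ∈ liftGroups r M S gr ↔
      (∃ t < r, ∃ p₀ ∈ gr, p = (p₀.1, fun j => t * S.length + p₀.2 ((finRotate N ^ t) j))) ∨
      ∃ b, ∃ hb : b < (positions M S).length, p = (M, fun c =>
        if stepsLeft ((positions M S)[b]).2 c < r then
          stepsLeft ((positions M S)[b]).2 c * S.length + ((positions M S)[b]).1
        else r * S.length + b) := by
  rw [liftGroups, List.mem_append, List.mem_flatMap, List.mem_map]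
  refine or_congr ?_ ?_
  · simp only [List.mem_range, List.mem_map]
    refine exists_congr fun t => and_congr_right fun _ => ?_
    exact exists_congr fun p₀ => and_congr_right fun _ => eq_comm
  · constructor
    · rintro ⟨⟨x, b⟩, hx, rfl⟩
      obtain ⟨hb, hxe⟩ := List.getElem?_eq_some_iff.1 (List.mem_zipIdx_iff_getElem?.1 hx)
      simp only at hb hxe
      subst hxe
      exact ⟨b, hb, rfl⟩
    · rintro ⟨b, hb, rfl⟩
      exact ⟨((positions M S)[b], b), List.mem_zipIdx_iff_getElem?.2 (List.getElem?_eq_getElem hb),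
        rfl⟩

theorem mul_add_inj {L t t' a a' : ℕ} (ha : a < L) (ha' : a' < L)
    (h : t * L + a = t' * L + a') : t = t' ∧ a = a' := by
  have hL : 0 < L := by omega
  have h1 : t = t' := by
    have := congrArg (· / L) h
    simpa [Nat.mul_comm _ L, Nat.mul_add_div hL, Nat.div_eq_of_lt ha, Nat.div_eq_of_lt ha'] using this
  subst h1
  exact ⟨rfl, by omega⟩

theorem mul_add_lt_mul {L t r a : ℕ} (ha : a < L) (ht : t < r) : t * L + a < r * L := by
  calc t * L + a < t * L + L := by omega
    _ = (t + 1) * L := by ring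
    _ ≤ r * L := Nat.mul_le_mul_right _ ht

theorem IsGrouping.row_lt {N r M : ℕ} {S : List (Fin N → ℕ)} {gr : List (ℕ × (Fin N → ℕ))}
    (h : IsGrouping r M S gr) {p : ℕ × (Fin N → ℕ)} (hp : p ∈ gr) (j : Fin N) :
    p.2 j < S.length := by
  refine lt_length_of_entry_ne_zero (j := j) ?_
  have := (h.level p hp).1
  rcases h.entry_eq p hp j with h | h <;> omega

theorem IsGrouping.lift {N r M : ℕ} {S : List (Fin N → ℕ)} {gr : List (ℕ × (Fin N → ℕ))}
    (h : IsGrouping r M S gr) (hr : r < N) (hM : 1 ≤ M) :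
    IsGrouping r (M + 1) (lift r M S) (liftGroups r M S gr) := by
  have hpos : ∀ b (hb : b < (positions M S).length),
      ((positions M S)[b]).1 < S.length ∧ entry S ((positions M S)[b]).1 ((positions M S)[b]).2 = M :=
    fun b hb => mem_positions.1 (List.getElem_mem hb)
  -- The entries in the new group of the position number `b`.
  have hnewlow : ∀ b (hb : b < (positions M S).length) c,
      stepsLeft ((positions M S)[b]).2 c < r →
      entry (OneShotPIR.lift r M S) (stepsLeft ((positions M S)[b]).2 c * S.length +
        ((positions M S)[b]).1) c = M := by
    intro b hb c hc
    rw [entry_lift_shift hc (hpos b hb).1, finRotate_pow_stepsLeft, (hpos b hb).2]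
  have hnewup : ∀ b (hb : b < (positions M S).length) c,
      ¬ stepsLeft ((positions M S)[b]).2 c < r →
      entry (OneShotPIR.lift r M S) (r * S.length + b) c = M + 1 := by
    intro b hb c hc
    rw [entry_lift_new hb, if_neg hc]
  refine ⟨?_, ?_, ?_, ?_, ?_, ?_, ?_⟩
  · intro p hp
    rcases mem_liftGroups.1 hp with ⟨t, ht, p₀, hp₀, rfl⟩ | ⟨b, hb, rfl⟩
    · have := h.level p₀ hp₀
      exact ⟨this.1, by simp only; omega⟩
    · exact ⟨hM, Nat.lt_succ_self M⟩
  · intro p hp j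
    rcases mem_liftGroups.1 hp with ⟨t, ht, p₀, hp₀, rfl⟩ | ⟨b, hb, rfl⟩
    · simp only
      rw [entry_lift_shift ht (h.row_lt hp₀ _)]
      exact h.entry_eq p₀ hp₀ _
    · simp only
      split_ifs with hc
      · exact Or.inl (hnewlow b hb j hc)
      · exact Or.inr (hnewup b hb j hc)
  · intro p hp
    rcases mem_liftGroups.1 hp with ⟨t, ht, p₀, hp₀, rfl⟩ | ⟨b, hb, rfl⟩
    · refine Eq.trans ?_ (h.card_lower p₀ hp₀)
      refine Finset.card_bij (fun j _ => (finRotate N ^ t) j) ?_ ?_ ?_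
      · intro j hj
        have := (Finset.mem_filter.1 hj).2
        simp only at this
        rw [entry_lift_shift ht (h.row_lt hp₀ _)] at this
        simpa using this
      · intro j _ j' _ e
        exact (finRotate N ^ t).injective e
      · intro j hj
        refine ⟨(finRotate N ^ t).symm j, ?_, by simp⟩
        rw [Finset.mem_filter]
        refine ⟨Finset.mem_univ _, ?_⟩
        simp only
        rw [entry_lift_shift ht (h.row_lt hp₀ _), Equiv.apply_symm_apply]
        exact (Finset.mem_filter.1 hj).2
    · conv_rhs => rw [← card_stepsLeft_lt hr.le ((positions M S)[b]).2]
      congr 1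
      ext c
      simp only [Finset.mem_filter, Finset.mem_univ, true_and]
      by_cases hc : stepsLeft ((positions M S)[b]).2 c < r
      · simp only [hc, if_true, iff_true]
        exact hnewlow b hb c hc
      · simp only [hc, if_false, iff_false]
        rw [hnewup b hb c hc]; omega
  · intro A j k hk1 hk hA
    have hlt : A < (OneShotPIR.lift r M S).length :=
      lt_length_of_entry_ne_zero (j := j) (by omega)
    rcases row_lift_cases hlt with ⟨t, ht, a, ha, rfl⟩ | ⟨b, hb, rfl⟩
    · rw [entry_lift_shift ht ha] at hA
      by_cases hkM : k = M
      · subst hkM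
        obtain ⟨b, hb, hbe⟩ := List.mem_iff_getElem.1
          ((mem_positions (b := (a, (finRotate N ^ t) j))).2 ⟨ha, hA⟩)
        refine ⟨_, mem_liftGroups.2 (Or.inr ⟨b, hb, rfl⟩), rfl, ?_⟩
        have hs : stepsLeft ((finRotate N ^ t) j) j = t :=
          (finRotate_pow_eq_iff (ht.trans hr) _ _).1 rfl
        simp only [hbe, hs, if_pos ht]
      · obtain ⟨p₀, hp₀, rfl, hpj⟩ := h.exists_lower a _ k hk1 (by omega) hA
        exact ⟨_, mem_liftGroups.2 (Or.inl ⟨t, ht, p₀, hp₀, rfl⟩), rfl, by simp only [hpj]⟩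
    · rw [entry_lift_new hb] at hA
      split_ifs at hA <;> omega
  · intro A j k hk1 hA
    have hlt : A < (OneShotPIR.lift r M S).length :=
      lt_length_of_entry_ne_zero (j := j) (by omega)
    rcases row_lift_cases hlt with ⟨t, ht, a, ha, rfl⟩ | ⟨b, hb, rfl⟩
    · rw [entry_lift_shift ht ha] at hA
      obtain ⟨p₀, hp₀, rfl, hpj⟩ := h.exists_upper a _ k hk1 hA
      exact ⟨_, mem_liftGroups.2 (Or.inl ⟨t, ht, p₀, hp₀, rfl⟩), rfl, by simp only [hpj]⟩
    · rw [entry_lift_new hb] at hA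
      by_cases hc : stepsLeft ((positions M S)[b]).2 j < r
      · rw [if_pos hc] at hA; omega
      · rw [if_neg hc] at hA
        refine ⟨_, mem_liftGroups.2 (Or.inr ⟨b, hb, rfl⟩), by simp only; omega, ?_⟩
        simp only [if_neg hc]
  · intro p hp p' hp' j h1 h2
    rcases mem_liftGroups.1 hp with ⟨t, ht, p₀, hp₀, rfl⟩ | ⟨b, hb, rfl⟩ <;>
    rcases mem_liftGroups.1 hp' with ⟨t', ht', p₀', hp₀', rfl⟩ | ⟨b', hb', rfl⟩
    · obtain ⟨rfl, e⟩ := mul_add_inj (h.row_lt hp₀ _) (h.row_lt hp₀' _) h2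
      rw [h.unique p₀ hp₀ p₀' hp₀' _ h1 e]
    · have := (h.level p₀ hp₀).2
      simp only at h1; omega
    · have := (h.level p₀' hp₀').2
      simp only at h1; omega
    · suffices hbb : b = b' by subst hbb; rfl
      simp only at h2
      have l1 := (hpos b hb).1
      have l2 := (hpos b' hb').1
      split_ifs at h2 with c1 c2 c2
      · obtain ⟨e1, e2⟩ := mul_add_inj l1 l2 h2
        have r1 := finRotate_pow_stepsLeft ((positions M S)[b]).2 j
        have r2 := finRotate_pow_stepsLeft ((positions M S)[b']).2 j
        rw [e1, r2] at r1
        exact ((nodup_positions S).getElem_inj_iff).1 (Prod.ext e2 r1.symm)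
      · have := mul_add_lt_mul l1 c1; omega
      · have := mul_add_lt_mul l2 c2; omega
      · omega
  · intro A j
    by_cases hA : entry (OneShotPIR.lift r M S) A j = 0
    · omega
    rcases row_lift_cases (lt_length_of_entry_ne_zero hA) with ⟨t, ht, a, ha, rfl⟩ | ⟨b, hb, rfl⟩
    · rw [entry_lift_shift ht ha]
      exact (h.entry_le _ _).trans (Nat.le_succ M)
    · rw [entry_lift_new hb]
      split_ifs <;> omega

theorem isGrouping_symMatrix {N r : ℕ} (hr : r < N) (M : ℕ) :
    IsGrouping r (M + 2) (symMatrix N r (M + 2)) (groups N r (M + 2)) := by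
  induction M with
  | succ M ih => exact ih.lift hr (by omega)
  | zero =>
    have he : ∀ j : Fin N, entry (symMatrix N r 2) 0 j = if (j : ℕ) < r then 1 else 2 :=
      fun j => rfl
    have hp : ∀ p, p ∈ groups N r 2 ↔ p = (1, fun _ => 0) := fun p => by
      simp [groups]
    have h0 : ∀ a j, entry (symMatrix N r 2) a j ≠ 0 → a = 0 := by
      intro a j h
      have := lt_length_of_entry_ne_zero h
      simpa [symMatrix] using this
    refine ⟨?_, ?_, ?_, ?_, ?_, ?_, ?_⟩
    · intro p h
      rw [(hp p).1 h]; simp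
    · intro p h j
      rw [(hp p).1 h]
      simp only [zero_add, he]
      split_ifs <;> simp
    · intro p h
      rw [(hp p).1 h]
      simp only [zero_add, he]
      have : ∀ j : Fin N, (if (j : ℕ) < r then 1 else 2) = 1 ↔ (j : ℕ) < r := by
        intro j; split_ifs with h <;> simp [h]
      simp only [this]
      rw [Fin.card_filter_val_lt]
      omega
    · intro a j k h1 hk ha
      exact ⟨_, (hp _).2 rfl, by simp only; omega, (h0 a j (by simp only [zero_add] at ha; omega)).symm⟩
    · intro a j k h1 ha
      simp only [zero_add] at ha
      obtain rfl := h0 a j (by omega)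
      refine ⟨_, (hp _).2 rfl, ?_, rfl⟩
      rw [he] at ha
      split_ifs at ha <;> simp only <;> omega
    · intro p h p' h' _ _ _
      rw [(hp p).1 h, (hp p').1 h']
    · intro a j
      by_cases h : entry (symMatrix N r 2) a j = 0
      · simp only [zero_add]; omega
      · obtain rfl := h0 a j h
        simp only [zero_add, he]
        split_ifs <;> omega

/-! ### Weighted numbers of entries -/

/-- The sum of `g` over all entries of `S`. -/
def entrySum {N : ℕ} (S : List (Fin N → ℕ)) (g : ℕ → ℕ) : ℕ := (S.map fun row => ∑ j, g (row j)).sum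

theorem length_positions {N k : ℕ} (S : List (Fin N → ℕ)) :
    (positions k S).length = entrySum S fun v => if v = k then 1 else 0 := by
  have h : ∀ row : Fin N → ℕ, ((List.finRange N).filter fun j => row j = k).length =
      ∑ j, if row j = k then 1 else 0 := by
    intro row
    rw [← Finset.card_filter, ← List.toFinset_card_of_nodup ((List.nodup_finRange N).filter _)]
    congr 1
    ext j; simp
  rw [positions, List.length_flatMap, entrySum]
  simp only [List.length_map, h]
  congr 1
  rw [show (fun p : (Fin N → ℕ) × ℕ => ∑ j, if p.1 j = k then 1 else 0) =
    (fun row : Fin N → ℕ => ∑ j, if row j = k then 1 else 0) ∘ Prod.fst from rfl,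
    ← List.map_map, List.zipIdx_map_fst]

theorem entrySum_lift {N r M : ℕ} (hr : r ≤ N) (S : List (Fin N → ℕ)) (g : ℕ → ℕ) (hg : g 0 = 0) :
    entrySum (lift r M S) g =
      r * entrySum S g + entrySum S (fun v => if v = M then 1 else 0) * ((N - r) * g (M + 1)) := by
  rw [← length_positions]
  unfold entrySum lift
  rw [List.map_append, List.sum_append, List.map_flatMap, List.flatMap, List.sum_flatten,
    List.map_map]
  congr 1
  · have : ∀ t, ((shift t S).map fun row => ∑ j, g (row j)).sum =
        (S.map fun row => ∑ j, g (row j)).sum := by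
      intro t
      rw [shift, List.map_map]
      congr 1
      refine List.map_congr_left fun row _ => ?_
      exact Equiv.sum_comp (finRotate N ^ t) fun j => g (row j)
    simp [Function.comp_def, this]
  · rw [List.map_map]
    have : ∀ b : ℕ × Fin N, ((fun row : Fin N → ℕ => ∑ j, g (row j)) ∘ fun (b : ℕ × Fin N) c =>
        if stepsLeft b.2 c < r then 0 else M + 1) b = (N - r) * g (M + 1) := by
      intro b
      simp only [Function.comp_apply, apply_ite g, hg]
      rw [Finset.sum_ite, Finset.sum_const_zero, zero_add, Finset.sum_const, smul_eq_mul]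
      congr 1
      have := Finset.card_filter_add_card_filter_not (s := (Finset.univ : Finset (Fin N)))
        (fun c => stepsLeft b.2 c < r)
      rw [card_stepsLeft_lt hr, Finset.card_univ, Fintype.card_fin] at this
      omega
    rw [List.map_congr_left fun b _ => this b]
    simp

theorem entrySum_symMatrix {N r : ℕ} (hr : r ≤ N) (M : ℕ) (g : ℕ → ℕ) (hg : g 0 = 0) :
    entrySum (symMatrix N r (M + 2)) g =
      ∑ k ∈ Finset.range (M + 2), (N - r) ^ k * r ^ (M + 1 - k) * g (k + 1) := by
  induction M generalizing g with
  | zero =>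
    have : ∀ j : Fin N, g (if (j : ℕ) < r then 1 else 2) =
        if (j : ℕ) < r then g 1 else g 2 := fun j => by split_ifs <;> rfl
    simp only [entrySum, symMatrix, List.map_cons, List.map_nil, List.sum_cons, List.sum_nil,
      add_zero, this]
    rw [Finset.sum_ite, Finset.sum_const, Finset.sum_const, Fin.card_filter_val_lt]
    have := Finset.card_filter_add_card_filter_not (s := (Finset.univ : Finset (Fin N)))
        (fun c => (c : ℕ) < r)
    rw [Fin.card_filter_val_lt, Finset.card_univ, Fintype.card_fin, min_eq_right hr] at this
    have h2 : (Finset.univ.filter fun c : Fin N => ¬ (c : ℕ) < r).card = N - r := by omega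
    rw [h2, min_eq_right hr]
    simp [Finset.sum_range_succ]
  | succ M ih =>
    have hlift : symMatrix N r (M + 1 + 2) = lift r (M + 2) (symMatrix N r (M + 2)) := rfl
    rw [hlift, entrySum_lift hr _ _ hg, ih g hg, ih _ (by simp)]
    rw [Finset.sum_range_succ _ (M + 2), Finset.mul_sum]
    congr 1
    · refine Finset.sum_congr rfl fun k hk => ?_
      have hk' := Finset.mem_range.1 hk
      have : M + 1 + 1 - k = (M + 1 - k) + 1 := by omega
      rw [this, pow_succ]; ring
    · rw [Finset.sum_eq_single (M + 1)]
      · simp [pow_succ]; ring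
      · intro k _ hk
        rw [if_neg (by omega), mul_zero]
      · intro h; exact absurd (Finset.mem_range.2 (by omega)) h

/-! ### Entropy and product laws -/

theorem PMF_map_congr_support {Ω α : Type*} (p : PMF Ω) {f g : Ω → α}
    (h : ∀ ω ∈ p.support, f ω = g ω) : p.map f = p.map g := by
  rw [← PMF.bind_pure_comp, ← PMF.bind_pure_comp]
  ext a
  rw [PMF.bind_apply, PMF.bind_apply]
  refine tsum_congr fun ω => ?_
  by_cases hω : ω ∈ p.support
  · simp only [Function.comp_apply, h ω hω]
  · rw [(PMF.apply_eq_zero_iff p ω).2 hω, zero_mul, zero_mul]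

theorem condEntropy_eq_zero {Ω α β : Type*} [Fintype α] [Fintype β] (p : PMF Ω) (X : Ω → α)
    (Y : Ω → β) (h : ∀ ω ∈ p.support, ∀ ω' ∈ p.support, Y ω = Y ω' → X ω = X ω') :
    condEntropy p X Y = 0 := by
  classical
  obtain ⟨ω₀, hω₀⟩ := p.support_nonempty
  obtain ⟨f, hf⟩ : ∃ f : β → α, ∀ ω ∈ p.support, X ω = f (Y ω) := by
    refine ⟨fun b => if hb : ∃ ω ∈ p.support, Y ω = b then X hb.choose else X ω₀, ?_⟩
    intro ω hω
    have hb : ∃ ω' ∈ p.support, Y ω' = Y ω := ⟨ω, hω, rfl⟩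
    beta_reduce
    rw [dif_pos hb]
    exact h _ hω _ hb.choose_spec.1 hb.choose_spec.2.symm
  have hmap : p.map (fun ω => (X ω, Y ω)) = (p.map Y).map fun b => (f b, b) := by
    rw [PMF.map_comp]
    exact PMF_map_congr_support p fun ω hω => by simp [hf ω hω]
  rw [condEntropy, sub_eq_zero, entropy, entropy, hmap, Fintype.sum_prod_type_right]
  refine Finset.sum_congr rfl fun b _ => ?_
  rw [Finset.sum_eq_single (f b)]
  · congr 2
    rw [PMF.map_apply, tsum_eq_single b]
    · simp
    · intro b' hb'
      rw [if_neg]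
      intro e
      exact hb' (Prod.ext_iff.1 e).2.symm
  · intro a _ ha
    rw [PMF.map_apply, ENNReal.tsum_eq_zero.2, ENNReal.toReal_zero, Real.negMulLog_zero]
    intro b'
    rw [if_neg]
    intro e
    obtain ⟨e1, rfl⟩ := Prod.ext_iff.1 e
    exact ha e1
  · intro hb
    exact absurd (Finset.mem_univ _) hb

theorem pmf_sum_toReal {α : Type*} [Fintype α] (p : PMF α) : ∑ a, (p a).toReal = 1 := by
  rw [← ENNReal.toReal_sum fun a _ => p.apply_ne_top a, ← tsum_fintype (L := .unconditional α), p.tsum_coe,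
    ENNReal.toReal_one]

theorem mutualInfo_eq_zero {Ω α β : Type*} [Fintype α] [Fintype β] (p : PMF Ω) (X : Ω → α)
    (Y : Ω → β) (h : ∀ a b, (p.map fun ω => (X ω, Y ω)) (a, b) = p.map X a * p.map Y b) :
    mutualInfo p X Y = 0 := by
  rw [mutualInfo, sub_eq_zero]
  simp only [entropy]
  rw [Fintype.sum_prod_type]
  simp only [h, ENNReal.toReal_mul, Real.negMulLog_mul, Finset.sum_add_distrib]
  simp only [← Finset.sum_mul, ← Finset.mul_sum, pmf_sum_toReal, one_mul]

/-- If the law of a function of the queries does not depend on the desired message, then this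
function and the desired index are independent. -/
theorem mutualInfo_indexLaw_eq_zero {F : Type*} [Fintype F] {M ℓ : ℕ} [NeZero M] {ι β : Type*}
    [Fintype β] (Q : Scheme F M ℓ ι) (f : (ι → Query F M ℓ) → β) (R : PMF β)
    (h : ∀ m, (Q m).map f = R) :
    mutualInfo (indexLaw Q) (fun ω => f ω.2) (fun ω => ω.1) = 0 := by
  classical
  have hX : (indexLaw Q).map (fun ω => f ω.2) = R := by
    rw [indexLaw, PMF.map_bind]
    simp only [PMF.map_comp, Function.comp_def, h]
    exact PMF.bind_const _ _
  have hY : (indexLaw Q).map (fun ω => ω.1) = PMF.uniformOfFintype (Fin M) := by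
    rw [indexLaw, PMF.map_bind]
    simp only [PMF.map_comp, Function.comp_def]
    conv_rhs => rw [← PMF.bind_pure (PMF.uniformOfFintype (Fin M))]
    congr 1
    funext m
    exact PMF.map_const _ _
  refine mutualInfo_eq_zero _ _ _ fun b m => ?_
  rw [hX, hY, indexLaw, PMF.map_bind]
  have hm : ∀ m', ((Q m').map fun q => (m', q)).map (fun ω => (f ω.2, ω.1)) =
      R.map fun b => (b, m') := by
    intro m'
    rw [← h m', PMF.map_comp, PMF.map_comp]
    rfl
  simp only [hm]
  rw [PMF.bind_apply, tsum_eq_single m, mul_comm]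
  · congr 1
    rw [PMF.map_apply, tsum_eq_single b]
    · simp
    · intro b' hb'
      rw [if_neg]
      intro e
      exact hb' (Prod.ext_iff.1 e).1.symm
  · intro m' hm'
    rw [PMF.map_apply, ENNReal.tsum_eq_zero.2, mul_zero]
    intro b'
    rw [if_neg]
    intro e
    exact hm' (Prod.ext_iff.1 e).2.symm

/-- The joint law of independent random variables with the given laws. -/
def pmfPi {ι α : Type*} [Fintype ι] [Fintype α] (p : ι → PMF α) : PMF (ι → α) :=
  letI := Classical.decEq ι
  PMF.ofFintype (fun f => ∏ i, p i (f i)) (by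
    rw [← Fintype.piFinset_univ, ← Finset.prod_univ_sum]
    refine Finset.prod_eq_one fun i _ => ?_
    rw [← tsum_fintype (L := .unconditional α), (p i).tsum_coe])

theorem pmfPi_apply {ι α : Type*} [Fintype ι] [Fintype α] (p : ι → PMF α) (f : ι → α) :
    pmfPi p f = ∏ i, p i (f i) := rfl

theorem mem_support_of_mem_support_pmfPi {ι α : Type*} [Fintype ι] [Fintype α] {p : ι → PMF α}
    {f : ι → α} (h : f ∈ (pmfPi p).support) (i : ι) : f i ∈ (p i).support := by
  rw [PMF.mem_support_iff, pmfPi_apply] at h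
  rw [PMF.mem_support_iff]
  intro h0
  exact h (Finset.prod_eq_zero (Finset.mem_univ i) h0)

theorem pmfPi_map {ι α β : Type*} [Fintype ι] [Fintype α] [Fintype β] (p : ι → PMF α)
    (φ : α → β) : (pmfPi p).map (fun f i => φ (f i)) = pmfPi fun i => (p i).map φ := by
  classical
  ext b
  rw [pmfPi_apply, PMF.map_apply, tsum_fintype]
  simp only [PMF.map_apply, tsum_fintype, pmfPi_apply]
  rw [Finset.prod_univ_sum, Fintype.piFinset_univ]
  refine Finset.sum_congr rfl fun f _ => ?_
  split_ifs with h
  · subst h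
    simp
  · obtain ⟨i, hi⟩ := Function.ne_iff.1 h
    exact (Finset.prod_eq_zero (Finset.mem_univ i) (if_neg hi)).symm

/-! ### Numbers of labels -/

theorem card_labels {N M : ℕ} (S : List (Fin N → ℕ)) (P : Finset (Fin M) → Prop)
    [DecidablePred P] :
    Fintype.card {x : Fin S.length × Fin N × Finset (Fin M) //
      P x.2.2 ∧ S.get x.1 x.2.1 = x.2.2.card} =
      entrySum S fun v => (Finset.univ.filter fun s : Finset (Fin M) => P s ∧ s.card = v).card := by
  rw [Fintype.card_subtype, Finset.card_filter, Fintype.sum_prod_type, entrySum]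
  conv_rhs => rw [← List.ofFn_get S, List.map_ofFn, List.sum_ofFn]
  refine Finset.sum_congr rfl fun a _ => ?_
  rw [Fintype.sum_prod_type]
  refine Finset.sum_congr rfl fun j _ => ?_
  rw [Finset.card_filter]
  refine Finset.sum_congr rfl fun s _ => ?_
  simp only [eq_comm]

theorem card_filter_mem_card_eq {M : ℕ} (j : Fin M) (k : ℕ) :
    (Finset.univ.filter fun s : Finset (Fin M) => j ∈ s ∧ s.card = k + 1).card =
      (M - 1).choose k := by
  have h : (Finset.powersetCard k (Finset.univ.erase j)).card = (M - 1).choose k := by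
    rw [Finset.card_powersetCard, Finset.card_erase_of_mem (Finset.mem_univ j), Finset.card_univ,
      Fintype.card_fin]
  rw [← h]
  refine Finset.card_bij' (fun s _ => s.erase j) (fun s _ => insert j s) ?_ ?_ ?_ ?_
  · intro s hs
    obtain ⟨h1, h2⟩ := (Finset.mem_filter.1 hs).2
    rw [Finset.mem_powersetCard, Finset.card_erase_of_mem h1, h2]
    exact ⟨Finset.erase_subset_erase _ (Finset.subset_univ s), rfl⟩
  · intro s hs
    obtain ⟨h1, h2⟩ := Finset.mem_powersetCard.1 hs
    have hj : j ∉ s := fun h => (Finset.mem_erase.1 (h1 h)).1 rfl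
    rw [Finset.mem_filter, Finset.card_insert_of_notMem hj, h2]
    exact ⟨Finset.mem_univ _, Finset.mem_insert_self _ _, rfl⟩
  · intro s hs
    exact Finset.insert_erase (Finset.mem_filter.1 hs).2.1
  · intro s hs
    obtain ⟨h1, h2⟩ := Finset.mem_powersetCard.1 hs
    exact Finset.erase_insert fun h => (Finset.mem_erase.1 (h1 h)).1 rfl

theorem card_filter_nonempty_card_eq {M : ℕ} (k : ℕ) :
    (Finset.univ.filter fun s : Finset (Fin M) => s.Nonempty ∧ s.card = k + 1).card =
      M.choose (k + 1) := by
  have h : (Finset.powersetCard (k + 1) (Finset.univ : Finset (Fin M))).card =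
      M.choose (k + 1) := by
    rw [Finset.card_powersetCard, Finset.card_univ, Fintype.card_fin]
  rw [← h]
  congr 1
  ext s
  rw [Finset.mem_filter, Finset.mem_powersetCard]
  constructor
  · exact fun hs => ⟨Finset.subset_univ s, hs.2.2⟩
  · exact fun hs => ⟨Finset.mem_univ s, Finset.card_pos.1 (by omega), hs.2⟩

/-- Every message is queried `N ^ (M - 1)` times by the queries of one copy of `S_M`. -/
theorem card_labels_mem {N r M : ℕ} (hr : r ≤ N) (j : Fin (M + 2)) :
    Fintype.card {x : Fin (symMatrix N r (M + 2)).length × Fin N × Finset (Fin (M + 2)) //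
      j ∈ x.2.2 ∧ (symMatrix N r (M + 2)).get x.1 x.2.1 = x.2.2.card} = N ^ (M + 1) := by
  rw [card_labels _ fun s => j ∈ s, entrySum_symMatrix hr]
  · simp only [card_filter_mem_card_eq]
    conv_rhs => rw [show N = (N - r) + r by omega, add_pow]
    rfl
  · simp only [Finset.card_eq_zero, Finset.filter_eq_empty_iff, Finset.mem_univ, true_implies]
    rintro s ⟨h1, h2⟩
    rw [h2] at h1
    exact absurd h1 (Finset.notMem_empty j)

theorem card_labels_nonempty {N r M : ℕ} (hr : r ≤ N) :
    (N - r) * Fintype.card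
      {x : Fin (symMatrix N r (M + 2)).length × Fin N × Finset (Fin (M + 2)) //
        x.2.2.Nonempty ∧ (symMatrix N r (M + 2)).get x.1 x.2.1 = x.2.2.card} + r ^ (M + 2) =
      N ^ (M + 2) := by
  rw [card_labels _ fun s => s.Nonempty, entrySum_symMatrix hr]
  · simp only [card_filter_nonempty_card_eq]
    conv_rhs => rw [show N = (N - r) + r by omega, add_pow, Finset.sum_range_succ']
    rw [Finset.mul_sum]
    congr 1
    · refine Finset.sum_congr rfl fun k _ => ?_
      rw [show M + 2 - (k + 1) = M + 1 - k by omega, pow_succ, Nat.cast_id]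
      ring
    · simp
  · simp only [Finset.card_eq_zero, Finset.filter_eq_empty_iff, Finset.mem_univ, true_implies]
    rintro s ⟨h1, h2⟩
    rw [h2] at h1
    exact absurd h1 Finset.not_nonempty_empty

theorem card_liftLabel {N r M ρ : ℕ} :
    Fintype.card (LiftLabel N r M ρ) = ρ * Fintype.card
      {x : Fin (symMatrix N r M).length × Fin N × Finset (Fin M) //
        x.2.2.Nonempty ∧ (symMatrix N r M).get x.1 x.2.1 = x.2.2.card} := by
  conv_rhs => rw [← Fintype.card_fin ρ, ← Fintype.card_prod]
  exact Fintype.card_congr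
    { toFun := fun x => (x.1.1, ⟨x.1.2, x.2⟩)
      invFun := fun x => ⟨(x.1, x.2.1), x.2.2⟩
      left_inv := fun _ => rfl
      right_inv := fun _ => rfl }

theorem card_liftLabel_mem {N r M ρ : ℕ} (m : Fin M) :
    Fintype.card {x : LiftLabel N r M ρ // m ∈ x.msgs} = ρ * Fintype.card
      {x : Fin (symMatrix N r M).length × Fin N × Finset (Fin M) //
        m ∈ x.2.2 ∧ (symMatrix N r M).get x.1 x.2.1 = x.2.2.card} := by
  conv_rhs => rw [← Fintype.card_fin ρ, ← Fintype.card_prod]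
  exact Fintype.card_congr
    { toFun := fun x => (x.1.1.1, ⟨x.1.1.2, x.2, x.1.2.2⟩)
      invFun := fun x => ⟨⟨(x.1, x.2.1), ⟨m, x.2.2.1⟩, x.2.2.2⟩, x.2.2.1⟩
      left_inv := fun _ => rfl
      right_inv := fun _ => rfl }

/-! ### The groups of labels that query one message -/

/-- The labels that query message `j`, in one copy of `S_M`. -/
abbrev LabelsOf (N r M : ℕ) (j : Fin M) : Type :=
  {x : Fin (symMatrix N r M).length × Fin N × Finset (Fin M) //
    j ∈ x.2.2 ∧ (symMatrix N r M).get x.1 x.2.1 = x.2.2.card}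

/-- The groups of labels that query message `j` when message `m` is desired: a group of entries and
a set of messages. -/
abbrev GroupsOf (N r M : ℕ) (j m : Fin M) : Type :=
  {x : (ℕ × (Fin N → ℕ)) × Finset (Fin M) //
    x.1 ∈ groups N r M ∧ x.2.card = x.1.1 ∧ j ∈ x.2 ∧ m ∉ x.2}

/-- The label at server `i` in a group. -/
def GroupsOf.label {N r M : ℕ} (hr : r < N) {j m : Fin (M + 2)}
    (x : GroupsOf N r (M + 2) j m) (i : Fin N) : LabelsOf N r (M + 2) j :=
  ⟨(⟨x.1.1.2 i, (isGrouping_symMatrix hr M).row_lt x.2.1 i⟩, i,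
    if entry (symMatrix N r (M + 2)) (x.1.1.2 i) i = x.1.1.1 then x.1.2 else insert m x.1.2), by
    refine ⟨?_, ?_⟩
    · dsimp only
      split_ifs
      · exact x.2.2.2.1
      · exact Finset.mem_insert_of_mem x.2.2.2.1
    · rw [← entry_eq_get]
      dsimp only
      split_ifs with h
      · rw [h, x.2.2.1]
      · rw [Finset.card_insert_of_notMem x.2.2.2.2, x.2.2.1]
        exact ((isGrouping_symMatrix hr M).entry_eq _ x.2.1 i).resolve_left h⟩

/-- Every label that queries `j` lies in exactly one group. -/
theorem GroupsOf.label_bijective {N r M : ℕ} (hr : r < N) {j m : Fin (M + 2)} (hjm : j ≠ m) :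
    Function.Bijective fun x : GroupsOf N r (M + 2) j m × Fin N => x.1.label hr x.2 := by
  have hgr := isGrouping_symMatrix hr M
  constructor
  · rintro ⟨⟨⟨p, s⟩, hp, hs, hj, hm⟩, i⟩ ⟨⟨⟨p', s'⟩, hp', hs', hj', hm'⟩, i'⟩ h
    simp only [GroupsOf.label, Subtype.mk.injEq, Prod.mk.injEq, Fin.mk.injEq] at h
    obtain ⟨h1, rfl, h2⟩ := h
    have hss : s = s' := by
      have h3 := congrArg (fun u => u.erase m) h2
      simp only [apply_ite (fun u : Finset (Fin (M + 2)) => u.erase m),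
        Finset.erase_insert hm, Finset.erase_insert hm', Finset.erase_eq_of_notMem hm,
        Finset.erase_eq_of_notMem hm', ite_self] at h3
      exact h3
    subst hss
    obtain rfl := hgr.unique p hp p' hp' i (hs.symm.trans hs') h1
    rfl
  · rintro ⟨⟨a, i, u⟩, hj, hu⟩
    simp only at hj hu
    have he : entry (symMatrix N r (M + 2)) a i = u.card := by rw [entry_eq_get, hu]
    have hup : 1 ≤ u.card := Finset.card_pos.2 ⟨j, hj⟩
    by_cases hm : m ∈ u
    · have hje : j ∈ u.erase m := Finset.mem_erase.2 ⟨hjm, hj⟩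
      have hc : (u.erase m).card + 1 = u.card := Finset.card_erase_add_one hm
      obtain ⟨p, hp, hpl, hpa⟩ := hgr.exists_upper a i (u.erase m).card
        (Finset.card_pos.2 ⟨j, hje⟩) (he.trans hc.symm)
      refine ⟨(⟨(p, u.erase m), hp, hpl.symm, hje, Finset.notMem_erase m u⟩, i), ?_⟩
      have hne : entry (symMatrix N r (M + 2)) a i ≠ p.1 := by omega
      simp only [GroupsOf.label, hpa, if_neg hne, Finset.insert_erase hm]
    · have hlt : u.card < M + 2 := by
        have := Finset.card_lt_univ_of_notMem hm
        rwa [Fintype.card_fin] at this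
      obtain ⟨p, hp, hpl, hpa⟩ := hgr.exists_lower a i u.card hup hlt he
      refine ⟨(⟨(p, u), hp, hpl.symm, hj, hm⟩, i), ?_⟩
      have hne : entry (symMatrix N r (M + 2)) a i = p.1 := by omega
      simp only [GroupsOf.label, hpa, if_pos hne]

/-- The labels that query `j` are indexed by a server and an element of `Fin (N ^ (M - 2))`, in such
a way that the labels of a group have the same index. -/
theorem GroupsOf.exists_equiv {N r M : ℕ} (hr : r < N) {j m : Fin (M + 2)} (hjm : j ≠ m) :
    ∃ η : LabelsOf N r (M + 2) j ≃ Fin (N ^ M) × Fin N, (∀ x, (η x).2 = x.1.2.1) ∧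
      ∀ p ∈ groups N r (M + 2), ∀ s : Finset (Fin (M + 2)), s.card = p.1 → j ∈ s → m ∉ s →
        ∃ g, ∀ x : LabelsOf N r (M + 2) j, (x.1.1 : ℕ) = p.2 x.1.2.1 →
          (x.1.2.2 = s ∨ x.1.2.2 = insert m s) → (η x).1 = g := by
  have hN : 0 < N := by omega
  have hgr := isGrouping_symMatrix hr M
  let φ := Equiv.ofBijective _ (GroupsOf.label_bijective hr hjm)
  have : Finite (GroupsOf N r (M + 2) j m) := by
    refine Finite.of_injective (fun x => φ (x, ⟨0, hN⟩)) fun x y h => ?_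
    exact (Prod.ext_iff.1 (φ.injective h)).1
  let _ : Fintype (GroupsOf N r (M + 2) j m) := Fintype.ofFinite _
  have hcard : Fintype.card (GroupsOf N r (M + 2) j m) = N ^ M := by
    have h := Fintype.card_congr φ
    rw [Fintype.card_prod, Fintype.card_fin, card_labels_mem hr.le, pow_succ] at h
    exact Nat.eq_of_mul_eq_mul_right hN h
  let ψ := Fintype.equivFinOfCardEq hcard
  refine ⟨φ.symm.trans (ψ.prodCongr (Equiv.refl _)), ?_, ?_⟩
  · intro x
    obtain ⟨y, rfl⟩ := φ.surjective x
    simp only [Equiv.trans_apply, Equiv.symm_apply_apply]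
    rfl
  · intro p hp s hs hj hm
    refine ⟨ψ ⟨(p, s), hp, hs, hj, hm⟩, fun x hx hxs => ?_⟩
    have : x = φ (⟨(p, s), hp, hs, hj, hm⟩, x.1.2.1) := by
      obtain ⟨⟨a, i, u⟩, hju, hu⟩ := x
      simp only at hx hxs hu
      have he : entry (symMatrix N r (M + 2)) (p.2 i) i = u.card := by
        rw [← hx, entry_eq_get, hu]
      refine Subtype.ext (Prod.ext (Fin.ext hx) (Prod.ext rfl ?_))
      change u = if entry (symMatrix N r (M + 2)) (p.2 i) i = p.1 then s else insert m s
      rcases hxs with rfl | rfl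
      · rw [if_pos (he.trans hs)]
      · rw [if_neg]
        rw [he, Finset.card_insert_of_notMem hm]
        omega
    conv_lhs => rw [this]
    simp only [Equiv.trans_apply, Equiv.symm_apply_apply]
    rfl

/-- An indexing `γ` of the labels that query `j` which does not depend on the desired message, and
permutations which turn it, at every server, into an indexing by groups. -/
theorem exists_group_perms {N r M : ℕ} (hr : r < N) :
    ∃ (γ : ∀ j, LabelsOf N r (M + 2) j → Fin (N ^ M))
      (π : Fin (M + 2) → Fin (M + 2) → Fin N → Equiv.Perm (Fin (N ^ M))),
      (∀ j, ∀ x y : LabelsOf N r (M + 2) j, x.1.2.1 = y.1.2.1 → γ j x = γ j y → x = y) ∧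
      ∀ j m, m ≠ j → ∀ p ∈ groups N r (M + 2), ∀ s : Finset (Fin (M + 2)), s.card = p.1 → j ∈ s →
        m ∉ s → ∃ g, ∀ x : LabelsOf N r (M + 2) j, (x.1.1 : ℕ) = p.2 x.1.2.1 →
          (x.1.2.2 = s ∨ x.1.2.2 = insert m s) → π j m x.1.2.1 (γ j x) = g := by
  have hη : ∀ j m : Fin (M + 2), ∃ η : LabelsOf N r (M + 2) j ≃ Fin (N ^ M) × Fin N,
      (∀ x, (η x).2 = x.1.2.1) ∧ (m ≠ j →
      ∀ p ∈ groups N r (M + 2), ∀ s : Finset (Fin (M + 2)), s.card = p.1 → j ∈ s → m ∉ s →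
        ∃ g, ∀ x : LabelsOf N r (M + 2) j, (x.1.1 : ℕ) = p.2 x.1.2.1 →
          (x.1.2.2 = s ∨ x.1.2.2 = insert m s) → (η x).1 = g) := by
    intro j m
    by_cases h : m = j
    · obtain ⟨m', hm'⟩ := exists_ne j
      obtain ⟨η, h1, -⟩ := GroupsOf.exists_equiv hr hm'.symm
      exact ⟨η, h1, fun h' => absurd h h'⟩
    · obtain ⟨η, h1, h2⟩ := GroupsOf.exists_equiv hr (Ne.symm h)
      exact ⟨η, h1, fun _ => h2⟩
  choose η hη1 hη2 using hη
  have hbij : ∀ j m i, Function.Bijective fun g => (η j m ((η j j).symm (g, i))).1 := by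
    intro j m i
    refine Finite.injective_iff_bijective.1 fun g g' h => ?_
    have h2 : ∀ g, (η j m ((η j j).symm (g, i))).2 = i := by
      intro g
      rw [hη1, ← hη1 j j, Equiv.apply_symm_apply]
    have := (η j m).injective (Prod.ext h ((h2 g).trans (h2 g').symm))
    exact (Prod.ext_iff.1 ((η j j).symm.injective this)).1
  refine ⟨fun j x => (η j j x).1, fun j m i => Equiv.ofBijective _ (hbij j m i), ?_, ?_⟩
  · intro j x y h1 h2
    exact (η j j).injective (Prod.ext h2 (by rw [hη1, hη1, h1]))
  · intro j m hm p hp s hs hj hms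
    obtain ⟨g, hg⟩ := hη2 j m hm p hp s hs hj hms
    refine ⟨g, fun x hx hxs => ?_⟩
    rw [← hg x hx hxs, Equiv.ofBijective_apply]
    have : ((η j j x).1, x.1.2.1) = η j j x := Prod.ext rfl (hη1 j j x).symm
    rw [this, Equiv.symm_apply_apply]

/-! ### Responses to the star product noise -/

theorem response_sum_smul {F : Type*} [Field F] {N K M ℓ : ℕ} (G : Matrix (Fin K) (Fin N) F)
    (W : Messages F M K ℓ) (i : Fin N) {ι : Type*} (s : Finset ι) (c : ι → F)
    (u : ι → Query F M ℓ) :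
    response G W i (∑ t ∈ s, c t • u t) = ∑ t ∈ s, c t * response G W i (u t) := by
  simp only [response, Finset.sum_apply, Pi.smul_apply, smul_eq_mul, Finset.mul_sum]
  rw [Finset.sum_comm' (s := s) (t' := Finset.univ) (s' := fun _ => s) (by simp)]
  refine Finset.sum_congr rfl fun j _ => ?_
  rw [Finset.sum_comm]
  refine Finset.sum_congr rfl fun t _ => Finset.sum_congr rfl fun l _ => ?_
  ring

theorem response_sub_right {F : Type*} [Field F] {N K M ℓ : ℕ} (G : Matrix (Fin K) (Fin N) F)
    (W : Messages F M K ℓ) (i : Fin N) (q q' : Query F M ℓ) :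
    response G W i (q - q') = response G W i q - response G W i q' := by
  simp only [response, Pi.sub_apply, mul_sub, Finset.sum_sub_distrib]

theorem response_sub_left {F : Type*} [Field F] {N K M ℓ : ℕ} (G : Matrix (Fin K) (Fin N) F)
    (W W' : Messages F M K ℓ) (i : Fin N) (q : Query F M ℓ) :
    response G (W - W') i q = response G W i q - response G W' i q := by
  simp only [response, stored, Pi.sub_apply, sub_mul, Finset.sum_sub_distrib]

theorem response_part {F : Type*} [Field F] {N K M ℓ : ℕ} (G : Matrix (Fin K) (Fin N) F)
    (W : Messages F M K ℓ) (i : Fin N) (m : Fin M) (q : Query F M ℓ) :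
    response G W i (part m q) = ∑ l, stored G W i m l * q m l := by
  rw [response, Finset.sum_eq_single m]
  · simp [part]
  · intro j _ hj
    simp [part, hj]
  · intro h
    exact absurd (Finset.mem_univ m) h

theorem mem_support_starNoise {F : Type*} [Field F] [Fintype F] [DecidableEq F] {N T M ℓ : ℕ}
    {H : Matrix (Fin T) (Fin N) F} {b : Fin N → Query F M ℓ} :
    b ∈ (starNoise M ℓ H).support ↔ ∃ u : Fin T → Query F M ℓ, (fun i => ∑ t, H t i • u t) = b := by
  rw [starNoise, PMF.support_map, PMF.support_uniformOfFintype]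
  simp

/-- The responses to a realization of the noise form a codeword of the star product. -/
theorem response_noise_mem {F : Type*} [Field F] [Fintype F] [DecidableEq F] {N K T M ℓ : ℕ}
    (G : Matrix (Fin K) (Fin N) F) (H : Matrix (Fin T) (Fin N) F) (W : Messages F M K ℓ)
    {b : Fin N → Query F M ℓ} (hb : b ∈ (starNoise M ℓ H).support) :
    (fun i => response G W i (b i)) ∈ rowSpace G * rowSpace H := by
  obtain ⟨u, rfl⟩ := mem_support_starNoise.1 hb
  have : (fun i => response G W i (∑ t, H t i • u t)) =
      ∑ t, ∑ j, ∑ l, (fun i => u t j l * stored G W i j l) * H t := by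
    funext i
    rw [response_sum_smul]
    simp only [Finset.sum_apply, Pi.mul_apply, response, Finset.mul_sum]
    refine Finset.sum_congr rfl fun t _ => Finset.sum_congr rfl fun j _ =>
      Finset.sum_congr rfl fun l _ => ?_
    ring
  rw [this]
  refine Submodule.sum_mem _ fun t _ => Submodule.sum_mem _ fun j _ => Submodule.sum_mem _ fun l _ =>
    Submodule.mul_mem_mul ?_ (Submodule.subset_span ⟨t, rfl⟩)
  refine mem_rowSpace_iff.2 ⟨fun k => u t j l * W j l k, fun i => ?_⟩
  simp only [stored, Finset.mul_sum, mul_assoc]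

/-- A codeword of an MDS code is determined, linearly, by its entries at `k` positions. -/
theorem IsMDS.exists_interpolation {F : Type*} [Field F] [DecidableEq F] {N k : ℕ}
    {C : Submodule F (Fin N → F)} (hC : IsMDS k C) (S : Finset (Fin N)) (hS : k ≤ S.card) :
    ∃ α : Fin N → Fin N → F, ∀ c ∈ C, ∀ i, c i = ∑ j ∈ S, α i j * c j := by
  classical
  let f : C →ₗ[F] (S → F) := (LinearMap.funLeft F F fun i : S => (i : Fin N)) ∘ₗ C.subtype
  have hf : LinearMap.ker f = ⊥ := by
    refine LinearMap.ker_eq_bot'.2 fun c hc => ?_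
    exact Subtype.ext (hC.eq_zero_of_vanish c.2 S hS fun i hi => congrFun hc ⟨i, hi⟩)
  obtain ⟨g, hg⟩ := f.exists_leftInverse_of_injective hf
  refine ⟨fun i j => if hj : j ∈ S then (g (Pi.single ⟨j, hj⟩ 1) : Fin N → F) i else 0,
    fun c hc i => ?_⟩
  have h1 : g (f ⟨c, hc⟩) = ⟨c, hc⟩ := LinearMap.congr_fun hg _
  have h2 : f ⟨c, hc⟩ = ∑ j : S, c j • Pi.single j (1 : F) := by
    funext j
    simp [f, Finset.sum_apply, Pi.single_apply, LinearMap.funLeft_apply]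
  rw [h2, map_sum] at h1
  have h3 := congrFun (congrArg Subtype.val h1) i
  refine h3.symm.trans ?_
  rw [← Finset.sum_coe_sort S]
  simp only [map_smul, Submodule.coe_sum, Finset.sum_apply, Submodule.coe_smul, Pi.smul_apply,
    smul_eq_mul]
  refine Finset.sum_congr rfl fun j _ => ?_
  rw [dif_pos j.2, mul_comm]

theorem ColumnsSeparated.exists_ne_zero {F : Type*} [Field F] {N K : ℕ}
    {G : Matrix (Fin K) (Fin N) F} (hG : ColumnsSeparated G) (hK : 1 ≤ K) (i : Fin N) :
    ∃ k, G k i ≠ 0 := by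
  obtain ⟨u, hu⟩ := hG {i} (by simpa using hK) i
  by_contra! h
  simpa [h] using hu i (Finset.mem_singleton_self i)

theorem exists_isOneShot {F : Type*} [Field F] [Fintype F] [DecidableEq F] {N K T M ℓ r : ℕ}
    {G : Matrix (Fin K) (Fin N) F} {H : Matrix (Fin T) (Fin N) F} (hG : ColumnsSeparated G)
    (hH : ColumnsSeparated H) (hGH : IsMDS r (rowSpace G * rowSpace H)) (hK : 1 ≤ K) (hr : r ≤ N)
    (hℓ : N ≤ ℓ) (m : Fin M) :
    ∃ a : Fin N → Query F M ℓ, IsOneShot G T r m (starNoise M ℓ H) a := by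
  classical
  -- Every server `i ≥ r` is asked for a coordinate of its own.
  refine ⟨fun i => if (i : ℕ) < r then 0 else Pi.single m (Pi.single (Fin.castLE hℓ i) 1),
    ?_, ?_, ?_, ?_, ?_⟩
  · intro i hi
    exact if_pos hi
  · intro i j hj
    dsimp only
    split_ifs
    · rfl
    · exact Pi.single_eq_of_ne hj _
  · intro J hJ
    set a : Fin N → Query F M ℓ := fun i =>
      if (i : ℕ) < r then 0 else Pi.single m (Pi.single (Fin.castLE hℓ i) 1) with ha
    have h := hH.map_codewords_uniform (n := M) J hJ.le (fun _ => 1) (X := Fin ℓ → F)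
    have hs := pmf_map_uniformOfFinset_of_perm (Finset.univ : Finset (J → Query F M ℓ))
      Finset.univ_nonempty (fun q i => q i + a i.1)
      (fun q q' hq => funext fun i => add_right_cancel (congrFun hq i)) fun _ _ => Finset.mem_univ _
    change (PMF.uniformOfFintype (J → Query F M ℓ)).map _ = PMF.uniformOfFintype _ at hs
    conv_rhs => rw [← hs, ← h]
    rw [PMF.map_comp, starNoise, PMF.map_comp]
    congr 1
    funext u i g
    simp [codewords, Finset.sum_apply]
  · rw [Fintype.linearIndependent_iff]
    intro y hy i
    obtain ⟨k, hk⟩ := hG.exists_ne_zero hK i.1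
    have h := congrFun hy (Pi.single m (Pi.single (Fin.castLE hℓ i.1) (Pi.single k 1)))
    rw [Finset.sum_apply, Finset.sum_eq_single i] at h
    · simp only [Pi.smul_apply, smul_eq_mul, Pi.zero_apply, if_neg (not_lt.2 i.2)] at h
      have hz : ∀ W : Messages F M K ℓ, response G W i.1 (Pi.single m (Pi.single
          (Fin.castLE hℓ i.1) 1)) = ∑ k, W m (Fin.castLE hℓ i.1) k * G k i.1 := by
        intro W
        rw [response, Finset.sum_eq_single m, Finset.sum_eq_single (Fin.castLE hℓ i.1)]
        · simp [stored]
        · intro l _ hl; simp [hl]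
        · simp
        · intro j _ hj; simp [hj]
        · simp
      rw [hz] at h
      simp only [Pi.single_eq_same] at h
      rw [Finset.sum_eq_single k] at h
      · simpa [hk] using h
      · intro k' _ hk'; simp [hk']
      · simp
    · intro i' _ hi'
      have hne : Fin.castLE hℓ i'.1 ≠ Fin.castLE hℓ i.1 := fun e =>
        hi' (Subtype.ext (Fin.castLE_injective hℓ e))
      simp only [Pi.smul_apply, smul_eq_mul, if_neg (not_lt.2 i'.2)]
      rw [response, Finset.sum_eq_zero, mul_zero]
      intro j _
      refine Finset.sum_eq_zero fun l _ => ?_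
      by_cases hj : j = m
      · subst hj
        by_cases hl : l = Fin.castLE hℓ i'.1
        · subst hl
          simp [stored, hne]
        · simp [hl]
      · simp [hj]
    · simp
  · obtain ⟨α, hα⟩ := hGH.exists_interpolation
      (Finset.univ.filter fun j : Fin N => (j : ℕ) < r)
      (by rw [Fin.card_filter_val_lt, min_eq_right hr])
    exact ⟨α, fun q hq i _ W => hα _ (response_noise_mem G H W hq) i⟩

/-! ### Decoding -/

/-- As many independent functionals as the message has symbols span the dual space, so that a message
on which all of them vanish is zero. -/
theorem eq_zero_of_part_responses {F : Type*} [Field F] [Fintype F] {N K M ℓ : ℕ}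
    (G : Matrix (Fin K) (Fin N) F) (m : Fin M) {ι : Type*} [Fintype ι] (srv : ι → Fin N)
    (q : ι → Query F M ℓ) (hcard : Fintype.card ι = ℓ * K)
    (hli : LinearIndependent F fun x : ι =>
      fun W : Messages F M K ℓ => response G W (srv x) (part m (q x)))
    (W : Messages F M K ℓ) (h : ∀ x, response G W (srv x) (part m (q x)) = 0) : W m = 0 := by
  let φ : ι → Module.Dual F (Fin ℓ → Fin K → F) := fun x =>
    { toFun := fun V => ∑ l, (∑ k, V l k * G k (srv x)) * q x m l
      map_add' := fun V V' => by
        simp only [Pi.add_apply, add_mul, Finset.sum_add_distrib]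
      map_smul' := fun c V => by
        simp only [Pi.smul_apply, smul_eq_mul, Finset.mul_sum, Finset.sum_mul, mul_assoc,
          RingHom.id_apply] }
  have hφ : ∀ x (W : Messages F M K ℓ), response G W (srv x) (part m (q x)) = φ x (W m) := by
    intro x W
    rw [response_part]
    rfl
  let Φ : Module.Dual F (Fin ℓ → Fin K → F) →ₗ[F] (Messages F M K ℓ → F) :=
    { toFun := fun f W => f (W m)
      map_add' := fun _ _ => rfl
      map_smul' := fun _ _ => rfl }
  have hφli : LinearIndependent F φ := by
    refine LinearIndependent.of_comp Φ ?_
    convert hli using 1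
    funext x W
    exact (hφ x W).symm
  have hspan := hφli.span_eq_top_of_card_eq_finrank' (by
    rw [hcard, Subspace.dual_finrank_eq, Module.finrank_pi_fintype]
    simp)
  rw [← Module.forall_dual_apply_eq_zero_iff F (W m)]
  intro f
  have hf : f ∈ Submodule.span F (Set.range φ) := hspan ▸ Submodule.mem_top
  induction hf using Submodule.span_induction with
  | mem f hf =>
    obtain ⟨x, rfl⟩ := hf
    rw [← hφ, h]
  | zero => rfl
  | add f g _ _ hf hg => rw [LinearMap.add_apply, hf, hg, add_zero]
  | smul c f _ hf => rw [LinearMap.smul_apply, hf, smul_zero]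

/-- Decoding: the first `r` responses of a group determine the interference in the others, and what
is left are as many independent functionals of the desired message as it has symbols. -/
theorem IsRefinedLifting.eq_zero {F : Type*} [Field F] [Fintype F] [DecidableEq F]
    {N K T M ℓ r ρ : ℕ} {G : Matrix (Fin K) (Fin N) F} {H : Matrix (Fin T) (Fin N) F}
    {Q : Scheme F (M + 2) ℓ (LiftLabel N r (M + 2) ρ)}
    (hQ : IsRefinedLifting G (starNoise (M + 2) ℓ H) Q)
    (hGH : IsMDS r (rowSpace G * rowSpace H)) (hr : r < N) (hcard : ρ * N ^ (M + 1) = ℓ * K)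
    {m : Fin (M + 2)} {q : LiftLabel N r (M + 2) ρ → Query F (M + 2) ℓ} (hq : q ∈ (Q m).support)
    (W : Messages F (M + 2) K ℓ) (h : ∀ x, response G W x.server (q x) = 0) : W m = 0 := by
  obtain ⟨hzero, hli, hgroup⟩ := hQ m q hq
  have hgr := isGrouping_symMatrix hr M
  refine eq_zero_of_part_responses G m (fun x : {x : LiftLabel N r (M + 2) ρ // m ∈ x.msgs} =>
    x.1.server) (fun x => q x.1) ?_ hli W ?_
  · rw [card_liftLabel_mem, card_labels_mem hr.le, hcard]
  rintro ⟨x, hm⟩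
  suffices hsub : response G W x.server (q x - part m (q x)) = 0 by
    rw [response_sub_right, h x, zero_sub, neg_eq_zero] at hsub
    exact hsub
  rcases (x.msgs.erase m).eq_empty_or_nonempty with he | hne
  · have : q x - part m (q x) = 0 := by
      funext j
      by_cases hj : j = m
      · subst hj; simp [part]
      · have : j ∉ x.msgs := fun hjx =>
          absurd (he ▸ Finset.mem_erase.2 ⟨hj, hjx⟩) (Finset.notMem_empty j)
        simp [part, hj, hzero x j this]
    rw [this]
    simp [response]
  · have hc : (x.msgs.erase m).card + 1 = x.msgs.card := Finset.card_erase_add_one hm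
    obtain ⟨p, hp, hpl, hpa⟩ := hgr.exists_upper x.1.2.1 x.server (x.msgs.erase m).card
      (Finset.card_pos.2 hne) (by rw [entry_eq_get, hc]; exact x.2.2)
    obtain ⟨b, hb, hbx⟩ := hgroup p hp x.1.1 (x.msgs.erase m) hpl.symm (Finset.notMem_erase m _)
    have hcw : (fun i => response G W i (b i)) = 0 := by
      refine hGH.eq_zero_of_vanish (response_noise_mem G H W hb) _
        (hgr.card_lower p hp).ge fun i hi => ?_
      have hi' := (Finset.mem_filter.1 hi).2
      -- The label in the group at server `i`, where the noise alone is sent.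
      let y : LiftLabel N r (M + 2) ρ :=
        ⟨(x.1.1, ⟨p.2 i, hgr.row_lt hp i⟩, i, x.msgs.erase m), hne, by
          rw [← entry_eq_get, hi', hpl]⟩
      have hy := (hbx y rfl rfl).1 rfl
      change response G W y.server (b y.server) = 0
      rw [← hy, h y]
    rw [(hbx x rfl hpa.symm).2 (Finset.insert_erase hm).symm]
    exact congrFun hcw x.server

theorem isCorrect_of_eq_zero {F : Type*} [Field F] [Fintype F] [DecidableEq F]
    {N K M ℓ : ℕ} {ι : Type*} [Fintype ι] [DecidableEq ι] {G : Matrix (Fin K) (Fin N) F}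
    {server : ι → Fin N} {Q : Scheme F M ℓ ι}
    (h : ∀ m, ∀ q ∈ (Q m).support, ∀ W : Messages F M K ℓ,
      (∀ x, response G W (server x) (q x) = 0) → W m = 0) : IsCorrect G server Q := by
  intro m
  refine condEntropy_eq_zero _ _ _ ?_
  rintro ⟨W, q⟩ hω ⟨W', q'⟩ - hY
  obtain ⟨hqq, hresp⟩ := Prod.ext_iff.1 hY
  simp only at hqq hresp
  subst hqq
  have hq : q ∈ (Q m).support := by
    rw [dataLaw, PMF.mem_support_bind_iff] at hω
    obtain ⟨W₀, -, hW₀⟩ := hω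
    rw [PMF.mem_support_map_iff] at hW₀
    obtain ⟨q₀, hq₀, e⟩ := hW₀
    have e₂ : q₀ = q := (Prod.ext_iff.1 e).2
    rwa [← e₂]
  have h0 := h m q hq (W - W') fun x => by
    rw [response_sub_left, sub_eq_zero]
    exact congrFun hresp x
  exact sub_eq_zero.1 h0

/-! ### The refined and lifted scheme -/

section

variable {F E C : Type*} [Field F] [Field E] [Algebra F E] {N K T M n e ℓ r ρ : ℕ}

/-- The coordinates over `F` of a vector over `E`. -/
def coords (bas : Module.Basis (Fin e) F E) (el : Fin ℓ ≃ Fin e × C) :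
    (C → E) →ₗ[F] (Fin ℓ → F) where
  toFun v l := bas.repr (v (el l).2) (el l).1
  map_add' v v' := by funext l; simp
  map_smul' c v := by funext l; simp

theorem coords_injective (bas : Module.Basis (Fin e) F E) (el : Fin ℓ ≃ Fin e × C) :
    Function.Injective (coords bas el) := by
  rw [← LinearMap.ker_eq_bot, LinearMap.ker_eq_bot']
  intro v hv
  funext c
  refine bas.repr.map_eq_zero_iff.1 (Finsupp.ext fun a => ?_)
  simpa [coords] using congrFun hv (el.symm (a, c))

/-- The functionals which the vectors `w i g a`, multiplied by the elements of a basis of `E` over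
`F`, define on the desired message are linearly independent over `F`. -/
theorem TensorIndep.linearIndependent [Fintype C] {G : Matrix (Fin K) (Fin N) F}
    {w : Fin N → Fin n → Fin K → C → E} (hw : TensorIndep G w) (bas : Module.Basis (Fin e) F E)
    (el : Fin ℓ ≃ Fin e × C) (m : Fin M) :
    LinearIndependent F (fun x : Fin N × Fin n × Fin K × Fin e =>
      fun W : Messages F M K ℓ => ∑ l, stored G W x.1 m l *
        coords bas el (bas x.2.2.2 • w x.1 x.2.1 x.2.2.1) l) := by
  classical
  rw [Fintype.linearIndependent_iff]
  intro y hy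
  have hl : ∀ l k, ∑ x : Fin N × Fin n × Fin K × Fin e,
      y x * (G k x.1 * coords bas el (bas x.2.2.2 • w x.1 x.2.1 x.2.2.1) l) = 0 := by
    intro l k
    have h := congrFun hy (Pi.single m (Pi.single l (Pi.single k 1)))
    rw [Finset.sum_apply] at h
    refine Eq.trans (Finset.sum_congr rfl fun x _ => ?_) h
    rw [Pi.smul_apply, smul_eq_mul, Finset.sum_eq_single l]
    · congr 2
      rw [stored, Finset.sum_eq_single k]
      · simp
      · intro k' _ hk'; simp [hk']
      · simp
    · intro l' _ hl'; simp [stored, hl']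
    · simp
  have hv : ∀ k, ∑ x : Fin N × Fin n × Fin K × Fin e,
      (y x * G k x.1) • (bas x.2.2.2 • w x.1 x.2.1 x.2.2.1) = 0 := by
    intro k
    apply coords_injective bas el
    rw [map_zero]
    funext l
    simp only [map_sum, map_smul, Finset.sum_apply, Pi.smul_apply, smul_eq_mul, Pi.zero_apply,
      mul_assoc]
    exact hl l k
  have h0 := hw (fun i g a => ∑ b, y (i, g, a, b) • bas b) fun c k => by
    have h := congrFun (hv k) c
    simp only [Finset.sum_apply, Fintype.sum_prod_type, Pi.zero_apply] at h
    refine Eq.trans ?_ h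
    refine Finset.sum_congr rfl fun i _ => Finset.sum_congr rfl fun g _ =>
      Finset.sum_congr rfl fun a _ => ?_
    rw [Finset.sum_mul, Finset.sum_mul]
    refine Finset.sum_congr rfl fun b _ => ?_
    rw [Pi.smul_apply, Pi.smul_apply, smul_eq_mul, Algebra.smul_def, Algebra.smul_def, map_mul]
    ring
  rintro ⟨i, g, a, b⟩
  exact Fintype.linearIndependent_iff.1 bas.linearIndependent (fun b => y (i, g, a, b))
    (congrFun (congrFun (congrFun h0 i) g) a) b

/-- The queries given by vectors `w j i g a` over `E` for every message `j`. The repetition number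
of a label is a pair of an element of the basis of `E` and of an element of `Fin K`, and `γ` gives
the index in `Fin n`. -/
def liftQueries (bas : Module.Basis (Fin e) F E) (el : Fin ℓ ≃ Fin e × C)
    (er : Fin ρ ≃ Fin e × Fin K) (γ : ∀ j, LabelsOf N r M j → Fin n)
    (w : Fin M → Fin N → Fin n → Fin K → C → E) (x : LiftLabel N r M ρ) : Query F M ℓ :=
  fun j => if h : j ∈ x.msgs then
    coords bas el (bas (er x.1.1).1 • w j x.server (γ j ⟨x.1.2, h, x.2.2⟩) (er x.1.1).2) else 0

/-- The laws of the vectors that query message `j` when `m` is desired. -/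
def messageLaw [Fintype C] [Fintype E] (H : Matrix (Fin T) (Fin N) F)
    (pD : PMF (Fin N → Fin n → Fin K → C → E)) (pU : PMF (Fin T → Fin n → Fin K → C → E))
    (π : Fin M → Fin M → Fin N → Equiv.Perm (Fin n)) (m j : Fin M) :
    PMF (Fin N → Fin n → Fin K → C → E) :=
  if j = m then pD else pU.map fun z i g => codewords H z i (π j m i g)

/-- The scheme whose queries to the desired message are free, while those to the other messages are
codewords of the retrieval code on every group. -/
def liftedScheme [Fintype C] [Fintype E] [DecidableEq C] (H : Matrix (Fin T) (Fin N) F)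
    (bas : Module.Basis (Fin e) F E) (el : Fin ℓ ≃ Fin e × C) (er : Fin ρ ≃ Fin e × Fin K)
    (γ : ∀ j, LabelsOf N r M j → Fin n) (π : Fin M → Fin M → Fin N → Equiv.Perm (Fin n))
    (pD : PMF (Fin N → Fin n → Fin K → C → E)) (pU : PMF (Fin T → Fin n → Fin K → C → E)) :
    Scheme F M ℓ (LiftLabel N r M ρ) := fun m =>
  (pmfPi (messageLaw H pD pU π m)).map (liftQueries bas el er γ)

end

theorem isRefinedLifting_liftedScheme {F E C : Type*} [Field F] [Fintype F] [DecidableEq F]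
    [Field E] [Fintype E] [Algebra F E] [Fintype C] [DecidableEq C] {N K T M n e ℓ r ρ : ℕ}
    {G : Matrix (Fin K) (Fin N) F} (H : Matrix (Fin T) (Fin N) F)
    (bas : Module.Basis (Fin e) F E) (el : Fin ℓ ≃ Fin e × C) (er : Fin ρ ≃ Fin e × Fin K)
    (γ : ∀ j, LabelsOf N r M j → Fin n) (π : Fin M → Fin M → Fin N → Equiv.Perm (Fin n))
    (pD : PMF (Fin N → Fin n → Fin K → C → E)) (pU : PMF (Fin T → Fin n → Fin K → C → E))
    (hpD : ∀ w ∈ pD.support, TensorIndep G w)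
    (hγ : ∀ j, ∀ x y : LabelsOf N r M j, x.1.2.1 = y.1.2.1 → γ j x = γ j y → x = y)
    (hπ : ∀ j m, m ≠ j → ∀ p ∈ groups N r M, ∀ s : Finset (Fin M), s.card = p.1 → j ∈ s →
        m ∉ s → ∃ g, ∀ x : LabelsOf N r M j, (x.1.1 : ℕ) = p.2 x.1.2.1 →
          (x.1.2.2 = s ∨ x.1.2.2 = insert m s) → π j m x.1.2.1 (γ j x) = g) :
    IsRefinedLifting G (starNoise M ℓ H) (liftedScheme H bas el er γ π pD pU) := by
  classical
  intro m q hq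
  rw [liftedScheme, PMF.mem_support_map_iff] at hq
  obtain ⟨w, hw, rfl⟩ := hq
  have hwj := fun j => mem_support_of_mem_support_pmfPi hw j
  have hD : TensorIndep G (w m) := hpD _ (by simpa [messageLaw] using hwj m)
  have hU : ∀ j, j ≠ m → ∃ z, w j = fun i g => codewords H z i (π j m i g) := by
    intro j hj
    have h := hwj j
    rw [messageLaw, if_neg hj, PMF.mem_support_map_iff] at h
    obtain ⟨z, -, hz⟩ := h
    exact ⟨z, hz.symm⟩
  choose! z hz using hU
  refine ⟨fun x j hj => by rw [liftQueries, dif_neg hj], ?_, ?_⟩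
  · have h := (hD.linearIndependent bas el m).comp
      (fun x : {x : LiftLabel N r M ρ // m ∈ x.msgs} =>
        (x.1.server, γ m ⟨x.1.1.2, x.2, x.1.2.2⟩, (er x.1.1.1).2, (er x.1.1.1).1)) ?_
    · convert h using 1
      funext x W
      rw [response_part, liftQueries, dif_pos x.2]
      rfl
    · rintro ⟨x, hx⟩ ⟨y, hy⟩ hxy
      simp only [Prod.mk.injEq] at hxy
      obtain ⟨h1, h2, h3, h4⟩ := hxy
      have hl := hγ m _ _ h1 h2
      have hc : x.1.1 = y.1.1 := er.injective (Prod.ext h4 h3)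
      exact Subtype.ext (Subtype.ext (Prod.ext hc (congrArg Subtype.val hl)))
  · intro p hp c s hs hms
    have hg : ∀ j, j ∈ s → ∃ g, ∀ x : LabelsOf N r M j, (x.1.1 : ℕ) = p.2 x.1.2.1 →
        (x.1.2.2 = s ∨ x.1.2.2 = insert m s) → π j m x.1.2.1 (γ j x) = g := fun j hj =>
      hπ j m (fun e => hms (e ▸ hj)) p hp s hs hj hms
    by_cases hn : Nonempty (Fin n)
    swap
    · refine ⟨_, mem_support_starNoise.2 ⟨0, rfl⟩, fun x hxc hxp => ?_⟩
      obtain ⟨j, hj⟩ := x.2.1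
      exact absurd ⟨γ j ⟨x.1.2, hj, x.2.2⟩⟩ hn
    choose! g hg using hg
    -- The information symbols of the codewords that form the noise of the group.
    refine ⟨_, mem_support_starNoise.2 ⟨fun t j => if j ∈ s then
      coords bas el (bas (er c).1 • z j t (g j) (er c).2) else 0, rfl⟩, fun x hxc hxp => ?_⟩
    have hq : ∀ j, (hj : j ∈ s) → (x.msgs = s ∨ x.msgs = insert m s) →
        liftQueries bas el er γ w x j =
          ∑ t, H t x.server • coords bas el (bas (er c).1 • z j t (g j) (er c).2) := by
      intro j hj hxs
      have hjx : j ∈ x.msgs := by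
        rcases hxs with h | h
        · rwa [h]
        · rw [h]; exact Finset.mem_insert_of_mem hj
      have hjm : j ≠ m := fun e => hms (e ▸ hj)
      have hgx : π j m x.server (γ j ⟨x.1.2, hjx, x.2.2⟩) = g j :=
        hg j hj ⟨x.1.2, hjx, x.2.2⟩ hxp hxs
      rw [liftQueries, dif_pos hjx, hz j hjm, hxc]
      beta_reduce
      rw [hgx]
      simp only [← map_smul, ← map_sum]
      congr 1
      funext d
      simp only [codewords, Finset.sum_apply, Pi.smul_apply, Finset.smul_sum]
      exact Finset.sum_congr rfl fun t _ => smul_comm _ _ _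
    refine ⟨fun hxs => ?_, fun hxs => ?_⟩
    · funext j
      rw [Finset.sum_apply]
      simp only [Pi.smul_apply]
      by_cases hj : j ∈ s
      · simp only [if_pos hj]
        exact hq j hj (Or.inl hxs)
      · simp only [if_neg hj, smul_zero, Finset.sum_const_zero]
        rw [liftQueries, dif_neg (by rwa [hxs])]
    · funext j
      rw [Finset.sum_apply, Pi.sub_apply]
      simp only [Pi.smul_apply, part]
      by_cases hjm : j = m
      · subst hjm
        simp [hms]
      rw [if_neg hjm, sub_zero]
      by_cases hj : j ∈ s
      · simp only [if_pos hj]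
        exact hq j hj (Or.inr hxs)
      · simp only [if_neg hj, smul_zero, Finset.sum_const_zero]
        rw [liftQueries, dif_neg]
        rw [hxs, Finset.mem_insert]
        tauto

/-- Privacy: the law of the queries to the servers in `J` is that of the desired vectors for every
message, whichever message is desired. -/
theorem map_liftedScheme {F E C : Type*} [Field F]
    [Field E] [Fintype E] [Algebra F E] [Fintype C] [DecidableEq C] {N K T M n e ℓ r ρ : ℕ}
    (H : Matrix (Fin T) (Fin N) F)
    (bas : Module.Basis (Fin e) F E) (el : Fin ℓ ≃ Fin e × C) (er : Fin ρ ≃ Fin e × Fin K)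
    (γ : ∀ j, LabelsOf N r M j → Fin n) (π : Fin M → Fin M → Fin N → Equiv.Perm (Fin n))
    (pD : PMF (Fin N → Fin n → Fin K → C → E)) (pU : PMF (Fin T → Fin n → Fin K → C → E))
    (J : Finset (Fin N))
    (hJ : ∀ π : Fin N → Equiv.Perm (Fin n), pD.map (fun w (i : J) => w i.1) =
          pU.map (fun z (i : J) g => codewords H z i.1 (π i.1 g))) (m m' : Fin M) :
    (liftedScheme H bas el er γ π pD pU m).map
      (fun q (x : {x : LiftLabel N r M ρ // x.server ∈ J}) => q x.1) =
    (liftedScheme H bas el er γ π pD pU m').map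
      (fun q (x : {x : LiftLabel N r M ρ // x.server ∈ J}) => q x.1) := by
  -- The queries to the servers in `J` depend only on the vectors for these servers.
  let Ψ : (Fin M → J → Fin n → Fin K → C → E) →
      {x : LiftLabel N r M ρ // x.server ∈ J} → Query F M ℓ := fun w x j =>
    if h : j ∈ x.1.msgs then
      coords bas el (bas (er x.1.1.1).1 •
        w j ⟨x.1.server, x.2⟩ (γ j ⟨x.1.1.2, h, x.1.2.2⟩) (er x.1.1.1).2) else 0
  have h : ∀ m, (liftedScheme H bas el er γ π pD pU m).map
      (fun q (x : {x : LiftLabel N r M ρ // x.server ∈ J}) => q x.1) =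
      (pmfPi fun _ => pD.map fun w (i : J) => w i.1).map Ψ := by
    intro m
    have hlaw : (fun _ : Fin M => pD.map fun w (i : J) => w i.1) =
        fun j => (messageLaw H pD pU π m j).map fun w (i : J) => w i.1 := by
      funext j
      rw [messageLaw]
      split_ifs
      · rfl
      · rw [PMF.map_comp, hJ (π j m)]
        rfl
    rw [hlaw, ← pmfPi_map, liftedScheme, PMF.map_comp, PMF.map_comp]
    rfl
  rw [h m, h m']

theorem isPrivate_of_map_eq {F : Type*} [Fintype F] {N M ℓ : ℕ} [NeZero M]
    {ι : Type*} [Fintype ι] [DecidableEq ι] {T : ℕ} {server : ι → Fin N} {Q : Scheme F M ℓ ι}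
    (h : ∀ J : Finset (Fin N), J.card = T → ∀ m m',
      (Q m).map (fun q (s : {s : ι // server s ∈ J}) => q s.1) =
        (Q m').map fun q (s : {s : ι // server s ∈ J}) => q s.1) :
    IsPrivate T server Q := by
  intro J hJ
  exact mutualInfo_indexLaw_eq_zero Q (fun q (s : {s : ι // server s ∈ J}) => q s.1)
    ((Q 0).map fun q (s : {s : ι // server s ∈ J}) => q s.1) fun m => h J hJ m 0

/-! ### The rate -/

theorem rate_liftLabel {N r M e K : ℕ} (hr : r < N) (he : 1 ≤ e) (hK : 1 ≤ K) :
    rate K (e * (N ^ M * N)) (LiftLabel N r (M + 2) (e * K)) =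
      ((N : ℝ) - r) * (N : ℝ) ^ (M + 1) / ((N : ℝ) ^ (M + 2) - (r : ℝ) ^ (M + 2)) := by
  rw [rate, card_liftLabel]
  have h := card_labels_nonempty (M := M) hr.le
  generalize Fintype.card {x : Fin (symMatrix N r (M + 2)).length × Fin N × Finset (Fin (M + 2)) //
    x.2.2.Nonempty ∧ (symMatrix N r (M + 2)).get x.1 x.2.1 = x.2.2.card} = t at h
  have hlt : r ^ (M + 2) < N ^ (M + 2) := Nat.pow_lt_pow_left hr (by omega)
  have ht : t ≠ 0 := by
    rintro rfl
    omega
  have h' : ((N : ℝ) ^ (M + 2) - (r : ℝ) ^ (M + 2)) = ((N : ℝ) - r) * t := by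
    rw [← Nat.cast_sub hr.le, sub_eq_iff_eq_add]
    exact_mod_cast h.symm
  have hNr : (N : ℝ) - r ≠ 0 := sub_ne_zero.2 (by exact_mod_cast hr.ne')
  have ht' : (t : ℝ) ≠ 0 := by exact_mod_cast ht
  have he' : (e : ℝ) ≠ 0 := by exact_mod_cast (by omega : e ≠ 0)
  have hK' : (K : ℝ) ≠ 0 := by exact_mod_cast (by omega : K ≠ 0)
  rw [h']
  push_cast
  field_simp
  ring

theorem rate_formula_eq {N r : ℝ} (hN : N ≠ 0) (M : ℕ) :
    (N - r) * N ^ (M + 1) / (N ^ (M + 2) - r ^ (M + 2)) = (1 - r / N) / (1 - (r / N) ^ (M + 2)) := by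
  have h1 : 1 - r / N = (N - r) / N := by field_simp
  have h2 : 1 - (r / N) ^ (M + 2) = (N ^ (M + 2) - r ^ (M + 2)) / N ^ (M + 2) := by
    rw [div_pow]; field_simp
  rw [h1, h2, div_div_div_eq]
  generalize N ^ (M + 2) - r ^ (M + 2) = d
  rw [pow_succ N (M + 1), mul_comm N d, ← mul_assoc (N - r), mul_div_mul_right _ _ hN]

end OneShotPIR

end

theorem theorem2 {F : Type*} [Field F] [Fintype F] [DecidableEq F]
    (N K T M : ℕ) [NeZero M] (hK : 1 ≤ K) (hT : 1 ≤ T) (hN : K + T ≤ N) (hM : 2 ≤ M) :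
    (∀ x y z : Fin N → F, Function.Injective x → (∀ i, y i ≠ 0) → (∀ i, z i ≠ 0) →
      OneShotPIR.IsStarPair K T (OneShotPIR.rowSpace (OneShotPIR.grsMatrix K x y))
        (OneShotPIR.rowSpace (OneShotPIR.grsMatrix T x z))) ∧
    ∀ (G : Matrix (Fin K) (Fin N) F) (H : Matrix (Fin T) (Fin N) F),
      OneShotPIR.IsStarPair K T (OneShotPIR.rowSpace G) (OneShotPIR.rowSpace H) →
      ∃ ℓ ρ : ℕ, 1 ≤ ℓ ∧ 1 ≤ ρ ∧
        (∀ m : Fin M, ∃ a : Fin N → OneShotPIR.Query F M ℓ,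
          OneShotPIR.IsOneShot G T (K + T - 1) m (OneShotPIR.starNoise M ℓ H) a) ∧
        ∃ Q : OneShotPIR.Scheme F M ℓ (OneShotPIR.LiftLabel N (K + T - 1) M ρ),
          OneShotPIR.IsRefinedLifting G (OneShotPIR.starNoise M ℓ H) Q ∧
          OneShotPIR.IsPIRScheme G T OneShotPIR.LiftLabel.server Q ∧
          OneShotPIR.rate K ℓ (OneShotPIR.LiftLabel N (K + T - 1) M ρ) =
            ((N : ℝ) - K - T + 1) * (N : ℝ) ^ (M - 1) /
              ((N : ℝ) ^ M - ((K : ℝ) + T - 1) ^ M) ∧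
          OneShotPIR.rate K ℓ (OneShotPIR.LiftLabel N (K + T - 1) M ρ) =
            (1 - ((K : ℝ) + T - 1) / N) / (1 - (((K : ℝ) + T - 1) / N) ^ M) := by
  refine ⟨fun x y z hx hy hz => OneShotPIR.grs_isStarPair hK hT hN x y z hx hy hz, ?_⟩
  rintro G H ⟨hGmds, hHmds, hGH⟩
  obtain ⟨M, rfl⟩ : ∃ M', M = M' + 2 := ⟨M - 2, by omega⟩
  have hG : OneShotPIR.ColumnsSeparated G := fun S hS i => hGmds.exists_dual (by omega) S hS i
  have hH : OneShotPIR.ColumnsSeparated H := fun S hS i => hHmds.exists_dual (by omega) S hS i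
  have hr : K + T - 1 < N := by omega
  have hn : 1 ≤ N ^ M := Nat.one_le_pow _ _ (by omega)
  obtain ⟨e, E, _, _, _, bas, pD, pU, he, hpD, hpU⟩ :=
    OneShotPIR.exists_query_laws hG hH hT hN (N ^ M)
  obtain ⟨γ, π, hγ, hπ⟩ := OneShotPIR.exists_group_perms (M := M) hr
  have hcoord : Fintype.card (OneShotPIR.Coord N K T (N ^ M)) = N ^ M * N := by
    have hmax : max T K ≤ N := max_le (by omega) (by omega)
    simp only [Fintype.card_sum, Fintype.card_prod, Fintype.card_fin]
    rw [← Nat.mul_add, Nat.add_sub_cancel' hmax]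
  let el : Fin (e * (N ^ M * N)) ≃ Fin e × OneShotPIR.Coord N K T (N ^ M) :=
    (Fintype.equivFinOfCardEq (by rw [Fintype.card_prod, Fintype.card_fin, hcoord])).symm
  let er : Fin (e * K) ≃ Fin e × Fin K := finProdFinEquiv.symm
  have hℓ : N ≤ e * (N ^ M * N) :=
    (Nat.le_mul_of_pos_left N hn).trans (Nat.le_mul_of_pos_left _ he)
  have hlift := OneShotPIR.isRefinedLifting_liftedScheme H bas el er γ π pD pU hpD hγ hπ
  have hr' : (K : ℝ) + T - 1 = ((K + T - 1 : ℕ) : ℝ) := by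
    rw [Nat.cast_sub (by omega)]; push_cast; rfl
  have hrate := OneShotPIR.rate_liftLabel (M := M) hr he hK
  refine ⟨e * (N ^ M * N), e * K, by omega, Nat.mul_pos he hK,
    fun m => OneShotPIR.exists_isOneShot hG hH hGH hK hr.le hℓ m,
    OneShotPIR.liftedScheme H bas el er γ π pD pU, hlift, ⟨hGmds, ?_, ?_⟩, ?_, ?_⟩
  · exact OneShotPIR.isCorrect_of_eq_zero fun m q hq W hW =>
      hlift.eq_zero hGH hr (by ring) hq W hW
  · exact OneShotPIR.isPrivate_of_map_eq fun J hJ m m' =>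
      OneShotPIR.map_liftedScheme H bas el er γ π pD pU J (hpU J hJ) m m'
  · rw [hrate, ← hr']
    congr 2
    ring
  · rw [hrate, hr', OneShotPIR.rate_formula_eq]
    exact_mod_cast (by omega : N ≠ 0)
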